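/- **Setting.** Let $a=(a_1,\dots,a_d)$ with $a_i>0$ and $\sum_i a_i=d$, put $D_a(t)=\mathrm{diag}(t^{a_1},\dots,t^{a_d})$ for $t>0$, and let $|\cdot|_a$ be the anisotropic norm on $\mathbb R^d$: $|0|_a=0$ and, for $\xi\neq0$, $|\xi|_a$ is the unique $t>0$ with $|D_a(1/t)\xi|=1$. Let $d(\xi,\zeta)=|\xi-\zeta|_a$ and $B_d(\xi,r)=\{\zeta: d(\xi,\zeta)<r\}$. A positive function $h$ is $d$-moderate on a set $S\subset\mathbb R^d\setminus\{0\}$ if there are $R,\delta_0>0$ such that $R^{-1}\le h(\xi)/h(\zeta)\le R$ for all $\xi,\zeta\in S$ with $d(\xi,\zeta)\le\delta_0h(\xi)$. A *hybrid regulation function* is a function $\tilde h:\mathbb R^d\setminus\{0\}\to(0,\infty)$ of the form $\tilde h=\rho h_1+(1-\rho)h_2$, where $\rho:\mathbb R^d\setminus\{0\}\to[0,1]$ is $C^1$, $\rho=1$ for $0<|\xi|_a\le 2/3$ and $\rho=0$ for $|\xi|_a\ge 4/3$; on $\{0<|\xi|_a<4/3\}$ the function $h_1$ is $d$-moderate with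 $c_0|\xi|_a^{r}\le h_1(\xi)\le c_1|\xi|_a$; and on $\{|\xi|_a>2/3\}$ the function $h_2$ is $d$-moderate with $c_2\le h_2(\xi)\le c_3|\xi|_a$, for some $c_0,c_1,c_2,c_3>0$ and $r\ge1$. A countable family $\{Q_j\}_{j\in J}$ of measurable sets is an *admissible covering* of $\mathbb R^d\setminus\{0\}$ if its union is $\mathbb R^d\setminus\{0\}$ and the number of $i$ with $Q_i\cap Q_j\ne\emptyset$ is bounded uniformly in $j$. It is *structured*, with invertible affine maps $T_j=A_j\cdot+b_j$ and $J\neq\emptyset$, if there are bounded open sets $P\subset Q\subset\mathbb R^d\setminus\{0\}$, $P$ compactly contained in $Q$, such that $Q_j=T_jQ$, both $\{T_jP\}_j$ and $\{T_jQ\}_j$ are admissible coverings of $\mathbb R^d\setminus\{0\}$, and the entries of $A_k^{-1}A_j$ are bounded uniformly over all $j,k$ with $Q_j\cap Q_k\neq\emptyset$. A *bounded admissible partition of unity* (BAPU) for it is a family $\{\psi_j\}_{j\in J}$ with $\operatorname{supp}\psi_j\subset Q_j$, $\sum_j\psi_j=1$ on $\mathbb R^d\setminus\{0\}$, and $\sup_j|Q_j|^{1/p-1}\|\mathcal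 F^{-1}\psi_j\|_{L_p}<\infty$ for every $p\in(0,1]$. Here $\mathcal F f(\xi)=\hat f(\xi)=(2\pi)^{-d/2}\int f(x)e^{-ix\cdot\xi}\,dx$. Let $\mathcal S_0$ be the space of all $\theta\in\mathcal S(\mathbb R^d)$ such that $$\|\theta\|_M:=\sup_{|\beta|\le M}\ \sup_{\xi\neq0}|\partial^\beta\hat\theta(\xi)|\,(|\xi|^M+|\xi|^{-M})<\infty\quad\text{for all }M\in\mathbb N,$$ with the topology induced by $\mathcal S(\mathbb R^d)$, and let $\mathcal S'/\mathcal P$ be the space of all continuous linear functionals on $\mathcal S_0$. A function $\theta\in\mathcal S_0$ is identified with the functional $\eta\mapsto\int\theta\eta$. Given a hybrid regulation function $\tilde h$, let $\{Q_j\}_{j\in J}$ be a structured admissible covering of $\mathbb R^d\setminus\{0\}$ by balls $Q_j=B_d(\xi_j,\delta\tilde h(\xi_j))$, $\delta>0$, $\xi_j\ne0$, with affine maps $T_j=A_j\cdot+b_j$, $A_j=D_a(\delta\tilde h(\xi_j))$, and let $\phi_j\in\mathcal S(\mathbb R^d)$ be such that $\{\phi_j^2\}_{j\in J}$ is a BAPU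 for it. For $0<p,q\le\infty$ and $\beta\in\mathbb R$ let $\dot M^\beta_{p,q}(\tilde h)$ be the set of all $f\in\mathcal S'/\mathcal P$ with $$\|f\|_{\dot M^\beta_{p,q}(\tilde h)}=\Big(\sum_{j\in J}\big(\tilde h(\xi_j)^\beta\|\phi_j^2(D)f\|_{L_p}\big)^q\Big)^{1/q}<\infty$$ (supremum over $j$ if $q=\infty$), where $\phi_j^2(D)f=\mathcal F^{-1}(\phi_j^2\hat f)$. **Proposition.** For every such choice and all $0<p,q\le\infty$, $\beta\in\mathbb R$: 1. $\mathcal S_0\hookrightarrow\dot M^\beta_{p,q}(\tilde h)\hookrightarrow\mathcal S'/\mathcal P$ continuously. That is, the map $\theta\mapsto(\eta\mapsto\int\theta\eta)$ is injective on $\mathcal S_0$, and there are $M\in\mathbb N$ and $C<\infty$ with $\|\theta\|_{\dot M^\beta_{p,q}(\tilde h)}\le C\|\theta\|_M$ for all $\theta\in\mathcal S_0$; and there are $M\in\mathbb N$ and $C<\infty$ with $|\langle f,\theta\rangle|\le C\|f\|_{\dot M^\beta_{p,q}(\tilde h)}\|\theta\|_M$ for all $f\in\dot M^\beta_{p,q}(\tilde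 h)$ and $\theta\in\mathcal S_0$. 2. $\dot M^\beta_{p,q}(\tilde h)$ is a quasi-Banach space, and a Banach space if $p,q\ge1$. 3. If $p,q<\infty$, then $\mathcal S_0$ is dense in $\dot M^\beta_{p,q}(\tilde h)$. -/

import Mathlib

open scoped ENNReal NNReal FourierTransform SchwartzMap RealInnerProductSpace

noncomputable section

namespace HomDecomp

/-- `ℝ^d` with the Euclidean norm. -/
abbrev E (d : ℕ) : Type := EuclideanSpace ℝ (Fin d)

/-! ### Anisotropic norm -/

/-- An anisotropy on `ℝ^d`: positive exponents which sum to `d`. -/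
structure IsAnisotropy {d : ℕ} (a : Fin d → ℝ) : Prop where
  pos : ∀ i, 0 < a i
  sum_eq : ∑ i, a i = d

/-- The anisotropic dilation matrix `D_a(t) = diag(t^{a_1}, …, t^{a_d})`. -/
def dil {d : ℕ} (a : Fin d → ℝ) (t : ℝ) : Matrix (Fin d) (Fin d) ℝ :=
  Matrix.diagonal fun i => t ^ a i

/-- The anisotropic norm: `|0|_a = 0`, and for `ξ ≠ 0`, `|ξ|_a` is the unique `t > 0` with
`|D_a(1/t) ξ| = 1`. The set below is then the singleton `{t}`; for `ξ = 0` it is empty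
and `sInf ∅ = 0`. -/
def aNorm {d : ℕ} (a : Fin d → ℝ) (ξ : E d) : ℝ :=
  sInf {t : ℝ | 0 < t ∧ ‖Matrix.toEuclideanLin (dil a (1 / t)) ξ‖ = 1}

/-- The ball of radius `r` about `ξ` for the quasi-distance `d(ξ, ζ) = |ξ - ζ|_a`. -/
def aBall {d : ℕ} (a : Fin d → ℝ) (ξ : E d) (r : ℝ) : Set (E d) :=
  {ζ | aNorm a (ξ - ζ) < r}

/-! ### Hybrid regulation functions -/

/-- `h` is moderate on `S` with respect to the quasi-distance induced by `|·|_a`. -/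
def IsModerateOn {d : ℕ} (a : Fin d → ℝ) (S : Set (E d)) (h : E d → ℝ) : Prop :=
  ∃ R > 0, ∃ δ₀ > 0, ∀ ξ ∈ S, ∀ ζ ∈ S, aNorm a (ξ - ζ) ≤ δ₀ * h ξ →
    R⁻¹ ≤ h ξ / h ζ ∧ h ξ / h ζ ≤ R

/-- `h` is a hybrid regulation function: `h = ρ h₁ + (1 - ρ) h₂` off the origin with a `C¹` ramp
function `ρ`. The growth and moderateness conditions are imposed on `h₁` where `0 < |ξ|_a < 4/3`
and on `h₂` where `|ξ|_a > 2/3`, that is, where they contribute to `h`. -/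
def IsHybridRegulation {d : ℕ} (a : Fin d → ℝ) (h : E d → ℝ) : Prop :=
  ∃ (ρ h₁ h₂ : E d → ℝ) (c₀ c₁ c₂ c₃ r : ℝ),
    ContDiffOn ℝ 1 ρ {0}ᶜ ∧
    (∀ ξ ≠ 0, 0 ≤ ρ ξ ∧ ρ ξ ≤ 1) ∧
    (∀ ξ ≠ 0, aNorm a ξ ≤ 2 / 3 → ρ ξ = 1) ∧
    (∀ ξ ≠ 0, 4 / 3 ≤ aNorm a ξ → ρ ξ = 0) ∧
    IsModerateOn a {ξ | ξ ≠ 0 ∧ aNorm a ξ < 4 / 3} h₁ ∧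
    IsModerateOn a {ξ | ξ ≠ 0 ∧ 2 / 3 < aNorm a ξ} h₂ ∧
    0 < c₀ ∧ 0 < c₁ ∧ 0 < c₂ ∧ 0 < c₃ ∧ 1 ≤ r ∧
    (∀ ξ ≠ 0, aNorm a ξ < 4 / 3 → c₀ * aNorm a ξ ^ r ≤ h₁ ξ ∧ h₁ ξ ≤ c₁ * aNorm a ξ) ∧
    (∀ ξ ≠ 0, 2 / 3 < aNorm a ξ → c₂ ≤ h₂ ξ ∧ h₂ ξ ≤ c₃ * aNorm a ξ) ∧
    (∀ ξ ≠ 0, h ξ = ρ ξ * h₁ ξ + (1 - ρ ξ) * h₂ ξ)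

/-! ### Structured admissible coverings and partitions of unity -/

/-- The family `Q` is an admissible covering of `ℝ^d \ {0}`. -/
structure IsAdmissibleCovering {d : ℕ} {J : Type*} (Q : J → Set (E d)) : Prop where
  measurable : ∀ j, MeasurableSet (Q j)
  cover : ⋃ j, Q j = {0}ᶜ
  finite_overlap : ∃ N : ℕ, ∀ j, {i | (Q i ∩ Q j).Nonempty}.encard ≤ N

/-- The image of `S` under the affine map `ξ ↦ A ξ + b`. -/
def affineImage {d : ℕ} (A : Matrix (Fin d) (Fin d) ℝ) (b : E d) (S : Set (E d)) : Set (E d) :=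
  (fun ξ => Matrix.toEuclideanLin A ξ + b) '' S

/-- `{A_j Q + b_j}` is a structured admissible covering of `ℝ^d \ {0}`. -/
structure IsStructuredCovering {d : ℕ} {J : Type*} (A : J → Matrix (Fin d) (Fin d) ℝ)
    (b : J → E d) (Q : Set (E d)) : Prop where
  nonempty : Nonempty J
  countable : Countable J
  invertible : ∀ j, IsUnit (A j).det
  isOpen : IsOpen Q
  bounded : Bornology.IsBounded Q
  zero_notMem : (0 : E d) ∉ Q
  admissible : IsAdmissibleCovering fun j => affineImage (A j) (b j) Q
  exists_inner : ∃ P : Set (E d), IsOpen P ∧ IsCompact (closure P) ∧ closure P ⊆ Q ∧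
    IsAdmissibleCovering fun j => affineImage (A j) (b j) P
  exists_bound : ∃ K : ℝ, ∀ j k,
    (affineImage (A j) (b j) Q ∩ affineImage (A k) (b k) Q).Nonempty →
      ∀ m n, |((A k)⁻¹ * A j) m n| ≤ K

/-- The inverse Fourier transform `(2π)^{-d/2} ∫ g(ξ) e^{i x·ξ} dξ`. -/
def invFourierFn {d : ℕ} (g : E d → ℂ) (x : E d) : ℂ :=
  (((2 * Real.pi) ^ (-(d : ℝ) / 2) : ℝ) : ℂ) * ∫ ξ, Complex.exp (Complex.I * (⟪x, ξ⟫ : ℝ)) * g ξ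

/-- `ψ` is a bounded admissible partition of unity subordinate to the covering `Q`. -/
structure IsBAPU {d : ℕ} {J : Type*} (Q : J → Set (E d)) (ψ : J → E d → ℂ) : Prop where
  support : ∀ j, tsupport (ψ j) ⊆ Q j
  sum_eq_one : ∀ ξ ≠ 0, HasSum (fun j => ψ j ξ) 1
  bounded : ∀ p : ℝ, 0 < p → p ≤ 1 → ∃ C : ℝ≥0, ∀ j,
    MeasureTheory.volume (Q j) ^ (1 / p - 1) *
      MeasureTheory.eLpNorm (invFourierFn (ψ j)) (ENNReal.ofReal p) MeasureTheory.volume ≤ C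

/-- The data used to define the homogeneous decomposition space of a regulation function `h`:
a structured admissible covering by the balls `Q_j = B(ξ_j, δ h(ξ_j))` whose affine
maps have linear part `D_a(δ h(ξ_j))`, and Schwartz functions `φ_j` such that the `φ_j²` form a
bounded admissible partition of unity for it. -/
structure DecompositionSystem {d : ℕ} (a : Fin d → ℝ) (h : E d → ℝ) (J : Type*) where
  δ : ℝ
  δ_pos : 0 < δ
  ξ : J → E d
  ξ_ne_zero : ∀ j, ξ j ≠ 0
  covering : ∃ (b : J → E d) (Q : Set (E d)),
    IsStructuredCovering (fun j => dil a (δ * h (ξ j))) b Q ∧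
      ∀ j, affineImage (dil a (δ * h (ξ j))) (b j) Q = aBall a (ξ j) (δ * h (ξ j))
  φ : J → 𝓢(E d, ℂ)
  bapu : IsBAPU (fun j => aBall a (ξ j) (δ * h (ξ j))) (fun j η => φ j η ^ 2)

/-! ### The Fourier transform on Schwartz functions -/

/-- `ξ ↦ ξ / (2π)`. -/
def scaleEquiv (d : ℕ) : E d ≃L[ℝ] E d :=
  ContinuousLinearEquiv.smulLeft (Units.mk0 ((2 * Real.pi)⁻¹ : ℝ) (by positivity))

lemma scaleEquiv_apply {d : ℕ} (ξ : E d) : scaleEquiv d ξ = (2 * Real.pi)⁻¹ • ξ := rfl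

/-- The Fourier transform `(2π)^{-d/2} ∫ f(x) e^{-i x·ξ} dx` on Schwartz functions. -/
def fourierS (d : ℕ) : 𝓢(E d, ℂ) →L[ℂ] 𝓢(E d, ℂ) :=
  (((2 * Real.pi) ^ (-(d : ℝ) / 2) : ℝ) : ℂ) •
    ((SchwartzMap.compCLMOfContinuousLinearEquiv ℂ (scaleEquiv d)).comp
      (FourierTransform.fourierCLM ℂ 𝓢(E d, ℂ)))

lemma fourierS_apply_eq {d : ℕ} (f : 𝓢(E d, ℂ)) (ξ : E d) :
    fourierS d f ξ = (((2 * Real.pi) ^ (-(d : ℝ) / 2) : ℝ) : ℂ) *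
      𝓕 (f : E d → ℂ) ((2 * Real.pi)⁻¹ • ξ) := rfl

lemma fourierS_apply {d : ℕ} (f : 𝓢(E d, ℂ)) (ξ : E d) :
    fourierS d f ξ = (((2 * Real.pi) ^ (-(d : ℝ) / 2) : ℝ) : ℂ) *
      ∫ x, Complex.exp (-(Complex.I * (⟪x, ξ⟫ : ℝ))) * f x := by
  rw [fourierS_apply_eq, Real.fourier_eq']
  congr 2
  ext x
  rw [smul_eq_mul, inner_smul_right]
  congr 2
  push_cast
  have : (Real.pi : ℂ) ≠ 0 := by exact_mod_cast Real.pi_ne_zero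
  field_simp

lemma fourierS_fourierS {d : ℕ} (f : 𝓢(E d, ℂ)) (ξ : E d) :
    fourierS d (fourierS d f) ξ = f (-ξ) := by
  have hpi : (0 : ℝ) < 2 * Real.pi := by positivity
  have h1 := MeasureTheory.Measure.integral_comp_smul
    (MeasureTheory.volume : MeasureTheory.Measure (E d))
    (fun z => Complex.exp (-(Complex.I * (⟪(2 * Real.pi) • z, ξ⟫ : ℝ))) * 𝓕 (f : E d → ℂ) z)
    ((2 * Real.pi)⁻¹)
  have h2 : ∫ z, Complex.exp (-(Complex.I * (⟪(2 * Real.pi) • z, ξ⟫ : ℝ))) *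
      𝓕 (f : E d → ℂ) z = f (-ξ) := by
    have h3 : 𝓕⁻ (𝓕 f) (-ξ) = f (-ξ) := by rw [FourierTransform.fourierInv_fourier_eq]
    rw [← h3, SchwartzMap.fourierInv_coe, Real.fourierInv_eq']
    congr 1
    ext z
    rw [smul_eq_mul, inner_smul_left, inner_neg_right]
    congr 2
    simp
    ring
  rw [h2] at h1
  rw [fourierS_apply]
  simp_rw [fourierS_apply_eq]
  simp only [smul_smul, mul_inv_cancel₀ hpi.ne', one_smul] at h1
  have h4 : ∀ x : E d, Complex.exp (-(Complex.I * (⟪x, ξ⟫ : ℝ))) *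
      ((((2 * Real.pi) ^ (-(d : ℝ) / 2) : ℝ) : ℂ) * 𝓕 (f : E d → ℂ) ((2 * Real.pi)⁻¹ • x)) =
      (((2 * Real.pi) ^ (-(d : ℝ) / 2) : ℝ) : ℂ) * (Complex.exp (-(Complex.I * (⟪x, ξ⟫ : ℝ))) *
      𝓕 (f : E d → ℂ) ((2 * Real.pi)⁻¹ • x)) := fun x => by ring
  simp_rw [h4]
  rw [MeasureTheory.integral_const_mul, h1, ← mul_assoc, Complex.real_smul, ← mul_assoc,
    ← Complex.ofReal_mul, ← Complex.ofReal_mul]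
  have h5 : (2 * Real.pi) ^ (-(d : ℝ) / 2) * (2 * Real.pi) ^ (-(d : ℝ) / 2) *
      |((2 * Real.pi)⁻¹ ^ Module.finrank ℝ (E d))⁻¹| = 1 := by
    rw [← Real.rpow_add hpi, abs_of_pos (by positivity), finrank_euclideanSpace_fin, inv_pow,
      inv_inv, ← Real.rpow_natCast, ← Real.rpow_add hpi]
    ring_nf
    simp
  rw [h5]
  simp

/-! ### The space `𝓢₀` and its dual -/

/-- `‖θ‖_M = sup_{|β| ≤ M} sup_{ξ ≠ 0} |∂^β θ̂(ξ)| (|ξ|^M + |ξ|^{-M})`, with the partial derivatives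
written as `∂_{v 1} ⋯ ∂_{v n}`. -/
def s0Norm {d : ℕ} (M : ℕ) (θ : 𝓢(E d, ℂ)) : ℝ≥0∞ :=
  ⨆ (n : ℕ) (_ : n ≤ M) (v : Fin n → Fin d) (ξ : E d) (_ : ξ ≠ 0),
    ENNReal.ofReal (‖iteratedFDeriv ℝ n (fourierS d θ) ξ fun i => EuclideanSpace.single (v i) 1‖ *
      (‖ξ‖ ^ M + (‖ξ‖ ^ M)⁻¹))

lemma s0Norm_add_le {d : ℕ} (M : ℕ) (θ η : 𝓢(E d, ℂ)) :
    s0Norm M (θ + η) ≤ s0Norm M θ + s0Norm M η := by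
  refine iSup_le fun n => iSup_le fun hn => iSup_le fun v => iSup_le fun ξ => iSup_le fun hξ => ?_
  have key : ∀ κ : 𝓢(E d, ℂ), ENNReal.ofReal
      (‖iteratedFDeriv ℝ n (fourierS d κ) ξ fun i => EuclideanSpace.single (v i) 1‖ *
      (‖ξ‖ ^ M + (‖ξ‖ ^ M)⁻¹)) ≤ s0Norm M κ := fun κ =>
    le_iSup_of_le n <| le_iSup_of_le hn <| le_iSup_of_le v <| le_iSup_of_le ξ <|
      le_iSup_of_le hξ le_rfl
  refine le_trans ?_ (add_le_add (key θ) (key η))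
  rw [← ENNReal.ofReal_add (by positivity) (by positivity), ← add_mul]
  refine ENNReal.ofReal_le_ofReal (mul_le_mul_of_nonneg_right ?_ (by positivity))
  have : (fourierS d (θ + η) : E d → ℂ) = (fourierS d θ : E d → ℂ) + fourierS d η := by
    rw [map_add]; rfl
  rw [this, iteratedFDeriv_add_apply ((fourierS d θ).smooth n).contDiffAt
    ((fourierS d η).smooth n).contDiffAt]
  exact norm_add_le _ _

lemma s0Norm_smul_le {d : ℕ} (M : ℕ) (c : ℂ) (θ : 𝓢(E d, ℂ)) :
    s0Norm M (c • θ) ≤ ENNReal.ofReal ‖c‖ * s0Norm M θ := by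
  refine iSup_le fun n => iSup_le fun hn => iSup_le fun v => iSup_le fun ξ => iSup_le fun hξ => ?_
  have key : ENNReal.ofReal
      (‖iteratedFDeriv ℝ n (fourierS d θ) ξ fun i => EuclideanSpace.single (v i) 1‖ *
      (‖ξ‖ ^ M + (‖ξ‖ ^ M)⁻¹)) ≤ s0Norm M θ :=
    le_iSup_of_le n <| le_iSup_of_le hn <| le_iSup_of_le v <| le_iSup_of_le ξ <|
      le_iSup_of_le hξ le_rfl
  refine le_trans ?_ (mul_le_mul_right key _)
  rw [← ENNReal.ofReal_mul (by positivity), ← mul_assoc]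
  refine ENNReal.ofReal_le_ofReal (mul_le_mul_of_nonneg_right ?_ (by positivity))
  have : (fourierS d (c • θ) : E d → ℂ) = c • (fourierS d θ : E d → ℂ) := by
    rw [map_smul]; rfl
  rw [this, iteratedFDeriv_const_smul_apply ((fourierS d θ).smooth n).contDiffAt]
  exact (norm_smul c _).le

/-- The space `𝓢₀(ℝ^d)` of Schwartz functions `θ` with `‖θ‖_M < ∞` for all `M`; it carries the
topology induced by the Schwartz space. -/
def S0 (d : ℕ) : Submodule ℂ 𝓢(E d, ℂ) where
  carrier := {θ | ∀ M, s0Norm M θ < ∞}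
  add_mem' hθ hη M := (s0Norm_add_le M _ _).trans_lt (ENNReal.add_lt_top.2 ⟨hθ M, hη M⟩)
  zero_mem' M := by
    have := s0Norm_smul_le M 0 (0 : 𝓢(E d, ℂ))
    simp only [norm_zero, ENNReal.ofReal_zero, zero_mul, smul_zero] at this
    exact this.trans_lt ENNReal.zero_lt_top
  smul_mem' c _ hθ M := (s0Norm_smul_le M c _).trans_lt (ENNReal.mul_lt_top ENNReal.ofReal_lt_top (hθ M))

/-- Tempered distributions modulo polynomials: the continuous linear functionals on `𝓢₀`. -/
abbrev SModP (d : ℕ) : Type := S0 d →L[ℂ] ℂ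

/-- The functional `η ↦ ∫ θ η` defined by `θ ∈ 𝓢₀`. -/
def toSModP {d : ℕ} (θ : S0 d) : SModP d :=
  ((SchwartzMap.integralCLM ℂ MeasureTheory.volume).comp
    (SchwartzMap.pairing (ContinuousLinearMap.mul ℂ ℂ) (θ : 𝓢(E d, ℂ)))).comp (S0 d).subtypeL

lemma toSModP_apply {d : ℕ} (θ η : S0 d) :
    toSModP θ η = ∫ x, (θ : 𝓢(E d, ℂ)) x * (η : 𝓢(E d, ℂ)) x := rfl

/-- The Fourier transform of a Schwartz function supported away from the origin is in `𝓢₀`. -/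
lemma fourierS_mem_S0 {d : ℕ} {η : 𝓢(E d, ℂ)} (h : (0 : E d) ∉ tsupport η) :
    fourierS d η ∈ S0 d := by
  intro M
  have h0 : (fourierS d (fourierS d η) : E d → ℂ) = η ∘ LinearIsometryEquiv.neg ℝ :=
    funext fun ξ => fourierS_fourierS η ξ
  obtain ⟨ε, hε, hball⟩ := Metric.isOpen_iff.1 (isClosed_tsupport (η : E d → ℂ)).isOpen_compl 0 h
  have hbd : ∀ n, ∃ C : ℝ, 0 ≤ C ∧ ∀ ξ : E d, ξ ≠ 0 →
      ‖iteratedFDeriv ℝ n η ξ‖ * (‖ξ‖ ^ M + (‖ξ‖ ^ M)⁻¹) ≤ C := by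
    intro n
    obtain ⟨C₁, hC₁, h₁⟩ := η.decay M n
    obtain ⟨C₂, hC₂, h₂⟩ := η.decay 0 n
    refine ⟨C₁ + C₂ * (ε ^ M)⁻¹, by positivity, fun ξ hξ => ?_⟩
    by_cases hξε : ‖ξ‖ < ε
    · have : iteratedFDeriv ℝ n η ξ = 0 := by
        by_contra hne
        have := support_iteratedFDeriv_subset (𝕜 := ℝ) (f := (η : E d → ℂ)) n
          (Function.mem_support.2 hne)
        exact hball (by simpa using hξε) this
      rw [this, norm_zero, zero_mul]
      positivity
    · rw [mul_add, mul_comm]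
      refine add_le_add (h₁ ξ) ?_
      refine mul_le_mul (by simpa using h₂ ξ) ?_ (by positivity) hC₂.le
      exact inv_anti₀ (by positivity) (pow_le_pow_left₀ hε.le (not_lt.1 hξε) M)
  choose C hC0 hC using hbd
  refine lt_of_le_of_lt (b := ENNReal.ofReal (∑ n ∈ Finset.range (M + 1), C n)) ?_
    ENNReal.ofReal_lt_top
  refine iSup_le fun n => iSup_le fun hn => iSup_le fun v => iSup_le fun ξ => iSup_le fun hξ => ?_
  refine ENNReal.ofReal_le_ofReal (le_trans ?_ (Finset.single_le_sum (fun i _ => hC0 i)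
    (Finset.mem_range.2 (Nat.lt_succ_of_le hn))))
  have hξ' := hC n (-ξ) (neg_ne_zero.2 hξ)
  rw [norm_neg] at hξ'
  refine le_trans (mul_le_mul_of_nonneg_right ?_ (by positivity)) hξ'
  refine (ContinuousMultilinearMap.le_opNorm _ _).trans ?_
  have h6 : ‖iteratedFDeriv ℝ n (fourierS d (fourierS d η)) ξ‖ = ‖iteratedFDeriv ℝ n η (-ξ)‖ := by
    rw [h0]
    exact LinearIsometryEquiv.norm_iteratedFDeriv_comp_right (LinearIsometryEquiv.neg ℝ) η ξ n
  rw [h6]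
  simp

/-! ### Fourier multipliers and the spaces -/

lemma hasTemperateGrowth_cexp : (fun t : ℝ => Complex.exp (Complex.I * t)).HasTemperateGrowth := by
  have h1 : ∀ n : ℕ, iteratedDeriv n (fun t : ℝ => Complex.exp (Complex.I * t)) =
      fun t : ℝ => Complex.I ^ n * Complex.exp (Complex.I * t) := by
    intro n
    induction n with
    | zero => simp
    | succ n ih =>
      rw [iteratedDeriv_succ, ih]
      ext t
      have h2 : HasDerivAt (fun t : ℝ => Complex.I * (t : ℂ)) (Complex.I * 1) t :=
        (Complex.ofRealCLM.hasDerivAt (x := t)).const_mul Complex.I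
      rw [(h2.cexp.const_mul (Complex.I ^ n)).deriv]
      ring
  refine ⟨Complex.contDiff_exp.comp (contDiff_const.mul Complex.ofRealCLM.contDiff), fun n =>
    ⟨0, 1, fun t => ?_⟩⟩
  rw [norm_iteratedFDeriv_eq_norm_iteratedDeriv, h1]
  simp [Complex.norm_exp]

/-- The Schwartz function `ξ ↦ e^{i x·ξ} φ(ξ)²`. -/
def modSq {d : ℕ} (φ : 𝓢(E d, ℂ)) (x : E d) : 𝓢(E d, ℂ) :=
  SchwartzMap.smulLeftCLM ℂ (fun ξ => Complex.exp (Complex.I * (⟪x, ξ⟫ : ℝ)))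
    (SchwartzMap.pairing (ContinuousLinearMap.mul ℂ ℂ) φ φ)

lemma modSq_apply {d : ℕ} (φ : 𝓢(E d, ℂ)) (x ξ : E d) :
    modSq φ x ξ = Complex.exp (Complex.I * (⟪x, ξ⟫ : ℝ)) * φ ξ ^ 2 := by
  rw [modSq, SchwartzMap.smulLeftCLM_apply_apply, SchwartzMap.pairing_apply_apply,
    ContinuousLinearMap.mul_apply', smul_eq_mul, sq]
  exact hasTemperateGrowth_cexp.comp (Function.hasTemperateGrowth_inner_right x)

lemma zero_notMem_tsupport_modSq {d : ℕ} {φ : 𝓢(E d, ℂ)}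
    (h : (0 : E d) ∉ tsupport fun ξ => φ ξ ^ 2) (x : E d) : (0 : E d) ∉ tsupport (modSq φ x) := by
  have : (modSq φ x : E d → ℂ) =
      (fun ξ => Complex.exp (Complex.I * (⟪x, ξ⟫ : ℝ))) * fun ξ => φ ξ ^ 2 :=
    funext fun ξ => modSq_apply φ x ξ
  rw [this]
  exact fun h' => h (tsupport_mul_subset_right h')

lemma DecompositionSystem.zero_notMem {d : ℕ} {a : Fin d → ℝ} {h : E d → ℝ} {J : Type*}
    (D : DecompositionSystem a h J) (j : J) : (0 : E d) ∉ tsupport fun η => D.φ j η ^ 2 := by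
  intro h0
  obtain ⟨b, Q, hQ, hb⟩ := D.covering
  have h1 : (0 : E d) ∈ ⋃ j, affineImage (dil a (D.δ * h (D.ξ j))) (b j) Q :=
    Set.mem_iUnion.2 ⟨j, by rw [hb]; exact D.bapu.support j h0⟩
  rw [hQ.admissible.cover] at h1
  exact h1 rfl

/-- The pairing `⟨f̂, η⟩ = ⟨f, η̂⟩` of the Fourier transform of `f` with a Schwartz function `η`
supported away from the origin. -/
def fourierPairing {d : ℕ} (f : SModP d) (η : 𝓢(E d, ℂ)) (h : (0 : E d) ∉ tsupport η) : ℂ :=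
  f ⟨fourierS d η, fourierS_mem_S0 h⟩

/-- The smooth function `φ_j²(D) f = 𝓕⁻¹(φ_j² f̂)`, which is the inverse Fourier transform of a compactly
supported distribution and so has the value `(2π)^{-d/2} ⟨f̂, φ_j² e^{i x·}⟩` at `x`. -/
def DecompositionSystem.multiplier {d : ℕ} {a : Fin d → ℝ} {h : E d → ℝ} {J : Type*}
    (D : DecompositionSystem a h J) (j : J) (f : SModP d) (x : E d) : ℂ :=
  (((2 * Real.pi) ^ (-(d : ℝ) / 2) : ℝ) : ℂ) *
    fourierPairing f (modSq (D.φ j) x) (zero_notMem_tsupport_modSq (D.zero_notMem j) x)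

/-- The `ℓ_q` quasi-norm, `0 < q ≤ ∞`. -/
def seqNorm {J : Type*} (q : ℝ≥0∞) (x : J → ℝ≥0∞) : ℝ≥0∞ :=
  if q = ∞ then ⨆ j, x j else (∑' j, x j ^ q.toReal) ^ (1 / q.toReal)

/-- The quasi-norm of the homogeneous decomposition space
`Ṁ^β_{p,q}(h) = {f ∈ 𝓢'/𝓟 | ‖f‖ < ∞}`. -/
def DecompositionSystem.norm {d : ℕ} {a : Fin d → ℝ} {h : E d → ℝ} {J : Type*}
    (D : DecompositionSystem a h J) (p q : ℝ≥0∞) (β : ℝ) (f : SModP d) : ℝ≥0∞ :=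
  seqNorm q fun j => ENNReal.ofReal (h (D.ξ j) ^ β) *
    MeasureTheory.eLpNorm (D.multiplier j f) p MeasureTheory.volume

/-- `{v | N v < ∞}` is a linear subspace of `V` on which `N` is a quasi-norm with constant `κ` in the
quasi-triangle inequality, and it is complete. For `κ = 1` it is a Banach space. -/
structure IsQuasiBanach {V : Type*} [AddCommGroup V] [Module ℂ V] (N : V → ℝ≥0∞) (κ : ℝ≥0) :
    Prop where
  eq_zero_iff : ∀ v, N v = 0 ↔ v = 0
  smul : ∀ (c : ℂ) (v : V), N v < ∞ → N (c • v) = ENNReal.ofReal ‖c‖ * N v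
  add_le : ∀ u v : V, N u < ∞ → N v < ∞ → N (u + v) ≤ κ * (N u + N v)
  complete : ∀ u : ℕ → V, (∀ n, N (u n) < ∞) →
    (∀ ε > 0, ∃ n₀, ∀ m ≥ n₀, ∀ n ≥ n₀, N (u m - u n) ≤ ε) →
    ∃ v, N v < ∞ ∧ Filter.Tendsto (fun n => N (u n - v)) Filter.atTop (nhds 0)

end HomDecomp

end

open HomDecomp

open MeasureTheory Filter Topology

noncomputable section

namespace HomDecomp

/-! ### The Fourier transform on Schwartz functions: inversion, duality and convolution -/

section Fourier

variable {d : ℕ}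

/-! Frequencies are measured by the weight wt(ξ) = |ξ| + 1/|ξ|. The inner covering by the T_j P,
together with 0 ∉ T_j Q, forces every ball Q_j, seen at its own scale, to keep a fixed distance from
the origin, even after a slight enlargement (`exists_enlargement`). Hence on the enlarged ball the
weight, the radius δh(ξ_j), its inverse, and with them h(ξ_j)^β, are bounded by powers of wt(ξ_j)
(`exists_comparison`). Bounded overlap gives Σ_j wt(ξ_j)^{-L} < ∞ for some L (`exists_summable`).
Transforms of functions in 𝓢₀ decay, with all derivatives, faster than every power of the weight, so
polynomial losses are harmless.

Embedding of 𝓢₀: the φ_j² are uniform L_p multipliers on functions with spectrum in ellipsoids of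
the scale of Q_j (`exists_eLpNorm_mulS_psi_le`). This is Young's inequality for p ≥ 1; for p < 1 it
is replaced by a convolution inequality for band-limited functions. As the φ_j² come without
derivative bounds, smooth cutoffs χ_j equal to 1 near Q_j are inserted, and 𝓕⁻¹(χ_j 𝓕θ) is small by
the decay of 𝓕θ.

Embedding into 𝓢'/𝓟: f extends to a tempered distribution U by Hahn–Banach, and φ_j²(D)f is the
continuous function `band U (D.psi j)`, whose pairings are computed by `integral_mul_band`. If the
spectrum of θ is compact and avoids 0, then ⟨f, θ⟩ is a finite sum of pairings of φ_j²(D)f with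
𝓕(χ_j 𝓕⁻¹θ). A Nikol'skij inequality from L_p to L_∞ with polynomial constant bounds each of them
(`exists_enorm_band_le`), and such θ are dense in 𝓢₀ (`exists_tendsto_of_mem_S0`).

Completeness: by the second embedding a Cauchy sequence converges pointwise on 𝓢₀, and by Fatou's
lemma the quasi-norm is lower semicontinuous for this convergence (`norm_le_of_tendsto`).

Density: since q < ∞ and the overlap is bounded, f is approximated by finite sums of pieces φ_j²(D)f
(`exists_norm_sub_sum_piece_lt`). Since p < ∞, each piece is approximated by its products with
mollifiers whose spectrum shrinks to 0; these products are Schwartz functions with spectrum near Q_j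
(`exists_norm_piece_sub_lt`). -/

/-- The normalising constant `(2π)^{-d/2}`. -/
def fourierConst (d : ℕ) : ℝ := (2 * Real.pi) ^ (-(d : ℝ) / 2)

lemma fourierConst_pos (d : ℕ) : 0 < fourierConst d := Real.rpow_pos_of_pos (by positivity) _

/-- The pointwise product of Schwartz functions. -/
def mulS (f : 𝓢(E d, ℂ)) : 𝓢(E d, ℂ) →L[ℂ] 𝓢(E d, ℂ) :=
  SchwartzMap.pairing (ContinuousLinearMap.mul ℂ ℂ) f

@[simp] lemma mulS_apply (f g : 𝓢(E d, ℂ)) (x : E d) : mulS f g x = f x * g x := rfl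

/-- The reflection `f ↦ f(-·)`. -/
def reflS (d : ℕ) : 𝓢(E d, ℂ) →L[ℂ] 𝓢(E d, ℂ) :=
  SchwartzMap.compCLMOfContinuousLinearEquiv ℂ (ContinuousLinearEquiv.neg ℝ)

@[simp] lemma reflS_apply (f : 𝓢(E d, ℂ)) (x : E d) : reflS d f x = f (-x) := rfl

/-- The inverse Fourier transform. -/
def invS (d : ℕ) : 𝓢(E d, ℂ) →L[ℂ] 𝓢(E d, ℂ) := (reflS d).comp (fourierS d)

lemma invS_apply (f : 𝓢(E d, ℂ)) (x : E d) : invS d f x = fourierS d f (-x) := rfl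

lemma invFourierFn_eq (f : 𝓢(E d, ℂ)) : invFourierFn f = invS d f := by
  ext x
  rw [invS_apply, fourierS_apply, invFourierFn]
  congr 2
  ext ξ
  rw [inner_neg_right, real_inner_comm]
  simp

lemma fourierS_reflS (f : 𝓢(E d, ℂ)) : fourierS d (reflS d f) = reflS d (fourierS d f) := by
  ext x
  rw [reflS_apply, fourierS_apply, fourierS_apply]
  congr 1
  rw [← integral_neg_eq_self]
  congr 1
  ext y
  simp

@[simp] lemma invS_fourierS (f : 𝓢(E d, ℂ)) : invS d (fourierS d f) = f := by
  ext x; simp [invS_apply, fourierS_fourierS]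

@[simp] lemma fourierS_invS (f : 𝓢(E d, ℂ)) : fourierS d (invS d f) = f := by
  rw [invS, ContinuousLinearMap.comp_apply, fourierS_reflS]
  ext x; simp [fourierS_fourierS]

lemma fourierS_eq_vectorFourier (f : 𝓢(E d, ℂ)) (ξ : E d) :
    fourierS d f ξ = (fourierConst d : ℂ) *
      VectorFourier.fourierIntegral Real.probChar volume (innerₗ (E d)) f ξ := by
  rw [fourierS_apply, VectorFourier.fourierIntegral_probChar]
  simp only [smul_eq_mul, fourierConst, innerₗ_apply_apply]
  congr 2
  ext x
  congr 2
  simp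
  ring

lemma integral_fourierS_mul (f g : 𝓢(E d, ℂ)) :
    ∫ ξ, fourierS d f ξ * g ξ = ∫ x, f x * fourierS d g x := by
  have h := VectorFourier.integral_fourierIntegral_smul_eq_flip (L := innerₗ (E d))
    (μ := volume) (ν := volume) (e := Real.probChar) (f := f) (g := g)
    Real.continuous_probChar (by simpa [innerₗ_apply_apply] using continuous_inner)
    f.integrable g.integrable
  have hflip : (innerₗ (E d)).flip = innerₗ (E d) := by
    ext x y; simp [innerₗ_apply_apply]
  rw [hflip] at h
  simp only [smul_eq_mul] at h
  simp_rw [fourierS_eq_vectorFourier, mul_assoc, mul_left_comm _ (fourierConst d : ℂ)]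
  rw [integral_const_mul, integral_const_mul, h]

/-- Modulation by the character `e^{i y·ξ}`. -/
def modS (y : E d) : 𝓢(E d, ℂ) →L[ℂ] 𝓢(E d, ℂ) :=
  SchwartzMap.smulLeftCLM ℂ (fun ξ => Complex.exp (Complex.I * (⟪y, ξ⟫ : ℝ)))

lemma modS_apply (y : E d) (f : 𝓢(E d, ℂ)) (ξ : E d) :
    modS y f ξ = Complex.exp (Complex.I * (⟪y, ξ⟫ : ℝ)) * f ξ := by
  rw [modS, SchwartzMap.smulLeftCLM_apply_apply, smul_eq_mul]
  exact hasTemperateGrowth_cexp.comp (Function.hasTemperateGrowth_inner_right y)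

/-- Translation `f ↦ f(· - y)`. -/
abbrev transS (y : E d) : 𝓢(E d, ℂ) →L[ℂ] 𝓢(E d, ℂ) := SchwartzMap.compSubConstCLM ℂ y

lemma fourierS_modS (y : E d) (f : 𝓢(E d, ℂ)) :
    fourierS d (modS y f) = transS y (fourierS d f) := by
  ext x
  rw [SchwartzMap.compSubConstCLM_apply, fourierS_apply, fourierS_apply]
  congr 2
  ext ξ
  rw [modS_apply, ← mul_assoc, ← Complex.exp_add, inner_sub_right, real_inner_comm ξ y]
  congr 2
  push_cast
  ring

lemma modSq_eq (φ : 𝓢(E d, ℂ)) (x : E d) : modSq φ x = modS x (mulS φ φ) := rfl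

/-- The convolution theorem follows from the duality `integral_fourierS_mul` for `invS d g` and a
modulation of `f`, because the transform turns modulation into translation. -/
lemma fourierS_mulS (f g : 𝓢(E d, ℂ)) (y : E d) :
    fourierS d (mulS f g) y =
      (fourierConst d : ℂ) * ∫ x, fourierS d g x * fourierS d f (y - x) := by
  have h := integral_fourierS_mul (invS d g) (modS (-y) f)
  rw [fourierS_invS, fourierS_modS] at h
  rw [fourierS_apply]
  have h1 : ∀ x, Complex.exp (-(Complex.I * (⟪x, y⟫ : ℝ))) * mulS f g x = g x * modS (-y) f x := by
    intro x
    rw [modS_apply, mulS_apply, inner_neg_left, real_inner_comm]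
    push_cast
    ring_nf
  simp_rw [h1, h]
  congr 1
  rw [← integral_neg_eq_self]
  congr 1
  ext x
  simp only [invS_apply, SchwartzMap.compSubConstCLM_apply, neg_neg, sub_neg_eq_add]
  rw [neg_add_eq_sub]

lemma invS_mulS (f g : 𝓢(E d, ℂ)) (y : E d) :
    invS d (mulS f g) y =
      (fourierConst d : ℂ) * ∫ x, invS d g x * invS d f (y - x) := by
  rw [invS_apply, fourierS_mulS, ← integral_neg_eq_self]
  simp only [invS_apply]
  congr 3
  ext x
  congr 2
  abel

lemma mulS_comm (f g : 𝓢(E d, ℂ)) : mulS f g = mulS g f := by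
  ext x; simp [mul_comm]

end Fourier

end HomDecomp

end

open MeasureTheory Filter Topology

noncomputable section

namespace HomDecomp

/-! ### Anisotropic dilations -/

section Dilation

variable {d : ℕ} {a : Fin d → ℝ}

/-- The anisotropic dilation by `t` as a linear map. -/
def dl (a : Fin d → ℝ) (t : ℝ) : E d →ₗ[ℝ] E d := Matrix.toEuclideanLin (dil a t)

lemma dl_apply (t : ℝ) (x : E d) (i : Fin d) : dl a t x i = t ^ a i * x i := by
  simp [dl, dil, Matrix.toLpLin_apply, Matrix.mulVec_diagonal]

lemma dl_dl {s t : ℝ} (hs : 0 ≤ s) (ht : 0 ≤ t) (x : E d) : dl a s (dl a t x) = dl a (s * t) x := by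
  ext i
  simp only [dl_apply]
  rw [Real.mul_rpow hs ht, mul_assoc]

lemma dl_one (x : E d) : dl a 1 x = x := by
  ext i; simp [dl_apply]

lemma dl_dl_inv {t : ℝ} (ht : 0 < t) (x : E d) : dl a t (dl a t⁻¹ x) = x := by
  rw [dl_dl ht.le (inv_pos.2 ht).le, mul_inv_cancel₀ ht.ne', dl_one]

lemma dl_inv_dl {t : ℝ} (ht : 0 < t) (x : E d) : dl a t⁻¹ (dl a t x) = x := by
  rw [dl_dl (inv_pos.2 ht).le ht.le, inv_mul_cancel₀ ht.ne', dl_one]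

lemma norm_dl_le {s K : ℝ} (hs : 0 ≤ s) (hK : 0 ≤ K) (h : ∀ i, s ^ a i ≤ K) (x : E d) :
    ‖dl a s x‖ ≤ K * ‖x‖ := by
  rw [EuclideanSpace.norm_eq, EuclideanSpace.norm_eq]
  refine Real.sqrt_le_iff.2 ⟨by positivity, ?_⟩
  rw [mul_pow, Real.sq_sqrt (by positivity), Finset.mul_sum]
  refine Finset.sum_le_sum fun i _ => ?_
  rw [dl_apply, norm_mul, mul_pow]
  have : ‖s ^ a i‖ = s ^ a i := Real.norm_of_nonneg (Real.rpow_nonneg hs _)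
  rw [this]
  gcongr
  exact h i

/-- Otherwise the ℓ¹ norm would be at most e d/(d+1) < e. The denominator d + 1 gives the strict
inequality and covers d = 0. -/
lemma exists_coord_ge {e : ℝ} (he : 0 < e) {x : E d} (hx : e ≤ ‖x‖) :
    ∃ i, e / (d + 1) ≤ |x i| := by
  by_contra! hcon
  have h1 : ‖x‖ ≤ ∑ i, |x i| := by
    rw [EuclideanSpace.norm_eq]
    refine Real.sqrt_le_iff.2 ⟨Finset.sum_nonneg fun i _ => abs_nonneg _, ?_⟩
    exact Finset.sum_sq_le_sq_sum_of_nonneg fun i _ => norm_nonneg (x i)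
  have h2 : ∑ i, |x i| ≤ ∑ _i : Fin d, e / (d + 1) := Finset.sum_le_sum fun i _ => (hcon i).le
  rw [Finset.sum_const, Finset.card_univ, Fintype.card_fin, nsmul_eq_mul] at h2
  have h3 : (d : ℝ) * (e / (d + 1)) < e := by
    rw [mul_div_assoc', div_lt_iff₀ (by positivity)]
    nlinarith
  linarith

lemma abs_coord_le (x : E d) (i : Fin d) : |x i| ≤ ‖x‖ := by
  simpa using PiLp.norm_apply_le x i

lemma IsAnisotropy.le_dim (ha : IsAnisotropy a) (i : Fin d) : a i ≤ d := by
  rw [← ha.sum_eq]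
  exact Finset.single_le_sum (fun j _ => (ha.pos j).le) (Finset.mem_univ i)

lemma IsAnisotropy.exists_lower (ha : IsAnisotropy a) : ∃ α > 0, ∀ i, α ≤ a i := by
  rcases isEmpty_or_nonempty (Fin d) with h | h
  · exact ⟨1, one_pos, fun i => (IsEmpty.false i).elim⟩
  · obtain ⟨i, hi⟩ := Finite.exists_min a
    exact ⟨a i, ha.pos i, hi⟩

/-- Strict monotonicity makes the value t in the definition of `aNorm` unique. -/
lemma norm_dl_inv_lt (ha : IsAnisotropy a) {x : E d} (hx : x ≠ 0) {s t : ℝ} (hs : 0 < s)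
    (hst : s < t) : ‖dl a t⁻¹ x‖ < ‖dl a s⁻¹ x‖ := by
  have ht : 0 < t := hs.trans hst
  obtain ⟨i, hi⟩ : ∃ i, x i ≠ 0 := by
    by_contra! hcon
    exact hx (by ext i; simpa using hcon i)
  rw [EuclideanSpace.norm_eq, EuclideanSpace.norm_eq]
  have key : ∀ j, (t⁻¹) ^ a j < (s⁻¹) ^ a j := fun j =>
    Real.rpow_lt_rpow (inv_pos.2 ht).le (inv_strictAnti₀ hs hst) (ha.pos j)
  have h0 : ∀ j, 0 < (t⁻¹) ^ a j := fun j => Real.rpow_pos_of_pos (inv_pos.2 ht) _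
  have h0' : ∀ j, 0 < (s⁻¹) ^ a j := fun j => Real.rpow_pos_of_pos (inv_pos.2 hs) _
  refine Real.sqrt_lt_sqrt (by positivity) (Finset.sum_lt_sum (fun j _ => ?_)
    ⟨i, Finset.mem_univ i, ?_⟩)
  · simp only [dl_apply, norm_mul, mul_pow, Real.norm_of_nonneg (h0 j).le,
      Real.norm_of_nonneg (h0' j).le]
    gcongr
    exacts [(ha.pos j).le]
  · simp only [dl_apply, norm_mul, mul_pow, Real.norm_of_nonneg (h0 i).le,
      Real.norm_of_nonneg (h0' i).le]
    have : 0 < ‖x i‖ := norm_pos_iff.2 hi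
    gcongr
    exacts [ha.pos i]

lemma exists_norm_dl_inv_eq_one (ha : IsAnisotropy a) {x : E d} (hx : x ≠ 0) :
    ∃ t > 0, ‖dl a t⁻¹ x‖ = 1 := by
  obtain ⟨i, hi⟩ : ∃ i, x i ≠ 0 := by
    by_contra! hcon
    exact hx (by ext i; simpa using hcon i)
  -- At this scale the i-th coordinate has modulus exactly 1, so the norm is at least 1; it tends to
  -- 0 at infinity, and the intermediate value theorem applies.
  set s : ℝ := |x i| ^ (a i)⁻¹ with hs
  have hs0 : 0 < s := Real.rpow_pos_of_pos (abs_pos.2 hi) _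
  have h1 : 1 ≤ ‖dl a s⁻¹ x‖ := by
    refine le_trans (le_of_eq ?_) (abs_coord_le (dl a s⁻¹ x) i)
    rw [dl_apply, abs_mul, Real.inv_rpow hs0.le, hs, ← Real.rpow_mul (abs_nonneg _),
      inv_mul_cancel₀ (ha.pos i).ne', Real.rpow_one, abs_inv, abs_abs,
      inv_mul_cancel₀ (abs_pos.2 hi).ne']
  have hlim : Tendsto (fun t : ℝ => ‖dl a t⁻¹ x‖) atTop (𝓝 0) := by
    rw [← norm_zero (E := E d)]
    refine Tendsto.norm ?_
    have : Tendsto (fun t : ℝ => (fun i => dl a t⁻¹ x i)) atTop (𝓝 (fun _ => 0)) := by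
      refine tendsto_pi_nhds.2 fun j => ?_
      simp only [dl_apply]
      have h2 : Tendsto (fun t : ℝ => (t⁻¹) ^ a j) atTop (𝓝 0) := by
        have := (tendsto_rpow_neg_atTop (ha.pos j))
        refine this.congr' ?_
        filter_upwards [eventually_gt_atTop 0] with t ht
        rw [Real.inv_rpow ht.le, Real.rpow_neg ht.le]
      simpa using h2.mul_const (x j)
    have h3 := ((PiLp.continuous_toLp 2 (fun _ : Fin d => ℝ)).tendsto _).comp this
    exact h3
  obtain ⟨T, hT⟩ := ((hlim.eventually (gt_mem_nhds one_pos)).and (eventually_ge_atTop s)).exists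
  have hcont : ContinuousOn (fun t : ℝ => ‖dl a t⁻¹ x‖) (Set.Icc s T) := by
    refine ContinuousOn.norm ?_
    have : ContinuousOn (fun t : ℝ => (fun i => dl a t⁻¹ x i)) (Set.Icc s T) := by
      refine continuousOn_pi.2 fun j => ?_
      simp only [dl_apply]
      refine ContinuousOn.mul ?_ continuousOn_const
      refine ContinuousOn.rpow_const ?_ fun t ht => Or.inr (ha.pos j).le
      exact continuousOn_inv₀.mono fun t ht => (hs0.trans_le ht.1).ne'
    exact (PiLp.continuous_toLp 2 (fun _ : Fin d => ℝ)).comp_continuousOn this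
  obtain ⟨t, ht, hteq⟩ := intermediate_value_Icc' hT.2 hcont ⟨hT.1.le, h1⟩
  exact ⟨t, hs0.trans_le ht.1, hteq⟩

lemma aNorm_spec (ha : IsAnisotropy a) {x : E d} (hx : x ≠ 0) :
    0 < aNorm a x ∧ ‖dl a (aNorm a x)⁻¹ x‖ = 1 := by
  obtain ⟨t, ht, h1⟩ := exists_norm_dl_inv_eq_one ha hx
  have hset : {s : ℝ | 0 < s ∧ ‖Matrix.toEuclideanLin (dil a (1 / s)) x‖ = 1} = {t} := by
    ext s
    simp only [Set.mem_ofPred_eq, Set.mem_singleton_iff, one_div]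
    constructor
    · rintro ⟨hs, h2⟩
      rcases lt_trichotomy s t with hlt | heq | hlt
      · have := norm_dl_inv_lt ha hx hs hlt
        rw [h1] at this
        exact absurd h2 this.ne'
      · exact heq
      · have := norm_dl_inv_lt ha hx ht hlt
        rw [h1] at this
        exact absurd h2 this.ne
    · rintro rfl
      exact ⟨ht, h1⟩
  rw [aNorm, hset, csInf_singleton]
  exact ⟨ht, h1⟩

/-- Through this equivalence the anisotropic balls become ellipsoids, and only the Euclidean norm of
dilated vectors is needed afterwards. -/
lemma aNorm_lt_iff (ha : IsAnisotropy a) (x : E d) {r : ℝ} (hr : 0 < r) :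
    aNorm a x < r ↔ ‖dl a r⁻¹ x‖ < 1 := by
  rcases eq_or_ne x 0 with rfl | hx
  · have : aNorm a (0 : E d) = 0 := by
      rw [aNorm]
      convert Real.sInf_empty
      ext t
      simp
    simp [this, hr]
  · obtain ⟨h0, h1⟩ := aNorm_spec ha hx
    constructor
    · intro h
      rw [← h1]
      exact norm_dl_inv_lt ha hx h0 h
    · intro h
      by_contra! hle
      rcases hle.eq_or_lt with heq | hlt
      · rw [heq, h1] at h; exact lt_irrefl _ h
      · have := norm_dl_inv_lt ha hx hr hlt
        rw [h1] at this
        linarith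

/-- The open ellipsoid `b + D_a(t) B(0, R)`. -/
def ellip (a : Fin d → ℝ) (t : ℝ) (b : E d) (R : ℝ) : Set (E d) := {x | ‖dl a t⁻¹ (x - b)‖ < R}

lemma aBall_eq_ellip (ha : IsAnisotropy a) (b : E d) {r : ℝ} (hr : 0 < r) :
    aBall a b r = ellip a r b 1 := by
  ext x
  rw [aBall, ellip, Set.mem_ofPred_eq, Set.mem_ofPred_eq, aNorm_lt_iff ha _ hr, ← norm_neg,
    ← map_neg, neg_sub]

lemma continuous_dl (t : ℝ) : Continuous (dl a t) := (dl a t).continuous_of_finiteDimensional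

lemma isOpen_ellip (t : ℝ) (b : E d) (R : ℝ) : IsOpen (ellip a t b R) :=
  isOpen_lt ((continuous_dl _).comp (continuous_id.sub continuous_const)).norm continuous_const

/-- The normalisation Σ a_i = d makes the volume of a ball of radius t proportional to t^d. -/
lemma det_dil (ha : IsAnisotropy a) {t : ℝ} (ht : 0 < t) : (dil a t).det = t ^ d := by
  rw [dil, Matrix.det_diagonal, ← Real.rpow_sum_of_pos ht, ha.sum_eq, Real.rpow_natCast]

lemma det_dl (ha : IsAnisotropy a) {t : ℝ} (ht : 0 < t) : LinearMap.det (dl a t) = t ^ d := by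
  rw [dl, Matrix.toEuclideanLin_eq_toLin_orthonormal, LinearMap.det_toLin, det_dil ha ht]

lemma ellip_eq_image {t : ℝ} (ht : 0 < t) (b : E d) (R : ℝ) :
    ellip a t b R = (fun x => b + x) '' (dl a t '' Metric.ball 0 R) := by
  ext x
  simp only [ellip, Set.mem_ofPred_eq, Set.mem_image, Metric.mem_ball, dist_zero_right]
  constructor
  · intro h
    exact ⟨x - b, ⟨_, h, dl_dl_inv ht _⟩, by abel⟩
  · rintro ⟨_, ⟨y, hy, rfl⟩, rfl⟩
    rwa [add_sub_cancel_left, dl_inv_dl ht]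

lemma volume_ellip (ha : IsAnisotropy a) {t : ℝ} (ht : 0 < t) (b : E d) (R : ℝ) :
    volume (ellip a t b R) = ENNReal.ofReal (t ^ d) * volume (Metric.ball (0 : E d) R) := by
  rw [ellip_eq_image ht, Set.image_add_left, measure_preimage_add,
    Measure.addHaar_image_linearMap, det_dl ha ht, abs_of_pos (by positivity)]

lemma isBounded_ellip {t : ℝ} (ht : 0 < t) (b : E d) (R : ℝ) :
    Bornology.IsBounded (ellip a t b R) := by
  rw [ellip_eq_image ht]
  have h1 : Bornology.IsBounded (dl a t '' Metric.ball 0 R) :=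
    (LinearMap.toContinuousLinearMap (dl a t)).lipschitz.isBounded_image Metric.isBounded_ball
  exact (isometry_add_left b).lipschitz.isBounded_image h1

end Dilation

end HomDecomp

end

open MeasureTheory Filter Topology

noncomputable section

namespace HomDecomp

/-! ### Geometry of the covering -/

section Weight

variable {d : ℕ} {a : Fin d → ℝ}

/-- The weight `|ξ| + |ξ|⁻¹`. -/
def wt (x : E d) : ℝ := ‖x‖ + ‖x‖⁻¹

lemma two_le_wt {x : E d} (hx : x ≠ 0) : 2 ≤ wt x := by
  have h : 0 < ‖x‖ := norm_pos_iff.2 hx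
  rw [wt, ← sub_nonneg]
  have : ‖x‖ + ‖x‖⁻¹ - 2 = (‖x‖ - 1) ^ 2 * ‖x‖⁻¹ := by field_simp; ring
  rw [this]; positivity

lemma norm_le_wt (x : E d) : ‖x‖ ≤ wt x := le_add_of_nonneg_right (by positivity)

lemma inv_norm_le_wt (x : E d) : ‖x‖⁻¹ ≤ wt x := le_add_of_nonneg_left (by positivity)

lemma wt_neg (x : E d) : wt (-x) = wt x := by simp [wt]

/-- As wt ≥ 2 off the origin, constants are absorbed into the exponent, and comparisons can be
stated with natural powers alone. -/
lemma exists_pow_bound (C κ : ℝ) : ∃ K : ℕ, ∀ w : ℝ, 2 ≤ w → C * w ^ κ ≤ w ^ K := by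
  obtain ⟨k₁, hk₁⟩ := pow_unbounded_of_one_lt C (one_lt_two : (1 : ℝ) < 2)
  obtain ⟨k₂, hk₂⟩ := exists_nat_ge κ
  refine ⟨k₁ + k₂, fun w hw => ?_⟩
  rw [pow_add]
  have h1 : C ≤ w ^ k₁ := hk₁.le.trans (pow_le_pow_left₀ zero_le_two hw _)
  have h2 : w ^ κ ≤ w ^ k₂ := by
    rw [← Real.rpow_natCast]
    exact Real.rpow_le_rpow_of_exponent_le (by linarith) hk₂
  exact mul_le_mul h1 h2 (Real.rpow_nonneg (by linarith) _) (by positivity)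

/-- Polynomial comparison of points which are close relative to their anisotropic size. -/
lemma exists_growth (ha : IsAnisotropy a) {e : ℝ} (he : 0 < e) (he1 : e ≤ 1) :
    ∃ C κ : ℝ, 0 < C ∧ 0 < κ ∧ ∀ t > 0, ∀ x y : E d, x ≠ 0 → y ≠ 0 → e ≤ ‖dl a t⁻¹ x‖ →
      ‖dl a t⁻¹ (x - y)‖ ≤ 2 →
      t ≤ C * wt x ^ κ ∧ ‖y‖ ≤ C * wt x ^ κ ∧ ‖x‖⁻¹ ≤ C * wt y ^ κ := by
  obtain ⟨α, hα, hαa⟩ := ha.exists_lower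
  set e' : ℝ := e / (d + 1) with he'
  have he'0 : 0 < e' := by positivity
  have he'1 : e' ≤ 1 := by
    rw [he', div_le_one (by positivity)]
    have : (0 : ℝ) ≤ d := by positivity
    linarith
  -- All quotients a_m / a_i lie between σ and τ (`hexp`). The additional 1 in τ ensures τ ≥ 1.
  set σ : ℝ := α / (d + 1) with hσ
  set τ : ℝ := (d + 1) / α + 1 with hτ
  have hσ0 : 0 < σ := by positivity
  have hτ0 : 0 < τ := by positivity
  rcases Nat.eq_zero_or_pos d with hd | hd
  · subst hd
    exact ⟨1, 1, one_pos, one_pos, fun t _ x y hx => (hx (Subsingleton.elim _ _)).elim⟩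
  have hαd : α ≤ d := (hαa ⟨0, hd⟩).trans (ha.le_dim _)
  have hσ1 : σ ≤ 1 := by
    rw [hσ, div_le_one (by positivity)]; linarith
  have hτ1 : 1 ≤ τ := by rw [hτ]; linarith [show 0 < ((d : ℝ) + 1) / α by positivity]
  have hστ : σ⁻¹ ≤ τ := by
    rw [hσ, inv_div, hτ]; linarith
  set C₀ : ℝ := (e'⁻¹) ^ τ with hC₀
  have hinv1 : 1 ≤ e'⁻¹ := (one_le_inv₀ he'0).2 he'1
  have hC₀1 : 1 ≤ C₀ := Real.one_le_rpow hinv1 hτ0.le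
  refine ⟨5 * C₀ + e'⁻¹ * 5 ^ τ + e'⁻¹, τ, by positivity, hτ0, fun t ht x y hx hy hxe hxy => ?_⟩
  have hwx := two_le_wt hx
  have hwy := two_le_wt hy
  have hx0 : 0 < ‖x‖ := norm_pos_iff.2 hx
  have hy0 : 0 < ‖y‖ := norm_pos_iff.2 hy
  -- One coordinate of D_a(1/t)x is bounded below, so t^{a_i} ≤ |x|/e' = s. Thus every entry t^{a_m}
  -- of the dilation is at most s^{a_m/a_i}.
  obtain ⟨i, hi⟩ := exists_coord_ge he hxe
  rw [← he', dl_apply, abs_mul, Real.inv_rpow ht.le, abs_inv,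
    abs_of_pos (Real.rpow_pos_of_pos ht _)] at hi
  set s : ℝ := ‖x‖ / e' with hs
  have hs0 : 0 < s := by positivity
  have hti : t ^ a i ≤ s := by
    have h0 : 0 < t ^ a i := Real.rpow_pos_of_pos ht _
    rw [hs, le_div_iff₀ he'0]
    calc t ^ a i * e' ≤ t ^ a i * ((t ^ a i)⁻¹ * |x i|) := by gcongr
      _ = |x i| := by field_simp
      _ ≤ ‖x‖ := abs_coord_le x i
  have ht1 : t ≤ s ^ (a i)⁻¹ := by
    have := Real.rpow_le_rpow (by positivity) hti (inv_pos.2 (ha.pos i)).le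
    rwa [← Real.rpow_mul ht.le, mul_inv_cancel₀ (ha.pos i).ne', Real.rpow_one] at this
  have hexp : ∀ m, σ ≤ (a i)⁻¹ * a m ∧ (a i)⁻¹ * a m ≤ τ := by
    intro m
    have hi1 := ha.pos i
    have hid := ha.le_dim i
    have hmd := ha.le_dim m
    constructor
    · rw [hσ, div_eq_inv_mul]
      exact mul_le_mul (inv_anti₀ hi1 (by linarith)) (hαa m) hα.le (inv_pos.2 hi1).le
    · have : (a i)⁻¹ * a m ≤ α⁻¹ * (d + 1) :=
        mul_le_mul (inv_anti₀ hα (hαa i)) (by linarith) (ha.pos m).le (inv_pos.2 hα).le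
      rw [hτ, div_eq_inv_mul]; linarith
  have hiτ : (a i)⁻¹ ≤ τ := by
    have : (a i)⁻¹ ≤ α⁻¹ := inv_anti₀ hα (hαa i)
    have h2 : α⁻¹ ≤ (d + 1) / α := by
      rw [inv_eq_one_div]; gcongr; linarith [show (0 : ℝ) ≤ d by positivity]
    rw [hτ]; linarith
  have hτwx : 1 ≤ wt x ^ τ := Real.one_le_rpow (by linarith) hτ0.le
  have hτwy : 1 ≤ wt y ^ τ := Real.one_le_rpow (by linarith) hτ0.le
  have hsmall : ∀ u, 0 ≤ u → u ≤ τ → s ^ u ≤ C₀ * wt x ^ τ := by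
    intro u hu0 hu
    have h1 : s ≤ e'⁻¹ * wt x := by
      rw [hs, div_eq_inv_mul]
      gcongr
      exact norm_le_wt x
    have h2 : 1 ≤ e'⁻¹ * wt x := by nlinarith
    calc s ^ u ≤ (e'⁻¹ * wt x) ^ u := Real.rpow_le_rpow hs0.le h1 hu0
      _ ≤ (e'⁻¹ * wt x) ^ τ := Real.rpow_le_rpow_of_exponent_le h2 hu
      _ = C₀ * wt x ^ τ := Real.mul_rpow (by positivity) (by linarith)
  have h5 : 0 ≤ e'⁻¹ * (5 : ℝ) ^ τ := by positivity
  have he'i : 0 ≤ e'⁻¹ := by positivity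
  have htm : ∀ m, t ^ a m ≤ s ^ ((a i)⁻¹ * a m) := by
    intro m
    rw [Real.rpow_mul hs0.le]
    exact Real.rpow_le_rpow ht.le ht1 (ha.pos m).le
  have hyx : ∀ B, 0 ≤ B → (∀ m, t ^ a m ≤ B) → ‖y‖ ≤ ‖x‖ + B * 2 := by
    intro B hB hBm
    have h1 : ‖x - y‖ ≤ B * 2 := by
      rw [← dl_dl_inv ht (x - y)]
      exact (norm_dl_le ht.le hB hBm _).trans (by gcongr)
    have h2 := norm_sub_norm_le y x
    rw [norm_sub_rev] at h2
    linarith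
  refine ⟨?_, ?_, ?_⟩
  · have := ht1.trans (hsmall _ (inv_pos.2 (ha.pos i)).le hiτ)
    refine this.trans ?_
    gcongr
    linarith
  · have h1 := hyx (C₀ * wt x ^ τ) (by positivity) fun m =>
      (htm m).trans (hsmall _ (hσ0.le.trans (hexp m).1) (hexp m).2)
    have h2 : ‖x‖ ≤ wt x ^ τ :=
      (norm_le_wt x).trans (Real.self_le_rpow_of_one_le (by linarith) hτ1)
    have h3 : wt x ^ τ ≤ C₀ * wt x ^ τ := le_mul_of_one_le_left (by positivity) hC₀1
    calc ‖y‖ ≤ 5 * C₀ * wt x ^ τ := by linarith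
      _ ≤ _ := by gcongr; linarith
  -- If s ≥ 1, then |x| ≥ e' and the bound is trivial. If s ≤ 1, then |x| and |x - y| are both
  -- O(s^σ), hence |y| ≤ 5 s^σ, which bounds 1/s by a power of 1/|y|.
  · rcases le_total 1 s with hs1 | hs1
    · have h1 : ‖x‖⁻¹ ≤ e'⁻¹ := by
        refine inv_anti₀ he'0 ?_
        rwa [hs, le_div_iff₀ he'0, one_mul] at hs1
      calc ‖x‖⁻¹ ≤ e'⁻¹ * 1 := by linarith
        _ ≤ _ := by gcongr; linarith
    · have hB : ∀ m, t ^ a m ≤ s ^ σ := fun m =>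
        (htm m).trans (Real.rpow_le_rpow_of_exponent_ge hs0 hs1 (hexp m).1)
      have h1 := hyx (s ^ σ) (by positivity) hB
      have h2 : ‖x‖ ≤ s ^ σ := by
        have h3 : ‖x‖ ≤ s := by
          rw [hs, le_div_iff₀ he'0]
          nlinarith
        exact h3.trans (Real.self_le_rpow_of_le_one hs0.le hs1 hσ1)
      have h3 : ‖y‖ ≤ 5 * s ^ σ := by linarith [Real.rpow_nonneg hs0.le σ]
      have h4 : (s ^ σ)⁻¹ ≤ 5 * wt y := by
        have : (s ^ σ)⁻¹ ≤ 5 * ‖y‖⁻¹ := by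
          rw [← div_eq_mul_inv, le_div_iff₀ hy0, inv_mul_le_iff₀ (by positivity)]
          linarith
        exact this.trans (by gcongr; exact inv_norm_le_wt y)
      have h5 : s⁻¹ ≤ (5 * wt y) ^ σ⁻¹ := by
        have := Real.rpow_le_rpow (by positivity) h4 (inv_pos.2 hσ0).le
        rwa [Real.inv_rpow (by positivity), ← Real.rpow_mul hs0.le, mul_inv_cancel₀ hσ0.ne',
          Real.rpow_one] at this
      have h6 : (5 * wt y) ^ σ⁻¹ ≤ 5 ^ τ * wt y ^ τ := by
        rw [← Real.mul_rpow (by norm_num) (by linarith)]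
        exact Real.rpow_le_rpow_of_exponent_le (by linarith) hστ
      have h7 : ‖x‖⁻¹ = e'⁻¹ * s⁻¹ := by rw [hs]; field_simp
      have h8 : ‖x‖⁻¹ ≤ e'⁻¹ * (5 ^ τ * wt y ^ τ) := by
        rw [h7]; gcongr; exact h5.trans h6
      calc ‖x‖⁻¹ ≤ e'⁻¹ * 5 ^ τ * wt y ^ τ := by linarith
        _ ≤ _ := by gcongr; linarith [show 0 < C₀ by linarith]

end Weight

end HomDecomp

end

open MeasureTheory Filter Topology

noncomputable section

namespace HomDecomp

/-! ### Balls of the covering: comparable radii, distance from the origin, summability of weights.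
-/

section Covering

variable {d : ℕ} {a : Fin d → ℝ} {h : E d → ℝ} {J : Type*}

/-- At each point `h` is a convex combination of those among h₁, h₂ whose lower bound is available
there. The result gives positive radii and, later, polynomial bounds for their inverses. -/
lemma IsHybridRegulation.lower_bound (ha : IsAnisotropy a) (hh : IsHybridRegulation a h) :
    ∃ c > 0, ∃ r : ℝ, 0 ≤ r ∧ ∀ x ≠ 0, c * min 1 (aNorm a x ^ r) ≤ h x := by
  obtain ⟨ρ, h₁, h₂, c₀, c₁, c₂, c₃, r, -, hρ, hρ1, hρ0, -, -, hc₀, -, hc₂, -, hr, H₁, H₂, H⟩ := hh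
  refine ⟨min c₀ c₂, lt_min hc₀ hc₂, r, by linarith, fun x hx => ?_⟩
  have hpos := (aNorm_spec ha hx).1
  have hpow : 0 < aNorm a x ^ r := Real.rpow_pos_of_pos hpos r
  have B1 : min c₀ c₂ * min 1 (aNorm a x ^ r) ≤ c₀ * aNorm a x ^ r :=
    mul_le_mul (min_le_left _ _) (min_le_right _ _) (le_min zero_le_one hpow.le) hc₀.le
  have B2 : min c₀ c₂ * min 1 (aNorm a x ^ r) ≤ c₂ :=
    (mul_le_mul (min_le_right _ _) (min_le_left _ _) (le_min zero_le_one hpow.le) hc₂.le).trans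
      (mul_one _).le
  rw [H x hx]
  rcases le_or_gt (aNorm a x) (2 / 3) with h1 | h1
  · rw [hρ1 x hx h1, one_mul, sub_self, zero_mul, add_zero]
    exact B1.trans (H₁ x hx (by linarith)).1
  · rcases lt_or_ge (aNorm a x) (4 / 3) with h2 | h2
    · have A1 := B1.trans (H₁ x hx h2).1
      have A2 := B2.trans (H₂ x hx h1).1
      obtain ⟨r0, r1⟩ := hρ x hx
      nlinarith
    · rw [hρ0 x hx h2, zero_mul, sub_zero, one_mul, zero_add]
      exact B2.trans (H₂ x hx h1).1

lemma IsHybridRegulation.pos (ha : IsAnisotropy a) (hh : IsHybridRegulation a h) {x : E d}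
    (hx : x ≠ 0) : 0 < h x := by
  obtain ⟨c, hc, r, -, H⟩ := hh.lower_bound ha
  refine lt_of_lt_of_le ?_ (H x hx)
  have := Real.rpow_pos_of_pos (aNorm_spec ha hx).1 r
  positivity

namespace DecompositionSystem

variable (D : DecompositionSystem a h J)

/-- The radius `δ h(ξ_j)` of the ball `Q_j`. -/
def rad (j : J) : ℝ := D.δ * h (D.ξ j)

/-- The ball `Q_j` as an ellipsoid. -/
def ball (j : J) : Set (E d) := ellip a (D.rad j) (D.ξ j) 1

/-- The function `φ_j²`. -/
def psi (j : J) : 𝓢(E d, ℂ) := mulS (D.φ j) (D.φ j)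

lemma psi_apply (j : J) (x : E d) : D.psi j x = D.φ j x ^ 2 := by
  rw [psi, mulS_apply, sq]

lemma coe_psi (j : J) : (D.psi j : E d → ℂ) = fun x => D.φ j x ^ 2 := funext (D.psi_apply j)

/-- A nonzero centre exists, so d ≥ 1. This is needed wherever limits along punctured neighbourhoods
of 0 are taken, or {0} has to be a null set. -/
lemma nontrivial (D : DecompositionSystem a h J) : Nontrivial (E d) := by
  obtain ⟨b, Q, hQ, -⟩ := D.covering
  obtain ⟨j⟩ := hQ.nonempty
  exact ⟨D.ξ j, 0, D.ξ_ne_zero j⟩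

lemma index_countable (D : DecompositionSystem a h J) : Countable J := by
  obtain ⟨b, Q, hQ, -⟩ := D.covering
  exact hQ.countable

lemma rad_pos (ha : IsAnisotropy a) (hh : IsHybridRegulation a h) (j : J) : 0 < D.rad j :=
  mul_pos D.δ_pos (hh.pos ha (D.ξ_ne_zero j))

lemma aBall_eq (ha : IsAnisotropy a) (hh : IsHybridRegulation a h) (j : J) :
    aBall a (D.ξ j) (D.δ * h (D.ξ j)) = D.ball j :=
  aBall_eq_ellip ha _ (D.rad_pos ha hh j)

lemma mem_affineImage {t : ℝ} (ht : 0 < t) (b : E d) (S : Set (E d)) (x : E d) :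
    x ∈ affineImage (dil a t) b S ↔ dl a t⁻¹ (x - b) ∈ S := by
  constructor
  · rintro ⟨y, hy, rfl⟩
    change dl a t⁻¹ (dl a t y + b - b) ∈ S
    rwa [add_sub_cancel_right, dl_inv_dl ht]
  · intro hx
    exact ⟨_, hx, by change dl a t (dl a t⁻¹ (x - b)) + b = x; rw [dl_dl_inv ht]; abel⟩

lemma psi_eq_zero (ha : IsAnisotropy a) (hh : IsHybridRegulation a h) {j : J} {x : E d}
    (hx : x ∉ D.ball j) : D.psi j x = 0 := by
  by_contra hne
  refine hx ?_
  rw [← D.aBall_eq ha hh]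
  refine D.bapu.support j (subset_tsupport _ ?_)
  rwa [Function.mem_support, ← D.psi_apply]

lemma exists_overlap (ha : IsAnisotropy a) (hh : IsHybridRegulation a h) :
    ∃ N : ℕ, ∀ j, {i | (D.ball i ∩ D.ball j).Nonempty}.encard ≤ N := by
  obtain ⟨b, Q, hQ, hb⟩ := D.covering
  obtain ⟨N, hN⟩ := hQ.admissible.finite_overlap
  refine ⟨N, fun j => ?_⟩
  have := hN j
  simp only [hb, D.aBall_eq ha hh] at this
  exact this

lemma iUnion_ball (ha : IsAnisotropy a) (hh : IsHybridRegulation a h) :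
    ⋃ j, D.ball j = {0}ᶜ := by
  obtain ⟨b, Q, hQ, hb⟩ := D.covering
  have := hQ.admissible.cover
  simp only [hb, D.aBall_eq ha hh] at this
  exact this

/-- These powers are the diagonal entries of A_j⁻¹ A_i, which the structure of the covering bounds.
Exchanging i and j shows that radii of intersecting balls are comparable. -/
lemma exists_rad_le (ha : IsAnisotropy a) (hh : IsHybridRegulation a h) :
    ∃ K : ℝ, 0 < K ∧ ∀ i j, (D.ball i ∩ D.ball j).Nonempty →
      ∀ m, (D.rad i / D.rad j) ^ a m ≤ K := by
  obtain ⟨b, Q, hQ, hb⟩ := D.covering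
  obtain ⟨K, hK⟩ := hQ.exists_bound
  refine ⟨max K 1, by positivity, fun i j hij m => ?_⟩
  have h1 := hK i j (by simpa only [hb, D.aBall_eq ha hh] using hij) m m
  have hi := D.rad_pos ha hh i
  have hj := D.rad_pos ha hh j
  change |((dil a (D.rad j))⁻¹ * dil a (D.rad i)) m m| ≤ K at h1
  have h2 : (dil a (D.rad j))⁻¹ = Matrix.diagonal fun i => ((D.rad j) ^ a i)⁻¹ := by
    refine Matrix.inv_eq_right_inv ?_
    rw [dil, Matrix.diagonal_mul_diagonal, ← Matrix.diagonal_one]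
    congr 1
    ext i
    exact mul_inv_cancel₀ (Real.rpow_pos_of_pos hj _).ne'
  rw [h2, dil, Matrix.diagonal_mul_diagonal, Matrix.diagonal_apply_eq] at h1
  rw [Real.div_rpow hi.le hj.le, div_eq_inv_mul]
  exact (le_abs_self _).trans (h1.trans (le_max_left _ _))

/-- The balls stay away from the origin, even after a slight enlargement. -/
lemma exists_enlargement (ha : IsAnisotropy a) (hh : IsHybridRegulation a h) :
    ∃ r e : ℝ, 1 < r ∧ r ≤ 2 ∧ 0 < e ∧ e ≤ 1 ∧
      ∀ j, ∀ x ∈ ellip a (D.rad j) (D.ξ j) r, e ≤ ‖dl a (D.rad j)⁻¹ x‖ := by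
  obtain ⟨K, hK0, hK⟩ := D.exists_rad_le ha hh
  obtain ⟨b, Q, hQ, hb⟩ := D.covering
  have hb' : ∀ j, affineImage (dil a (D.rad j)) (b j) Q = D.ball j := fun j => by
    rw [← D.aBall_eq ha hh]; exact hb j
  obtain ⟨P, hPo, hPc, hPQ, hPcov⟩ := hQ.exists_inner
  obtain ⟨ε, hε, hthick⟩ := hPc.exists_thickening_subset_open hQ.isOpen hPQ
  -- Choose k with x ∈ T_k P. The ε-neighbourhood of P lies in Q, so a point closer to 0 than ε at
  -- scale k would put 0 into T_k Q.
  have hcore : ∀ x ≠ (0 : E d), ∃ k, x ∈ D.ball k ∧ ε ≤ ‖dl a (D.rad k)⁻¹ x‖ := by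
    intro x hx
    have hx' : x ∈ ⋃ j, affineImage (dil a (D.rad j)) (b j) P := by
      have := hPcov.cover
      rw [show (⋃ j, affineImage (dil a (D.rad j)) (b j) P) = {0}ᶜ from this]
      exact hx
    obtain ⟨k, hk⟩ := Set.mem_iUnion.1 hx'
    have hr := D.rad_pos ha hh k
    have hkP := (mem_affineImage hr _ _ _).1 hk
    refine ⟨k, ?_, ?_⟩
    · rw [← hb', mem_affineImage hr]
      exact hPQ (subset_closure hkP)
    · by_contra! hlt
      have h0 : (0 : E d) ∈ affineImage (dil a (D.rad k)) (b k) Q := by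
        rw [mem_affineImage hr]
        refine hthick (Metric.mem_thickening_iff.2 ⟨_, subset_closure hkP, ?_⟩)
        rw [dist_comm, dist_eq_norm, ← map_sub]
        simpa using hlt
      have h1 : (0 : E d) ∈ ⋃ j, affineImage (dil a (D.rad j)) (b j) Q := Set.mem_iUnion.2 ⟨k, h0⟩
      rw [show (⋃ j, affineImage (dil a (D.rad j)) (b j) Q) = {0}ᶜ from hQ.admissible.cover] at h1
      exact h1 rfl
  -- The bound moves from the good index k to any j with x ∈ Q_j, since the two balls meet and their
  -- radii are comparable.
  have hball : ∀ j, ∀ x ∈ D.ball j, ε / K ≤ ‖dl a (D.rad j)⁻¹ x‖ := by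
    intro j x hx
    have hx0 : x ≠ 0 := by
      have : x ∈ ⋃ j, D.ball j := Set.mem_iUnion.2 ⟨j, hx⟩
      rw [D.iUnion_ball ha hh] at this
      exact this
    obtain ⟨k, hk, hk2⟩ := hcore x hx0
    have hrj := D.rad_pos ha hh j
    have hrk := D.rad_pos ha hh k
    have h1 : dl a (D.rad k)⁻¹ x = dl a (D.rad j / D.rad k) (dl a (D.rad j)⁻¹ x) := by
      rw [dl_dl (by positivity) (by positivity)]
      congr 2
      field_simp
    rw [div_le_iff₀ hK0, mul_comm]
    refine hk2.trans ?_
    rw [h1]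
    exact norm_dl_le (by positivity) hK0.le (hK j k ⟨x, hx, hk⟩) _
  set E0 := ε / K with hE0
  have hE0p : 0 < E0 := by positivity
  set η : ℝ := min 1 (E0 / 2) with hη
  have hηp : 0 < η := lt_min one_pos (by positivity)
  refine ⟨1 + η, min 1 (E0 / 2), by linarith, by linarith [min_le_left 1 (E0 / 2)],
    lt_min one_pos (by positivity), min_le_left _ _, fun j x hx => ?_⟩
  have hrj := D.rad_pos ha hh j
  set u := dl a (D.rad j)⁻¹ (x - D.ξ j) with hu
  have hu1 : ‖u‖ < 1 + η := hx
  -- Contracting towards the centre brings x back into the ball and moves it, at scale j, by at most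
  -- η ≤ E0/2; half of the distance E0 to the origin remains.
  set x' := D.ξ j + dl a (D.rad j) ((1 + η)⁻¹ • u) with hx'
  have hx'm : x' ∈ D.ball j := by
    rw [ball, ellip, Set.mem_ofPred_eq, hx', add_sub_cancel_left, dl_inv_dl hrj, norm_smul,
      Real.norm_of_nonneg (by positivity), inv_mul_lt_iff₀ (by positivity), mul_one]
    exact hu1
  have h1 := hball j x' hx'm
  have h2 : dl a (D.rad j)⁻¹ x = dl a (D.rad j)⁻¹ x' + (1 - (1 + η)⁻¹) • u := by
    have : dl a (D.rad j)⁻¹ x = u + dl a (D.rad j)⁻¹ (D.ξ j) := by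
      rw [hu, map_sub]; abel
    rw [this, hx', map_add, dl_inv_dl hrj, sub_smul, one_smul]
    abel
  have h3 : ‖(1 - (1 + η)⁻¹) • u‖ ≤ η := by
    have h4 : (1 - (1 + η)⁻¹) = η * (1 + η)⁻¹ := by field_simp; ring
    rw [h4, norm_smul, Real.norm_of_nonneg (by positivity), mul_assoc]
    have : (1 + η)⁻¹ * ‖u‖ ≤ 1 := by
      rw [inv_mul_le_iff₀ (by positivity), mul_one]; exact hu1.le
    nlinarith
  have h4 : ‖dl a (D.rad j)⁻¹ x'‖ ≤ ‖dl a (D.rad j)⁻¹ x‖ + ‖(1 - (1 + η)⁻¹) • u‖ := by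
    rw [h2]
    have := norm_sub_le (dl a (D.rad j)⁻¹ x' + (1 - (1 + η)⁻¹) • u) ((1 - (1 + η)⁻¹) • u)
    rwa [add_sub_cancel_right] at this
  have h5 : η ≤ E0 / 2 := min_le_right _ _
  linarith

/-- All quantities attached to the enlarged ball `j` are polynomially comparable. -/
lemma exists_comparison (ha : IsAnisotropy a) (hh : IsHybridRegulation a h) :
    ∃ (r : ℝ) (K : ℕ), 1 < r ∧ r ≤ 2 ∧
      (∀ j, ∀ x ∈ ellip a (D.rad j) (D.ξ j) r, x ≠ 0 ∧ wt x ≤ wt (D.ξ j) ^ K ∧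
        wt (D.ξ j) ≤ wt x ^ K) ∧
      ∀ j, D.rad j ≤ wt (D.ξ j) ^ K ∧ (D.rad j)⁻¹ ≤ wt (D.ξ j) ^ K := by
  obtain ⟨r, e, hr1, hr2, he, he1, H⟩ := D.exists_enlargement ha hh
  obtain ⟨C, κ, hC, hκ, hG⟩ := exists_growth ha he he1
  obtain ⟨c, hc, r', hr', hlow⟩ := hh.lower_bound ha
  obtain ⟨α, hα, hαa⟩ := ha.exists_lower
  obtain ⟨K₁, hK₁⟩ := exists_pow_bound (C + C) κ
  obtain ⟨K₂, hK₂⟩ := exists_pow_bound ((D.δ * c)⁻¹) (α⁻¹ * r')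
  refine ⟨r, K₁ + K₂, hr1, hr2, ?_, ?_⟩
  · intro j x hx
    have hxe := H j x hx
    have hx0 : x ≠ 0 := by
      rintro rfl
      simp at hxe
      linarith
    have hj0 := D.ξ_ne_zero j
    have hje : e ≤ ‖dl a (D.rad j)⁻¹ (D.ξ j)‖ := H j _ (by
      rw [ellip, Set.mem_ofPred_eq, sub_self, map_zero, norm_zero]; linarith)
    have hxj : ‖dl a (D.rad j)⁻¹ (x - D.ξ j)‖ ≤ 2 := (show _ < r from hx).le.trans hr2
    have hjx : ‖dl a (D.rad j)⁻¹ (D.ξ j - x)‖ ≤ 2 := by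
      rw [← norm_neg, ← map_neg, neg_sub]; exact hxj
    have G1 := hG _ (D.rad_pos ha hh j) x (D.ξ j) hx0 hj0 hxe hxj
    have G2 := hG _ (D.rad_pos ha hh j) (D.ξ j) x hj0 hx0 hje hjx
    have w1 := two_le_wt hx0
    have w2 := two_le_wt hj0
    refine ⟨hx0, ?_, ?_⟩
    · calc wt x = ‖x‖ + ‖x‖⁻¹ := rfl
        _ ≤ (C + C) * wt (D.ξ j) ^ κ := by linarith [G1.2.2, G2.2.1]
        _ ≤ wt (D.ξ j) ^ K₁ := hK₁ _ w2
        _ ≤ _ := pow_le_pow_right₀ (by linarith) (by omega)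
    · calc wt (D.ξ j) = ‖D.ξ j‖ + ‖D.ξ j‖⁻¹ := rfl
        _ ≤ (C + C) * wt x ^ κ := by linarith [G2.2.2, G1.2.1]
        _ ≤ wt x ^ K₁ := hK₁ _ w1
        _ ≤ _ := pow_le_pow_right₀ (by linarith) (by omega)
  · intro j
    have hj0 := D.ξ_ne_zero j
    have w2 := two_le_wt hj0
    have hrj := D.rad_pos ha hh j
    constructor
    · have hje : e ≤ ‖dl a (D.rad j)⁻¹ (D.ξ j)‖ := H j _ (by
        rw [ellip, Set.mem_ofPred_eq, sub_self, map_zero, norm_zero]; linarith)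
      have G := (hG _ hrj (D.ξ j) (D.ξ j) hj0 hj0 hje (by simp)).1
      have hp : 0 ≤ wt (D.ξ j) ^ κ := Real.rpow_nonneg (by linarith) _
      calc D.rad j ≤ (C + C) * wt (D.ξ j) ^ κ := by nlinarith
        _ ≤ wt (D.ξ j) ^ K₁ := hK₁ _ w2
        _ ≤ _ := pow_le_pow_right₀ (by linarith) (by omega)
    · set τ := aNorm a (D.ξ j) with hτ
      obtain ⟨hτ0, hτ1⟩ := aNorm_spec ha hj0
      -- The lower bound for `h` is in terms of the anisotropic size τ. For τ ≤ 1 one has |ξ_j| ≤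
      -- τ^α, which turns it into a power of the Euclidean weight.
      have hm : (wt (D.ξ j) ^ (α⁻¹ * r'))⁻¹ ≤ min 1 (τ ^ r') := by
        have hw1 : 1 ≤ wt (D.ξ j) ^ (α⁻¹ * r') := Real.one_le_rpow (by linarith) (by positivity)
        refine le_min (inv_le_one_of_one_le₀ hw1) ?_
        rcases le_total 1 τ with h1 | h1
        · exact (inv_le_one_of_one_le₀ hw1).trans (Real.one_le_rpow h1 hr')
        · have h2 : ‖D.ξ j‖ ≤ τ ^ α := by
            rw [← dl_dl_inv hτ0 (D.ξ j)]
            have := norm_dl_le (a := a) hτ0.le (Real.rpow_nonneg hτ0.le α)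
              (fun i => Real.rpow_le_rpow_of_exponent_ge hτ0 h1 (hαa i)) (dl a τ⁻¹ (D.ξ j))
            rwa [hτ1, mul_one] at this
          have h3 : (wt (D.ξ j))⁻¹ ≤ τ ^ α := by
            refine le_trans ?_ h2
            exact inv_le_of_inv_le₀ (norm_pos_iff.2 hj0) (inv_norm_le_wt _)
          have h4 := Real.rpow_le_rpow (by positivity) h3 (show 0 ≤ α⁻¹ * r' by positivity)
          rwa [Real.inv_rpow (by linarith), ← Real.rpow_mul hτ0.le, ← mul_assoc,
            mul_inv_cancel₀ hα.ne', one_mul] at h4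
      have hle : D.δ * (c * (wt (D.ξ j) ^ (α⁻¹ * r'))⁻¹) ≤ D.rad j := by
        have := hlow _ hj0
        have hδ := D.δ_pos
        rw [rad]
        gcongr
        exact le_trans (by gcongr) this
      have hp : 0 < wt (D.ξ j) ^ (α⁻¹ * r') := Real.rpow_pos_of_pos (by linarith) _
      have hδ := D.δ_pos
      calc (D.rad j)⁻¹ ≤ (D.δ * (c * (wt (D.ξ j) ^ (α⁻¹ * r'))⁻¹))⁻¹ := inv_anti₀ (by positivity) hle
        _ = (D.δ * c)⁻¹ * wt (D.ξ j) ^ (α⁻¹ * r') := by field_simp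
        _ ≤ wt (D.ξ j) ^ K₂ := hK₂ _ w2
        _ ≤ _ := pow_le_pow_right₀ (by linarith) (by omega)

lemma volume_ball (ha : IsAnisotropy a) (hh : IsHybridRegulation a h) (j : J) :
    volume (D.ball j) = ENNReal.ofReal (D.rad j ^ d) * volume (Metric.ball (0 : E d) 1) :=
  volume_ellip ha (D.rad_pos ha hh j) _ _

/-- On Q_j the function (1+|x|)^{-(d+1)} is, up to a constant, at least wt(ξ_j)^{-K(d+1)}, and |Q_j|
is at least a constant times wt(ξ_j)^{-Kd}. So each term with L = K(d+1) + Kd is dominated by an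
integral over Q_j, and by bounded overlap these integrals add up to at most N times the integral
over ℝ^d. -/
lemma exists_summable (ha : IsAnisotropy a) (hh : IsHybridRegulation a h) :
    ∃ L : ℕ, ∑' j, ENNReal.ofReal ((wt (D.ξ j) ^ L)⁻¹) < ∞ := by
  obtain ⟨N, hN⟩ := D.exists_overlap ha hh
  obtain ⟨r, K, hr1, hr2, H, Hr⟩ := D.exists_comparison ha hh
  have := D.index_countable
  have hint : ∫⁻ x : E d, ENNReal.ofReal ((1 + ‖x‖) ^ (-((d : ℝ) + 1))) < ∞ := by
    have := integrable_one_add_norm (E := E d) (μ := volume) (r := d + 1) (by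
      rw [finrank_euclideanSpace_fin]; linarith)
    exact this.lintegral_lt_top
  set c := volume (Metric.ball (0 : E d) 1) with hc
  have hc0 : c ≠ 0 := (Metric.measure_ball_pos _ _ one_pos).ne'
  have hct : c ≠ ∞ := measure_ball_lt_top.ne
  set M := K * (d + 1) + K * d with hM
  have key : ∀ j, c * ENNReal.ofReal ((wt (D.ξ j) ^ M)⁻¹) ≤
      ∫⁻ x in D.ball j, ENNReal.ofReal (2 ^ (d + 1) * (1 + ‖x‖) ^ (-((d : ℝ) + 1))) := by
    intro j
    have w2 := two_le_wt (D.ξ_ne_zero j)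
    have hrj := D.rad_pos ha hh j
    have hpt : ∀ x ∈ D.ball j, ENNReal.ofReal ((wt (D.ξ j) ^ (K * (d + 1)))⁻¹) ≤
        ENNReal.ofReal (2 ^ (d + 1) * (1 + ‖x‖) ^ (-((d : ℝ) + 1))) := by
      intro x hx
      obtain ⟨hx0, hx1, -⟩ := H j x (lt_trans (show _ < (1 : ℝ) from hx) hr1)
      refine ENNReal.ofReal_le_ofReal ?_
      have h1 : (1 + ‖x‖) / 2 ≤ wt x := by
        have := two_le_wt hx0
        have := norm_le_wt x
        linarith
      have h2 : ((1 + ‖x‖) / 2) ^ (d + 1) ≤ wt (D.ξ j) ^ (K * (d + 1)) := by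
        rw [pow_mul]
        exact pow_le_pow_left₀ (by positivity) (h1.trans hx1) _
      have h3 := inv_anti₀ (by positivity) h2
      refine h3.trans (le_of_eq ?_)
      rw [Real.rpow_neg (by positivity), div_pow, inv_div, div_eq_mul_inv]
      congr 2
      exact_mod_cast (Real.rpow_natCast (1 + ‖x‖) (d + 1)).symm
    have hvol : ENNReal.ofReal ((wt (D.ξ j) ^ (K * d))⁻¹) * c ≤ volume (D.ball j) := by
      rw [D.volume_ball ha hh]
      gcongr
      refine inv_le_of_inv_le₀ (by positivity) ?_
      rw [← inv_pow, pow_mul]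
      exact pow_le_pow_left₀ (by positivity) (Hr j).2 _
    calc c * ENNReal.ofReal ((wt (D.ξ j) ^ M)⁻¹)
        = ENNReal.ofReal ((wt (D.ξ j) ^ (K * (d + 1)))⁻¹) *
          (ENNReal.ofReal ((wt (D.ξ j) ^ (K * d))⁻¹) * c) := by
          rw [hM, pow_add, mul_inv, ENNReal.ofReal_mul (by positivity)]; ring
      _ ≤ ENNReal.ofReal ((wt (D.ξ j) ^ (K * (d + 1)))⁻¹) * volume (D.ball j) := by gcongr
      _ = ∫⁻ _ in D.ball j, ENNReal.ofReal ((wt (D.ξ j) ^ (K * (d + 1)))⁻¹) := by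
          rw [setLIntegral_const]
      _ ≤ _ := setLIntegral_mono' (isOpen_ellip _ _ _).measurableSet hpt
  have hmult : ∀ x, ∑' j, (D.ball j).indicator (1 : E d → ℝ≥0∞) x ≤ N := by
    intro x
    by_cases hx : ∃ j, x ∈ D.ball j
    · obtain ⟨j, hj⟩ := hx
      have h1 : ∀ i, (D.ball i).indicator (1 : E d → ℝ≥0∞) x =
          {i | x ∈ D.ball i}.indicator (fun _ => 1) i := by
        intro i; simp [Set.indicator]
      simp_rw [h1]
      rw [← tsum_subtype, ENNReal.tsum_set_one]
      have h2 : {i | x ∈ D.ball i}.encard ≤ N :=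
        (Set.encard_le_encard fun i hi => (⟨x, hi, hj⟩ : (D.ball i ∩ D.ball j).Nonempty)).trans (hN j)
      exact_mod_cast h2
    · have : ∀ j, (D.ball j).indicator (1 : E d → ℝ≥0∞) x = 0 := fun j =>
        Set.indicator_of_notMem (fun hj => hx ⟨j, hj⟩) _
      simp [this]
  set g : E d → ℝ≥0∞ := fun x => ENNReal.ofReal (2 ^ (d + 1) * (1 + ‖x‖) ^ (-((d : ℝ) + 1)))
  have hg : Measurable g := by
    refine ENNReal.measurable_ofReal.comp ?_
    fun_prop
  have hsum : c * ∑' j, ENNReal.ofReal ((wt (D.ξ j) ^ M)⁻¹) ≤ N * ∫⁻ x, g x := by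
    rw [← ENNReal.tsum_mul_left]
    calc ∑' j, c * ENNReal.ofReal ((wt (D.ξ j) ^ M)⁻¹) ≤ ∑' j, ∫⁻ x in D.ball j, g x :=
          ENNReal.tsum_le_tsum key
      _ = ∑' j, ∫⁻ x, (D.ball j).indicator (1 : E d → ℝ≥0∞) x * g x := by
          congr 1; ext j
          rw [← lintegral_indicator (show MeasurableSet (D.ball j) from (isOpen_ellip _ _ _).measurableSet)]
          congr 1; ext x
          by_cases hx : x ∈ D.ball j <;> simp [hx]
      _ = ∫⁻ x, (∑' j, (D.ball j).indicator (1 : E d → ℝ≥0∞) x) * g x := by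
          rw [← lintegral_tsum]
          · simp_rw [ENNReal.tsum_mul_right]
          · intro j
            exact ((measurable_one.indicator (isOpen_ellip _ _ _).measurableSet).mul hg).aemeasurable
      _ ≤ ∫⁻ x, N * g x := lintegral_mono fun x => by gcongr; exact hmult x
      _ = N * ∫⁻ x, g x := lintegral_const_mul _ hg
  have hfin : (N : ℝ≥0∞) * ∫⁻ x, g x < ∞ := by
    refine ENNReal.mul_lt_top (ENNReal.natCast_lt_top N) ?_
    simp only [g]
    simp_rw [ENNReal.ofReal_mul (show (0 : ℝ) ≤ 2 ^ (d + 1) by positivity)]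
    rw [lintegral_const_mul' _ _ ENNReal.ofReal_ne_top]
    exact ENNReal.mul_lt_top ENNReal.ofReal_lt_top hint
  exact ⟨M, (ENNReal.mul_lt_top_iff.1 (hsum.trans_lt hfin)).elim (fun h => h.2) (by
    rintro (h | h)
    · exact (hc0 h).elim
    · rw [h]; exact ENNReal.zero_lt_top)⟩

end DecompositionSystem

end Covering

end HomDecomp

end

open MeasureTheory Filter Topology

noncomputable section

namespace HomDecomp

/-! ### Interchanging tempered distributions with integrals -/

section Interchange

variable {d : ℕ}

/-- Evaluation of the `n`-th derivative at a point. -/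
def derivEval (n : ℕ) (y : E d) : 𝓢(E d, ℂ) →L[ℝ] (E d [×n]→L[ℝ] ℂ) :=
  SchwartzMap.mkCLMtoNormedSpace (fun f => iteratedFDeriv ℝ n f y)
    (fun f g => iteratedFDeriv_add_apply (f.smooth n).contDiffAt (g.smooth n).contDiffAt)
    (fun c f => iteratedFDeriv_const_smul_apply (f.smooth n).contDiffAt)
    ⟨{(0, n)}, 1, zero_le_one, fun f => by
      simpa using SchwartzMap.norm_iteratedFDeriv_le_seminorm ℝ f n y⟩

/-- A family of Schwartz functions which may be integrated in every seminorm. -/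
structure IsDominatedFamily (g : E d → 𝓢(E d, ℂ)) : Prop where
  continuous : Continuous g
  dominated : ∀ k n, ∃ b : E d → ℝ, Integrable b ∧ ∀ x, SchwartzMap.seminorm ℝ k n (g x) ≤ b x

variable {g : E d → 𝓢(E d, ℂ)}

lemma IsDominatedFamily.integrable_derivEval (hg : IsDominatedFamily g) (n : ℕ) (y : E d) :
    Integrable fun x => iteratedFDeriv ℝ n (g x) y := by
  obtain ⟨b, hb, hgb⟩ := hg.dominated 0 n
  exact hb.mono' ((derivEval n y).continuous.comp hg.continuous).aestronglyMeasurable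
    (Eventually.of_forall fun x =>
      (SchwartzMap.norm_iteratedFDeriv_le_seminorm ℝ (g x) n y).trans (hgb x))

/-- Differentiation under the integral sign, one order at a time; the dominating function is that of
the seminorm of indices (0, n+1). -/
lemma IsDominatedFamily.iteratedFDeriv_eq (hg : IsDominatedFamily g) {G : 𝓢(E d, ℂ)}
    (hG : ∀ y, G y = ∫ x, g x y) (n : ℕ) :
    iteratedFDeriv ℝ n G = fun y => ∫ x, iteratedFDeriv ℝ n (g x) y := by
  induction n with
  | zero =>
    ext1 y
    simp only [iteratedFDeriv_zero_eq_comp, Function.comp_apply]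
    rw [hG]
    exact ((continuousMultilinearCurryFin0 ℝ (E d) ℂ).symm.toLinearIsometry.integral_comp_comm
      _).symm
  | succ n ih =>
    obtain ⟨b, hb, hgb⟩ := hg.dominated 0 (n + 1)
    ext1 y
    have hcurry : ∀ x y, fderiv ℝ (iteratedFDeriv ℝ n (g x)) y =
        continuousMultilinearCurryLeftEquiv ℝ (fun _ : Fin (n + 1) => E d) ℂ
          (iteratedFDeriv ℝ (n + 1) (g x) y) := by
      intro x y
      rw [iteratedFDeriv_succ_eq_comp_left, Function.comp_apply,
        LinearIsometryEquiv.apply_symm_apply]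
    have key : HasFDerivAt (fun y => ∫ x, iteratedFDeriv ℝ n (g x) y)
        (∫ x, fderiv ℝ (iteratedFDeriv ℝ n (g x)) y) y := by
      refine hasFDerivAt_integral_of_dominated_of_fderiv_le 
        (F := fun y x => iteratedFDeriv ℝ n (g x) y)
        (F' := fun y x => fderiv ℝ (iteratedFDeriv ℝ n (g x)) y) (bound := b) (s := Set.univ)
        univ_mem ?_ (hg.integrable_derivEval n y) ?_ ?_ hb ?_
      · exact Eventually.of_forall fun y => (hg.integrable_derivEval n y).aestronglyMeasurable
      · simp_rw [hcurry]
        exact ((LinearIsometryEquiv.continuous _).comp_aestronglyMeasurable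
          (hg.integrable_derivEval (n + 1) y).aestronglyMeasurable)
      · refine Eventually.of_forall fun x y _ => ?_
        rw [norm_fderiv_iteratedFDeriv]
        exact (SchwartzMap.norm_iteratedFDeriv_le_seminorm ℝ (g x) (n + 1) y).trans (hgb x)
      · refine Eventually.of_forall fun x y _ => ?_
        exact ((((g x).smooth ⊤).differentiable_iteratedFDeriv (m := n)
          (by exact_mod_cast WithTop.coe_lt_top _)) y).hasFDerivAt
    rw [iteratedFDeriv_succ_eq_comp_left, Function.comp_apply, ih, key.fderiv]
    simp_rw [hcurry]
    have := LinearIsometry.integral_comp_comm (μ := volume) (𝕜 := ℝ)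
      (E := E d [×(n + 1)]→L[ℝ] ℂ) (F := E d →L[ℝ] (E d [×n]→L[ℝ] ℂ))
      (continuousMultilinearCurryLeftEquiv ℝ (fun _ : Fin (n + 1) => E d) ℂ).toLinearIsometry
      (fun x => iteratedFDeriv ℝ (n + 1) (g x) y)
    simp only [LinearIsometryEquiv.coe_toLinearIsometry] at this
    rw [this, LinearIsometryEquiv.symm_apply_apply]

/-- Jets of order `N` of functions on `ℝ^d`. -/
def JetFibre (d N : ℕ) : Type := (n : Fin (N + 1)) → (E d [×(n : ℕ)]→L[ℝ] ℂ)

instance (d N : ℕ) : NormedAddCommGroup (JetFibre d N) :=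
  inferInstanceAs (NormedAddCommGroup ((n : Fin (N + 1)) → (E d [×(n : ℕ)]→L[ℝ] ℂ)))

instance (d N : ℕ) : NormedSpace ℂ (JetFibre d N) :=
  inferInstanceAs (NormedSpace ℂ ((n : Fin (N + 1)) → (E d [×(n : ℕ)]→L[ℝ] ℂ)))

instance (d N : ℕ) : CompleteSpace (JetFibre d N) :=
  inferInstanceAs (CompleteSpace ((n : Fin (N + 1)) → (E d [×(n : ℕ)]→L[ℝ] ℂ)))

/-- Bounded continuous jet fields. -/
abbrev JetSpace (d N : ℕ) : Type := BoundedContinuousFunction (E d) (JetFibre d N)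

/-- The component of order `n` of a jet. -/
def jetProj {d N : ℕ} (n : Fin (N + 1)) : JetFibre d N →L[ℂ] (E d [×(n : ℕ)]→L[ℝ] ℂ) :=
  ContinuousLinearMap.proj (φ := fun n : Fin (N + 1) => (E d [×(n : ℕ)]→L[ℝ] ℂ)) n

/-- All derivatives of order at most `N`, with polynomial weight. -/
def jetFun (N : ℕ) (f : 𝓢(E d, ℂ)) (y : E d) : JetFibre d N :=
  fun n : Fin (N + 1) => (1 + ‖y‖) ^ N • iteratedFDeriv ℝ n f y

lemma norm_jetFun_le (N : ℕ) (f : 𝓢(E d, ℂ)) (y : E d) :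
    ‖jetFun N f y‖ ≤ 2 ^ N * (Finset.Iic (N, N)).sup (schwartzSeminormFamily ℂ (E d) ℂ) f := by
  refine (pi_norm_le_iff_of_nonneg (by positivity)).2 fun n => ?_
  rw [jetFun, norm_smul, Real.norm_of_nonneg (by positivity)]
  exact SchwartzMap.one_add_le_sup_seminorm_apply (m := (N, N)) le_rfl
    (Nat.lt_succ_iff.1 n.2) f y

/-- The weighted jet as a bounded continuous function. -/
def jetBCF (N : ℕ) (f : 𝓢(E d, ℂ)) :
    JetSpace d N :=
  BoundedContinuousFunction.ofNormedAddCommGroup (jetFun N f)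
    (continuous_pi fun n => by
      have := ((f.smooth ⊤).continuous_iteratedFDeriv (m := n)
        (by exact_mod_cast le_top))
      exact Continuous.smul (f := fun y : E d => (1 + ‖y‖) ^ N) (by fun_prop) this)
    _ (norm_jetFun_le N f)

lemma jetBCF_apply (N : ℕ) (f : 𝓢(E d, ℂ)) (y : E d) (n : Fin (N + 1)) :
    jetBCF N f y n = (1 + ‖y‖) ^ N • iteratedFDeriv ℝ n f y := rfl

/-- The weighted jet as a continuous linear map. -/
def jetCLM (N : ℕ) : 𝓢(E d, ℂ) →L[ℂ]
    JetSpace d N :=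
  SchwartzMap.mkCLMtoNormedSpace (σ := RingHom.id ℂ) (jetBCF (d := d) N)
    (fun f g => by
      ext1 y
      refine funext fun n : Fin (N + 1) => ?_
      change jetBCF N (f + g) y n = jetBCF N f y n + jetBCF N g y n
      exact (congrArg (fun u => (1 + ‖y‖) ^ N • u) (map_add (derivEval (n : ℕ) y) f g)).trans
        (smul_add _ _ _))
    (fun c f => by
      ext1 y
      refine funext fun n : Fin (N + 1) => ?_
      change jetBCF N (c • f) y n = c • jetBCF N f y n
      rw [jetBCF_apply, jetBCF_apply, smul_comm]
      congr 1
      exact iteratedFDeriv_const_smul_apply (f.smooth n).contDiffAt)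
    ⟨Finset.Iic (N, N), 2 ^ N, by positivity, fun f =>
      (BoundedContinuousFunction.norm_le (by positivity)).2 (norm_jetFun_le N f)⟩

lemma seminorm_le_norm_jetCLM {N k n : ℕ} (hk : k ≤ N) (hn : n ≤ N) (f : 𝓢(E d, ℂ)) :
    SchwartzMap.seminorm ℂ k n f ≤ ‖jetCLM N f‖ := by
  refine SchwartzMap.seminorm_le_bound ℂ k n f (norm_nonneg _) fun x => ?_
  have h1 := (jetCLM N f).norm_coe_le_norm x
  have h2 := norm_le_pi_norm (jetCLM N f x) ⟨n, Nat.lt_succ_of_le hn⟩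
  refine le_trans ?_ (h2.trans h1)
  change _ ≤ ‖jetBCF N f x _‖
  rw [jetBCF_apply, norm_smul, Real.norm_of_nonneg (by positivity)]
  gcongr
  calc ‖x‖ ^ k ≤ (1 + ‖x‖) ^ k := by gcongr; linarith
    _ ≤ (1 + ‖x‖) ^ N := pow_le_pow_right₀ (by linarith [norm_nonneg x]) hk

lemma exists_seminorm_bound (U : 𝓢(E d, ℂ) →L[ℂ] ℂ) :
    ∃ (N : ℕ) (C : ℝ), 0 ≤ C ∧ ∀ f,
      ‖U f‖ ≤ C * (Finset.Iic (N, N)).sup (schwartzSeminormFamily ℂ (E d) ℂ) f := by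
  obtain ⟨s, C, -, hC⟩ := Seminorm.bound_of_continuous (schwartz_withSeminorms ℂ (E d) ℂ)
    ((normSeminorm ℂ ℂ).comp U.toLinearMap) (by exact continuous_norm.comp U.continuous)
  refine ⟨s.sup (fun m => max m.1 m.2), C, C.2, fun f => (hC f).trans ?_⟩
  change (C : ℝ) * _ ≤ _
  refine mul_le_mul_of_nonneg_left ?_ C.2
  refine Seminorm.le_def.1 (Finset.sup_mono fun m hm => ?_) f
  have := Finset.le_sup (f := fun m : ℕ × ℕ => max m.1 m.2) hm
  exact Finset.mem_Iic.2 ⟨(le_max_left _ _).trans this, (le_max_right _ _).trans this⟩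

/-- A tempered distribution has finite order, so it is bounded by the norm of a weighted jet. It
therefore factors through the image of the injective jet map and extends by Hahn–Banach to a Banach
space, where bounded functionals commute with Bochner integrals. -/
lemma exists_jet_factorization (U : 𝓢(E d, ℂ) →L[ℂ] ℂ) :
    ∃ (N : ℕ) (T : JetSpace d N →L[ℂ] ℂ), ∀ f, T (jetCLM N f) = U f := by
  obtain ⟨N, C, hC0, hC⟩ := exists_seminorm_bound U
  have hbound : ∀ f, ‖U f‖ ≤ C * ‖jetCLM N f‖ := fun f => by
    refine (hC f).trans (mul_le_mul_of_nonneg_left ?_ hC0)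
    refine Seminorm.finset_sup_apply_le (norm_nonneg _) fun m hm => ?_
    have := Finset.mem_Iic.1 hm
    exact seminorm_le_norm_jetCLM this.1 this.2 f
  have hinj : Function.Injective (jetCLM N : 𝓢(E d, ℂ) →L[ℂ] _).toLinearMap := by
    refine (injective_iff_map_eq_zero _).2 fun f hf => ?_
    ext y
    have h0 := seminorm_le_norm_jetCLM (Nat.zero_le N) (Nat.zero_le N) f
    rw [show jetCLM N f = 0 from hf, norm_zero] at h0
    have := SchwartzMap.norm_le_seminorm ℂ f y
    simpa using this.trans h0
  set e := LinearEquiv.ofInjective _ hinj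
  have he : ∀ v, (jetCLM N) (e.symm v) = v := fun v => by
    have := e.apply_symm_apply v
    exact congrArg Subtype.val this
  set T₀ := LinearMap.mkContinuous (U.toLinearMap ∘ₗ e.symm.toLinearMap) C (fun v => by
    refine (hbound (e.symm v)).trans (le_of_eq ?_)
    rw [he]; rfl)
  obtain ⟨T, hT, -⟩ := exists_extension_norm_eq _ T₀
  refine ⟨N, T, fun f => ?_⟩
  have := hT (e f)
  refine this.trans ?_
  change U (e.symm (e f)) = U f
  rw [e.symm_apply_apply]

lemma IsDominatedFamily.integrable_jet (hg : IsDominatedFamily g) (N : ℕ) :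
    Integrable fun x => jetCLM N (g x) := by
  choose b hb hgb using hg.dominated
  have hint : Integrable fun x => 2 ^ N * ∑ m ∈ Finset.Iic (N, N), b m.1 m.2 x :=
    (integrable_finsetSum _ fun m _ => hb m.1 m.2).const_mul _
  refine hint.mono' ((jetCLM N).continuous.comp hg.continuous).aestronglyMeasurable
    (Eventually.of_forall fun x => ?_)
  have hb0 : ∀ k n, 0 ≤ b k n x := fun k n => (apply_nonneg _ _).trans (hgb k n x)
  have h1 : ‖jetCLM N (g x)‖ ≤
      2 ^ N * (Finset.Iic (N, N)).sup (schwartzSeminormFamily ℂ (E d) ℂ) (g x) :=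
    (BoundedContinuousFunction.norm_le (by positivity)).2 (norm_jetFun_le N (g x))
  refine h1.trans (mul_le_mul_of_nonneg_left ?_ (by positivity))
  refine Seminorm.finset_sup_apply_le (Finset.sum_nonneg fun m _ => hb0 _ _) fun m hm => ?_
  exact (hgb m.1 m.2 x).trans
    (Finset.single_le_sum (f := fun m : ℕ × ℕ => b m.1 m.2 x) (fun m _ => hb0 m.1 m.2) hm)

/-- A tempered distribution commutes with the integral of a dominated family. -/
lemma IsDominatedFamily.apply_integral (hg : IsDominatedFamily g) {G : 𝓢(E d, ℂ)}
    (hG : ∀ y, G y = ∫ x, g x y) (U : 𝓢(E d, ℂ) →L[ℂ] ℂ) :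
    U G = ∫ x, U (g x) := by
  obtain ⟨N, T, hT⟩ := exists_jet_factorization U
  have hint := hg.integrable_jet N
  have hjet : jetCLM N G = ∫ x, jetCLM N (g x) := by
    ext1 y
    refine funext fun n : Fin (N + 1) => ?_
    have h1 := ContinuousLinearMap.integral_comp_comm
      ((jetProj n).comp
        (BoundedContinuousFunction.evalCLM ℂ y)) hint
    refine Eq.trans ?_ h1
    change (1 + ‖y‖) ^ N • iteratedFDeriv ℝ n G y =
      ∫ x, (1 + ‖y‖) ^ N • iteratedFDeriv ℝ n (g x) y
    rw [integral_smul, hg.iteratedFDeriv_eq hG]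
  rw [← hT, hjet, ← T.integral_comp_comm hint]
  simp_rw [hT]

end Interchange

end HomDecomp

end

open MeasureTheory Filter Topology

noncomputable section

namespace HomDecomp

/-! ### Band-limited functions defined by tempered distributions -/

section Band

variable {d : ℕ}

lemma add_pow_le_two (k : ℕ) {u v : ℝ} (hu : 0 ≤ u) (hv : 0 ≤ v) :
    (u + v) ^ k ≤ 2 ^ k * (u ^ k + v ^ k) := by
  refine (add_pow_le hu hv k).trans ?_
  gcongr
  · norm_num
  · omega

lemma iteratedFDeriv_transS (v : E d) (G : 𝓢(E d, ℂ)) (n : ℕ) (y : E d) :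
    iteratedFDeriv ℝ n (transS v G) y = iteratedFDeriv ℝ n G (y - v) := by
  have : (transS v G : E d → ℂ) = fun y => G (y + -v) := by
    ext y; simp [sub_eq_add_neg]
  rw [this, iteratedFDeriv_comp_add_right, sub_eq_add_neg]

lemma pow_norm_mul_le (k n : ℕ) (H : 𝓢(E d, ℂ)) (y z v : E d) (hyz : ‖y‖ ≤ ‖z‖ + ‖v‖) :
    ‖y‖ ^ k * ‖iteratedFDeriv ℝ n H z‖ ≤
      2 ^ k * (SchwartzMap.seminorm ℝ k n H + ‖v‖ ^ k * SchwartzMap.seminorm ℝ 0 n H) := by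
  have h1 : ‖y‖ ^ k ≤ 2 ^ k * (‖z‖ ^ k + ‖v‖ ^ k) :=
    (pow_le_pow_left₀ (norm_nonneg _) hyz k).trans
      (add_pow_le_two k (norm_nonneg _) (norm_nonneg _))
  have h2 := SchwartzMap.le_seminorm ℝ k n H z
  have h3 := SchwartzMap.norm_iteratedFDeriv_le_seminorm ℝ H n z
  calc ‖y‖ ^ k * ‖iteratedFDeriv ℝ n H z‖
      ≤ 2 ^ k * (‖z‖ ^ k + ‖v‖ ^ k) * ‖iteratedFDeriv ℝ n H z‖ := by gcongr
    _ = 2 ^ k * (‖z‖ ^ k * ‖iteratedFDeriv ℝ n H z‖ + ‖v‖ ^ k * ‖iteratedFDeriv ℝ n H z‖) := by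
        ring
    _ ≤ _ := by gcongr

lemma seminorm_transS_le (k n : ℕ) (v : E d) (G : 𝓢(E d, ℂ)) :
    SchwartzMap.seminorm ℝ k n (transS v G) ≤
      2 ^ k * (SchwartzMap.seminorm ℝ k n G + ‖v‖ ^ k * SchwartzMap.seminorm ℝ 0 n G) := by
  refine SchwartzMap.seminorm_le_bound ℝ k n _ (by positivity) fun y => ?_
  rw [iteratedFDeriv_transS]
  refine pow_norm_mul_le k n G y (y - v) v ?_
  have := norm_add_le (y - v) v
  rwa [sub_add_cancel] at this

/-- Mean value inequality on the segment from y to y - v, with the weight |y|^k held fixed along the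
segment. -/
lemma seminorm_transS_sub_le (k n : ℕ) (v : E d) (H : 𝓢(E d, ℂ)) :
    SchwartzMap.seminorm ℝ k n (transS v H - H) ≤
      2 ^ k * (SchwartzMap.seminorm ℝ k (n + 1) H + ‖v‖ ^ k * SchwartzMap.seminorm ℝ 0 (n + 1) H) *
        ‖v‖ := by
  refine SchwartzMap.seminorm_le_bound ℝ k n _ (by positivity) fun y => ?_
  have h1 : iteratedFDeriv ℝ n (transS v H - H) y =
      iteratedFDeriv ℝ n H (y - v) - iteratedFDeriv ℝ n H y := by
    rw [← iteratedFDeriv_transS]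
    exact map_sub (derivEval n y) (transS v H) H
  have hd : Differentiable ℝ (iteratedFDeriv ℝ n H) :=
    (H.smooth ⊤).differentiable_iteratedFDeriv (by exact_mod_cast WithTop.coe_lt_top _)
  have h2 : ‖y‖ ^ k * ‖iteratedFDeriv ℝ n (transS v H - H) y‖ =
      ‖(‖y‖ ^ k) • iteratedFDeriv ℝ n H (y - v) - (‖y‖ ^ k) • iteratedFDeriv ℝ n H y‖ := by
    rw [h1, ← smul_sub, norm_smul, Real.norm_of_nonneg (by positivity)]
  rw [h2]
  have h3 := (convex_segment (𝕜 := ℝ) y (y - v)).norm_image_sub_le_of_norm_fderiv_le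
    (f := fun z => (‖y‖ ^ k) • iteratedFDeriv ℝ n H z)
    (C := 2 ^ k * (SchwartzMap.seminorm ℝ k (n + 1) H +
      ‖v‖ ^ k * SchwartzMap.seminorm ℝ 0 (n + 1) H))
    (fun z _ => (hd z).fun_const_smul _) (fun z hz => ?_)
    (left_mem_segment ℝ y (y - v)) (right_mem_segment ℝ y (y - v))
  · refine h3.trans (le_of_eq ?_)
    rw [sub_sub_cancel_left, norm_neg]
  · rw [fderiv_fun_const_smul (hd z), norm_smul, Real.norm_of_nonneg (by positivity),
      norm_fderiv_iteratedFDeriv]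
    refine pow_norm_mul_le k (n + 1) H y z v ?_
    have h4 := norm_sub_le_of_mem_segment hz
    have h5 : ‖y - (y - v)‖ = ‖v‖ := by rw [sub_sub_cancel]
    have h6 := norm_sub_norm_le y z
    have h7 : ‖z - y‖ ≤ ‖v‖ := by
      refine h4.trans (le_of_eq ?_)
      rw [sub_sub_cancel_left, norm_neg]
    rw [norm_sub_rev] at h7
    linarith

lemma continuous_transS (G : 𝓢(E d, ℂ)) : Continuous fun x => transS x G := by
  refine continuous_iff_continuousAt.2 fun x₀ => ?_
  refine ((schwartz_withSeminorms ℝ (E d) ℂ).tendsto_nhds _ _).2 fun m ε hε => ?_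
  set H := transS x₀ G
  have h1 : ∀ x, transS x G - transS x₀ G = transS (x - x₀) H - H := fun x => by
    simp only [H, SchwartzMap.compSubConstCLM_comp, add_sub_cancel]
  have hlim : Tendsto (fun x => 2 ^ m.1 * (SchwartzMap.seminorm ℝ m.1 (m.2 + 1) H +
      ‖x - x₀‖ ^ m.1 * SchwartzMap.seminorm ℝ 0 (m.2 + 1) H) * ‖x - x₀‖) (𝓝 x₀) (𝓝 0) := by
    have : Continuous fun x => 2 ^ m.1 * (SchwartzMap.seminorm ℝ m.1 (m.2 + 1) H +
      ‖x - x₀‖ ^ m.1 * SchwartzMap.seminorm ℝ 0 (m.2 + 1) H) * ‖x - x₀‖ := by fun_prop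
    have h2 := this.tendsto x₀
    simpa using h2
  filter_upwards [hlim.eventually (gt_mem_nhds hε)] with x hx
  rw [h1]
  exact (seminorm_transS_sub_le m.1 m.2 (x - x₀) H).trans_lt hx

/-- The function `𝓕⁻¹(ψ 𝓕U)`. -/
def band (U : 𝓢(E d, ℂ) →L[ℂ] ℂ) (ψ : 𝓢(E d, ℂ)) (x : E d) : ℂ :=
  (fourierConst d : ℂ) * U (transS x (fourierS d ψ))

variable (U : 𝓢(E d, ℂ) →L[ℂ] ℂ) (ψ : 𝓢(E d, ℂ))

lemma continuous_band : Continuous (band U ψ) :=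
  continuous_const.mul (U.continuous.comp (continuous_transS _))

lemma exists_norm_band_le : ∃ (C : ℝ) (k : ℕ), 0 ≤ C ∧ ∀ x, ‖band U ψ x‖ ≤ C * (1 + ‖x‖ ^ k) := by
  obtain ⟨N, C, hC, hU⟩ := exists_seminorm_bound U
  set G := fourierS d ψ
  set S := (Finset.Iic (N, N)).sum fun m => SchwartzMap.seminorm ℝ m.1 m.2 G +
    SchwartzMap.seminorm ℝ 0 m.2 G
  have hS : 0 ≤ S := Finset.sum_nonneg fun m _ => by positivity
  have hfc := fourierConst_pos d
  refine ⟨fourierConst d * (C * (2 ^ N * (2 * S))), N, by positivity, fun x => ?_⟩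
  rw [band, norm_mul, Complex.norm_real, Real.norm_of_nonneg hfc.le, mul_assoc]
  refine mul_le_mul_of_nonneg_left ?_ hfc.le
  refine (hU _).trans ?_
  rw [mul_assoc]
  refine mul_le_mul_of_nonneg_left ?_ hC
  refine Seminorm.finset_sup_apply_le (by positivity) fun m hm => ?_
  have hm' := Finset.mem_Iic.1 hm
  refine (seminorm_transS_le m.1 m.2 x G).trans ?_
  have h1 : ‖x‖ ^ m.1 ≤ 1 + ‖x‖ ^ N := by
    rcases le_total ‖x‖ 1 with h | h
    · exact (pow_le_one₀ (norm_nonneg _) h).trans (by linarith [pow_nonneg (norm_nonneg x) N])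
    · exact (pow_le_pow_right₀ h hm'.1).trans (by linarith)
  have h2 : SchwartzMap.seminorm ℝ m.1 m.2 G + SchwartzMap.seminorm ℝ 0 m.2 G ≤ S :=
    Finset.single_le_sum (f := fun m : ℕ × ℕ => SchwartzMap.seminorm ℝ m.1 m.2 G +
      SchwartzMap.seminorm ℝ 0 m.2 G) (fun m _ => by positivity) hm
  have h3 : 0 ≤ SchwartzMap.seminorm ℝ m.1 m.2 G := apply_nonneg _ _
  have h4 : 0 ≤ SchwartzMap.seminorm ℝ 0 m.2 G := apply_nonneg _ _
  have h5 : (2 : ℝ) ^ m.1 ≤ 2 ^ N := pow_le_pow_right₀ one_le_two hm'.1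
  have h6 : 0 ≤ ‖x‖ ^ N := by positivity
  calc 2 ^ m.1 * (SchwartzMap.seminorm ℝ m.1 m.2 G + ‖x‖ ^ m.1 * SchwartzMap.seminorm ℝ 0 m.2 G)
      ≤ 2 ^ N * (S * (1 + ‖x‖ ^ N) + (1 + ‖x‖ ^ N) * S) := by
        gcongr
        · nlinarith
        · linarith
    _ = 2 ^ N * (2 * S) * (1 + ‖x‖ ^ N) := by ring

lemma integrable_pow_mul_mul_band (θ : 𝓢(E d, ℂ)) (n : ℕ) :
    Integrable fun x => ‖x‖ ^ n * ‖θ x * band U ψ x‖ := by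
  obtain ⟨C, k, hC, hb⟩ := exists_norm_band_le U ψ
  have h1 : Integrable fun x => C * (‖x‖ ^ n * ‖θ x‖ + ‖x‖ ^ (n + k) * ‖θ x‖) :=
    ((θ.integrable_pow_mul volume n).add (θ.integrable_pow_mul volume (n + k))).const_mul _
  refine h1.mono' ?_ (Eventually.of_forall fun x => ?_)
  · have := continuous_band U ψ
    exact Continuous.aestronglyMeasurable (by fun_prop)
  · rw [Real.norm_of_nonneg (by positivity), norm_mul]
    calc ‖x‖ ^ n * (‖θ x‖ * ‖band U ψ x‖) ≤ ‖x‖ ^ n * (‖θ x‖ * (C * (1 + ‖x‖ ^ k))) := by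
          gcongr; exact hb x
      _ = _ := by ring

lemma integrable_mul_band (θ : 𝓢(E d, ℂ)) : Integrable fun x => θ x * band U ψ x := by
  have h := integrable_pow_mul_mul_band U ψ θ 0
  simp only [pow_zero, one_mul] at h
  have hc := continuous_band U ψ
  exact (integrable_norm_iff (Continuous.aestronglyMeasurable (by fun_prop))).1 h

/-- The function 𝓕(ψ 𝓕⁻¹θ) is a convolution of θ with 𝓕ψ, that is, an integral of translates of 𝓕ψ
weighted by θ. This family is dominated, so U may be applied under the integral. -/
lemma integral_mul_band (θ : 𝓢(E d, ℂ)) :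
    ∫ x, θ x * band U ψ x = U (fourierS d (mulS ψ (invS d θ))) := by
  set G := fourierS d ψ
  set g : E d → 𝓢(E d, ℂ) := fun x => ((fourierConst d : ℂ) * θ x) • transS x G
  have hfc := fourierConst_pos d
  have hg : IsDominatedFamily g := by
    refine ⟨?_, fun k n => ?_⟩
    · exact (continuous_const.mul θ.continuous).smul (continuous_transS G)
    · refine ⟨fun x => (fourierConst d * (2 ^ k * SchwartzMap.seminorm ℝ k n G)) * ‖θ x‖ +
        (fourierConst d * (2 ^ k * SchwartzMap.seminorm ℝ 0 n G)) * (‖x‖ ^ k * ‖θ x‖),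
        (θ.integrable.norm.const_mul _).add ((θ.integrable_pow_mul volume k).const_mul _),
        fun x => ?_⟩
      have h1 : SchwartzMap.seminorm ℝ k n (g x) =
          fourierConst d * ‖θ x‖ * SchwartzMap.seminorm ℝ k n (transS x G) := by
        have : SchwartzMap.seminorm ℂ k n (g x) =
            ‖(fourierConst d : ℂ) * θ x‖ * SchwartzMap.seminorm ℂ k n (transS x G) :=
          map_smul_eq_mul _ _ _
        rw [norm_mul, Complex.norm_real, Real.norm_of_nonneg hfc.le] at this
        exact this
      rw [h1]
      calc fourierConst d * ‖θ x‖ * SchwartzMap.seminorm ℝ k n (transS x G)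
          ≤ fourierConst d * ‖θ x‖ * (2 ^ k * (SchwartzMap.seminorm ℝ k n G +
            ‖x‖ ^ k * SchwartzMap.seminorm ℝ 0 n G)) := by
            gcongr
            exact seminorm_transS_le k n x G
        _ = _ := by ring
  have hG : ∀ y, fourierS d (mulS ψ (invS d θ)) y = ∫ x, g x y := by
    intro y
    rw [fourierS_mulS, fourierS_invS, ← integral_const_mul]
    refine integral_congr_ae (Eventually.of_forall fun x => ?_)
    change _ = ((fourierConst d : ℂ) * θ x) * G (y - x)
    simp only [G]
    ring
  rw [hg.apply_integral hG U]
  refine integral_congr_ae (Eventually.of_forall fun x => ?_)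
  simp only [g, map_smul, smul_eq_mul, band, G]
  ring

/-- A mollifier with prescribed frequency support. -/
lemma exists_mollifier {ε : ℝ} (hε : 0 < ε) : ∃ κ : 𝓢(E d, ℂ), (∀ x, ‖κ x‖ ≤ 1) ∧
    (∀ x, ‖κ x - 1‖ ≤ ε * ‖x‖) ∧ ∀ ξ, ε ≤ ‖ξ‖ → invS d κ ξ = 0 := by
  -- κ is the unnormalised Fourier transform of a bump of integral 1 supported in |ξ| ≤ ε: the mass
  -- gives |κ| ≤ 1, and |e^{-ix·ξ} - 1| ≤ ε|x| on the support gives |κ(x) - 1| ≤ ε|x|.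
  let f : ContDiffBump (0 : E d) := ⟨ε / 2, ε, by positivity, by linarith⟩
  have hsm : ContDiff ℝ ((⊤ : ℕ∞) : WithTop ℕ∞) (fun x => ((f.normed volume x : ℝ) : ℂ)) :=
    Complex.ofRealCLM.contDiff.comp f.contDiff_normed
  have hcs : HasCompactSupport (fun x => ((f.normed volume x : ℝ) : ℂ)) :=
    f.hasCompactSupport_normed.comp_left (g := fun t : ℝ => (t : ℂ)) (by simp)
  set m : 𝓢(E d, ℂ) := hcs.toSchwartzMap hsm
  have hm : ∀ x, m x = ((f.normed volume x : ℝ) : ℂ) := fun x => rfl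
  have hc : ((fourierConst d : ℝ) : ℂ) ≠ 0 := by exact_mod_cast (fourierConst_pos d).ne'
  have hκ : ∀ x, (((fourierConst d : ℝ) : ℂ)⁻¹ • fourierS d m) x =
      ∫ ξ, Complex.exp (-(Complex.I * (⟪ξ, x⟫ : ℝ))) * m ξ := by
    intro x
    rw [smul_apply, fourierS_apply, smul_eq_mul, ← mul_assoc]
    rw [show ((((2 * Real.pi) ^ (-(d : ℝ) / 2) : ℝ) : ℂ)) = fourierConst d from rfl,
      inv_mul_cancel₀ hc, one_mul]
  have hint1 : ∫ ξ, ‖m ξ‖ = 1 := by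
    simp_rw [hm, Complex.norm_real, Real.norm_of_nonneg (f.nonneg_normed _)]
    exact f.integral_normed
  have hexp : ∀ x ξ : E d, ‖Complex.exp (-(Complex.I * (⟪ξ, x⟫ : ℝ)))‖ = 1 := fun x ξ => by
    rw [Complex.norm_exp]; simp
  have hint2 : ∀ x : E d, Integrable fun ξ => Complex.exp (-(Complex.I * (⟪ξ, x⟫ : ℝ))) * m ξ := by
    intro x
    refine m.integrable.norm.mono' (Continuous.aestronglyMeasurable (by fun_prop))
      (Eventually.of_forall fun ξ => ?_)
    rw [norm_mul, hexp, one_mul]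
  refine ⟨((fourierConst d : ℝ) : ℂ)⁻¹ • fourierS d m, fun x => ?_, fun x => ?_, fun ξ hξ => ?_⟩
  · rw [hκ, ← hint1]
    refine (norm_integral_le_integral_norm _).trans (le_of_eq ?_)
    congr 1; ext ξ
    rw [norm_mul, hexp, one_mul]
  · have h1 : (1 : ℂ) = ∫ ξ, m ξ := by
      simp_rw [hm]
      rw [integral_complex_ofReal, f.integral_normed]; simp
    rw [hκ, h1, ← integral_sub (hint2 x) m.integrable]
    have h2 : ε * ‖x‖ = ∫ ξ, ε * ‖x‖ * ‖m ξ‖ := by rw [integral_const_mul, hint1, mul_one]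
    rw [h2]
    refine norm_integral_le_of_norm_le (m.integrable.norm.const_mul _)
      (Eventually.of_forall fun ξ => ?_)
    have h3 : Complex.exp (-(Complex.I * (⟪ξ, x⟫ : ℝ))) * m ξ - m ξ =
        (Complex.exp (Complex.I * ((-⟪ξ, x⟫ : ℝ) : ℂ)) - 1) * m ξ := by
      push_cast; ring_nf
    rw [h3, norm_mul]
    by_cases hξ : ‖ξ‖ < ε
    · refine mul_le_mul_of_nonneg_right ?_ (norm_nonneg _)
      refine (Real.norm_exp_I_mul_ofReal_sub_one_le (x := -⟪ξ, x⟫)).trans ?_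
      rw [norm_neg]
      exact (norm_inner_le_norm ξ x).trans (by gcongr)
    · have : m ξ = 0 := by
        rw [hm, Complex.ofReal_eq_zero, ← Function.notMem_support, f.support_normed_eq]
        simpa using hξ
      simp [this]
  · rw [map_smul, invS_fourierS, smul_apply, hm]
    have : f.normed volume ξ = 0 := by
      rw [← Function.notMem_support, f.support_normed_eq]
      simpa using hξ
    simp [this]

/-- All moments of the product are finite, so its transform is smooth; the transform also vanishes
at distance at least ε from the set where ψ ≠ 0, hence has compact support. By Fourier inversion the
product is itself a Schwartz function. -/
lemma exists_schwartz_eq_mul_band {R ε : ℝ} (hψ : ∀ ξ, ψ ξ ≠ 0 → ‖ξ‖ ≤ R) {κ : 𝓢(E d, ℂ)}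
    (hκ : ∀ ξ, ε ≤ ‖ξ‖ → invS d κ ξ = 0) :
    ∃ θ : 𝓢(E d, ℂ), (∀ x, θ x = κ x * band U ψ x) ∧
      ∀ ζ, (∀ ξ, ψ ξ ≠ 0 → ε ≤ ‖ξ - ζ‖) → fourierS d θ ζ = 0 := by
  set H : E d → ℂ := fun x => κ x * band U ψ x
  have hHc : Continuous H := by have := continuous_band U ψ; fun_prop
  have hHi : Integrable H := integrable_mul_band U ψ κ
  have hsm : ContDiff ℝ ((⊤ : ℕ∞) : WithTop ℕ∞) (𝓕 H) :=
    Real.contDiff_fourier fun n _ => integrable_pow_mul_mul_band U ψ κ n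
  -- By `integral_mul_band` the value at w is U applied to the transform of ψ times a translate of
  -- 𝓕⁻¹κ by 2πw, and this product is zero. The factor 2π converts between the normalisations of `𝓕`
  -- and `fourierS`.
  have hval : ∀ w : E d, (∀ ξ, ψ ξ ≠ 0 → ε ≤ ‖ξ - (2 * Real.pi) • w‖) → 𝓕 H w = 0 := by
    intro w hw
    have h1 : 𝓕 H w = ∫ x, modS (-((2 * Real.pi) • w)) κ x * band U ψ x := by
      rw [Real.fourier_eq']
      congr 1; ext x
      rw [modS_apply, smul_eq_mul, ← mul_assoc, inner_neg_left, inner_smul_left]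
      congr 3
      simp
      rw [real_inner_comm]
      ring
    rw [h1, integral_mul_band]
    have h2 : mulS ψ (invS d (modS (-((2 * Real.pi) • w)) κ)) = 0 := by
      ext ξ
      rw [mulS_apply]
      by_cases hξ : ψ ξ = 0
      · simp [hξ]
      · have h3 : invS d (modS (-((2 * Real.pi) • w)) κ) ξ = invS d κ (ξ - (2 * Real.pi) • w) := by
          rw [invS_apply, fourierS_modS, SchwartzMap.compSubConstCLM_apply, invS_apply]
          congr 1; abel
        rw [h3, hκ _ (hw ξ hξ)]
        simp
    rw [h2, map_zero, map_zero]
  have hpi : 0 < 2 * Real.pi := by positivity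
  have hcs : HasCompactSupport (𝓕 H) := by
    refine HasCompactSupport.intro (isCompact_closedBall (0 : E d) ((R + ε) / (2 * Real.pi)))
      fun w hw => hval w fun ξ hξ => ?_
    rw [Metric.mem_closedBall, dist_zero_right, not_le, div_lt_iff₀ hpi] at hw
    have h1 := hψ ξ hξ
    have h2 := norm_sub_norm_le ((2 * Real.pi) • w) ξ
    rw [norm_smul, Real.norm_of_nonneg hpi.le] at h2
    rw [norm_sub_rev]
    linarith
  set G : 𝓢(E d, ℂ) := hcs.toSchwartzMap hsm
  have hG : (G : E d → ℂ) = 𝓕 H := rfl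
  have hθ : ((𝓕⁻ G : 𝓢(E d, ℂ)) : E d → ℂ) = H := by
    rw [SchwartzMap.fourierInv_coe, hG]
    refine hHc.fourierInv_fourier_eq hHi ?_
    rw [← hG]; exact G.integrable
  refine ⟨𝓕⁻ G, fun x => congrFun hθ x, fun ζ hζ => ?_⟩
  rw [fourierS_apply_eq, hθ, hval _ (fun ξ hξ => ?_), mul_zero]
  rw [smul_smul, mul_inv_cancel₀ hpi.ne', one_smul]
  exact hζ ξ hξ

/-- Schwartz approximations of a band-limited function. -/
lemma exists_band_approx {R ε : ℝ} (hε : 0 < ε) (hψ : ∀ ξ, ψ ξ ≠ 0 → ‖ξ‖ ≤ R) :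
    ∃ κ θ : ℕ → 𝓢(E d, ℂ), (∀ n x, ‖κ n x‖ ≤ 1) ∧
      (∀ x, Tendsto (fun n => κ n x) atTop (𝓝 1)) ∧ (∀ n x, θ n x = κ n x * band U ψ x) ∧
      ∀ n ζ, fourierS d (θ n) ζ ≠ 0 → ∃ ξ, ψ ξ ≠ 0 ∧ ‖ζ - ξ‖ < ε := by
  have hεn : ∀ n : ℕ, 0 < ε / (n + 1) := fun n => by positivity
  choose κ hκ1 hκ2 hκ3 using fun n => exists_mollifier (d := d) (hεn n)
  choose θ hθ1 hθ2 using fun n => exists_schwartz_eq_mul_band U ψ hψ (hκ3 n)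
  refine ⟨κ, θ, hκ1, fun x => ?_, hθ1, fun n ζ hζ => ?_⟩
  · refine tendsto_iff_norm_sub_tendsto_zero.2 ?_
    refine squeeze_zero (fun n => norm_nonneg _) (fun n => hκ2 n x) ?_
    have h1 : Tendsto (fun n : ℕ => ε * ‖x‖ * (1 / ((n : ℝ) + 1))) atTop (𝓝 (ε * ‖x‖ * 0)) :=
      tendsto_one_div_add_atTop_nhds_zero_nat.const_mul _
    rw [mul_zero] at h1
    refine h1.congr fun n => ?_
    ring
  · by_contra! hcon
    refine hζ (hθ2 n ζ fun ξ hξ => ?_)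
    rw [norm_sub_rev]
    refine le_trans ?_ (hcon ξ hξ)
    exact div_le_self hε.le (by linarith [show (0 : ℝ) ≤ n by positivity])

end Band

end HomDecomp

end

open MeasureTheory Filter Topology

noncomputable section

namespace HomDecomp

/-! ### Inequalities for band-limited functions -/

section BandLimited

variable {d : ℕ} {a : Fin d → ℝ}

lemma lintegral_conv {u v : E d → ℝ≥0∞} (hu : Measurable u) (hv : Measurable v) :
    ∫⁻ x, ∫⁻ y, u y * v (x - y) = (∫⁻ y, u y) * ∫⁻ x, v x := by
  rw [lintegral_lintegral_swap (by fun_prop)]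
  have h1 : ∀ y, ∫⁻ x, u y * v (x - y) = u y * ∫⁻ x, v x := fun y => by
    rw [lintegral_const_mul _ (by fun_prop), lintegral_sub_right_eq_self]
  simp_rw [h1]
  rw [lintegral_mul_const _ hu]

lemma eLpNorm_comp_sub_left {F : Type*} [NormedAddCommGroup F] {f : E d → F} (hf : Continuous f)
    (p : ℝ≥0∞) (x : E d) : eLpNorm (fun y => f (x - y)) p volume = eLpNorm f p volume :=
  eLpNorm_comp_measurePreserving hf.aestronglyMeasurable (Measure.measurePreserving_sub_left volume x)

lemma enorm_invS_mulS_le (ψ g : 𝓢(E d, ℂ)) (x : E d) :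
    ‖invS d (mulS ψ g) x‖ₑ ≤
      ENNReal.ofReal (fourierConst d) * ∫⁻ y, ‖invS d ψ y‖ₑ * ‖invS d g (x - y)‖ₑ := by
  rw [mulS_comm, invS_mulS, enorm_mul]
  refine mul_le_mul' ?_ ?_
  · rw [← ofReal_norm, Complex.norm_real, Real.norm_of_nonneg (fourierConst_pos d).le]
  · refine (enorm_integral_le_lintegral_enorm _).trans (le_of_eq ?_)
    simp_rw [enorm_mul]

lemma eLpNorm_rpow_eq {F : Type*} [NormedAddCommGroup F] (f : E d → F) {p : ℝ} (hp : 0 < p) :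
    eLpNorm f (ENNReal.ofReal p) volume ^ p = ∫⁻ x, ‖f x‖ₑ ^ p := by
  rw [eLpNorm_eq_lintegral_rpow_enorm_toReal (by simpa using hp) ENNReal.ofReal_ne_top,
    ENNReal.toReal_ofReal hp.le, ← ENNReal.rpow_mul, one_div_mul_cancel hp.ne', ENNReal.rpow_one]

lemma eLpNorm_le_of_rpow_le {F : Type*} [NormedAddCommGroup F] {f : E d → F} {p : ℝ} (hp : 0 < p)
    {A : ℝ≥0∞} (h : ∫⁻ x, ‖f x‖ₑ ^ p ≤ A ^ p) : eLpNorm f (ENNReal.ofReal p) volume ≤ A := by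
  rw [← eLpNorm_rpow_eq f hp] at h
  exact (ENNReal.rpow_le_rpow_iff hp).1 h

/-- Young's inequality `‖u * v‖_p ≤ ‖u‖_1 ‖v‖_p`. -/
lemma lintegral_conv_rpow_le {u v : E d → ℝ≥0∞} (hu : Measurable u) (hv : Measurable v) {p : ℝ}
    (hp : 1 ≤ p) :
    ∫⁻ x, (∫⁻ y, u y * v (x - y)) ^ p ≤ (∫⁻ y, u y) ^ p * ∫⁻ x, v x ^ p := by
  have hp0 : 0 < p := by linarith
  have hq : (0 : ℝ) ≤ 1 - 1 / p := by
    rw [sub_nonneg, div_le_one hp0]; exact hp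
  have h1 : ∀ x, (∫⁻ y, u y * v (x - y)) ^ p ≤
      (∫⁻ y, u y) ^ (p - 1) * ∫⁻ y, u y * v (x - y) ^ p := by
    intro x
    -- Hölder's inequality for the splitting u v = u^{1-1/p} (u v^p)^{1/p}.
    have h2 := ENNReal.lintegral_mul_norm_pow_le (μ := (volume : Measure (E d)))
      (f := u) (g := fun y => u y * v (x - y) ^ p) (by fun_prop) (by fun_prop) hq
      (show (0 : ℝ) ≤ 1 / p by positivity) (by ring)
    have h3 : ∀ y, u y ^ (1 - 1 / p) * (u y * v (x - y) ^ p) ^ (1 / p) = u y * v (x - y) := by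
      intro y
      rw [ENNReal.mul_rpow_of_nonneg _ _ (by positivity), ← ENNReal.rpow_mul,
        mul_one_div_cancel hp0.ne', ENNReal.rpow_one, ← mul_assoc,
        ← ENNReal.rpow_add_of_nonneg _ _ hq (by positivity), sub_add_cancel, ENNReal.rpow_one]
    simp_rw [h3] at h2
    refine (ENNReal.rpow_le_rpow h2 hp0.le).trans (le_of_eq ?_)
    rw [ENNReal.mul_rpow_of_nonneg _ _ hp0.le, ← ENNReal.rpow_mul, ← ENNReal.rpow_mul,
      one_div_mul_cancel hp0.ne', ENNReal.rpow_one]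
    congr 2
    field_simp
  calc ∫⁻ x, (∫⁻ y, u y * v (x - y)) ^ p
      ≤ ∫⁻ x, (∫⁻ y, u y) ^ (p - 1) * ∫⁻ y, u y * v (x - y) ^ p := lintegral_mono h1
    _ = (∫⁻ y, u y) ^ (p - 1) * ((∫⁻ y, u y) * ∫⁻ x, v x ^ p) := by
        rw [lintegral_const_mul, lintegral_conv hu (hv.pow_const p)]
        exact Measurable.lintegral_prod_right' (f := fun z : E d × E d => u z.2 * v (z.1 - z.2) ^ p)
          (by fun_prop)
    _ = _ := by
        rw [← mul_assoc]
        congr 1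
        nth_rewrite 2 [← ENNReal.rpow_one (∫⁻ y, u y)]
        rw [← ENNReal.rpow_add_of_nonneg _ _ (by linarith) zero_le_one, sub_add_cancel]

lemma eLpNorm_invS_mulS_le_of_one_le {p : ℝ≥0∞} (hp : 1 ≤ p) (ψ g : 𝓢(E d, ℂ)) :
    eLpNorm (invS d (mulS ψ g)) p volume ≤
      ENNReal.ofReal (fourierConst d) * eLpNorm (invS d ψ) 1 volume *
        eLpNorm (invS d g) p volume := by
  rcases eq_or_ne p ∞ with rfl | hpt
  · rw [eLpNorm_exponent_top, eLpNorm_exponent_top, eLpNorm_one_eq_lintegral_enorm]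
    refine essSup_le_of_ae_le _ (Eventually.of_forall fun x => ?_)
    refine (enorm_invS_mulS_le ψ g x).trans ?_
    rw [mul_assoc]
    refine mul_le_mul_right ?_ _
    have h1 : ∀ᵐ y : E d, ‖invS d g (x - y)‖ₑ ≤ eLpNormEssSup (invS d g) volume :=
      (Measure.measurePreserving_sub_left volume x).quasiMeasurePreserving.ae
        (enorm_ae_le_eLpNormEssSup (invS d g) volume)
    calc ∫⁻ y, ‖invS d ψ y‖ₑ * ‖invS d g (x - y)‖ₑ
        ≤ ∫⁻ y, ‖invS d ψ y‖ₑ * eLpNormEssSup (invS d g) volume := by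
          refine lintegral_mono_ae ?_
          filter_upwards [h1] with y hy
          gcongr
      _ = _ := lintegral_mul_const _ (invS d ψ).continuous.enorm.measurable
  · obtain ⟨p, rfl⟩ : ∃ r : ℝ, p = ENNReal.ofReal r := ⟨p.toReal, (ENNReal.ofReal_toReal hpt).symm⟩
    have hp1 : 1 ≤ p := ENNReal.one_le_ofReal.1 hp
    have hp0 : 0 < p := by linarith
    refine eLpNorm_le_of_rpow_le hp0 ?_
    have hm := lintegral_conv_rpow_le (invS d ψ).continuous.enorm.measurable
      (invS d g).continuous.enorm.measurable hp1
    calc ∫⁻ x, ‖invS d (mulS ψ g) x‖ₑ ^ p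
        ≤ ∫⁻ x, (ENNReal.ofReal (fourierConst d) *
            ∫⁻ y, ‖invS d ψ y‖ₑ * ‖invS d g (x - y)‖ₑ) ^ p :=
          lintegral_mono fun x => ENNReal.rpow_le_rpow (enorm_invS_mulS_le ψ g x) hp0.le
      _ = ENNReal.ofReal (fourierConst d) ^ p *
            ∫⁻ x, (∫⁻ y, ‖invS d ψ y‖ₑ * ‖invS d g (x - y)‖ₑ) ^ p := by
          simp_rw [ENNReal.mul_rpow_of_nonneg _ _ hp0.le]
          exact lintegral_const_mul' _ _ (by finiteness)
      _ ≤ _ := by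
          rw [ENNReal.mul_rpow_of_nonneg _ _ hp0.le, ENNReal.mul_rpow_of_nonneg _ _ hp0.le,
            eLpNorm_rpow_eq _ hp0, mul_assoc, eLpNorm_one_eq_lintegral_enorm]
          gcongr

/-- Write u = u^p u^{1-p}, bound the second factor by (S ∫u)^{1-p}, and cancel (∫u)^{1-p}, which is
finite by hypothesis and nonzero outside a trivial case. A bound of sup by L¹ thus becomes a bound
of L¹ by L_p for p ≤ 1. -/
lemma lintegral_rpow_le_of_enorm_le {u : E d → ℝ≥0∞} (hu : Measurable u) {p : ℝ} (hp0 : 0 < p)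
    (hp1 : p ≤ 1) {S : ℝ≥0∞} (h : ∀ x, u x ≤ S * ∫⁻ y, u y) (hfin : ∫⁻ y, u y ≠ ∞) :
    (∫⁻ y, u y) ^ p ≤ S ^ (1 - p) * ∫⁻ y, u y ^ p := by
  set I := ∫⁻ y, u y with hI
  rcases eq_or_ne I 0 with h0 | h0
  · rw [h0, ENNReal.zero_rpow_of_pos hp0]; exact zero_le
  have hp2 : 0 ≤ 1 - p := by linarith
  have h1 : I ≤ (S ^ (1 - p) * ∫⁻ y, u y ^ p) * I ^ (1 - p) := by
    calc I = ∫⁻ y, u y := hI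
      _ ≤ ∫⁻ y, u y ^ p * (S * I) ^ (1 - p) := by
          refine lintegral_mono fun y => ?_
          calc u y = u y ^ p * u y ^ (1 - p) := by
                rw [← ENNReal.rpow_add_of_nonneg _ _ hp0.le (by linarith)]; simp
            _ ≤ _ := by
                gcongr
                exact h y
      _ = _ := by
          rw [lintegral_mul_const _ (hu.pow_const p), ENNReal.mul_rpow_of_nonneg _ _ (by linarith)]
          ring
  have h2 : I = I ^ p * I ^ (1 - p) := by
    rw [← ENNReal.rpow_add_of_nonneg _ _ hp0.le (by linarith)]; simp
  have h3 : I ^ (1 - p) ≠ 0 := by simp [h0, hfin]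
  have h4 : I ^ (1 - p) ≠ ∞ := ENNReal.rpow_ne_top_of_nonneg (by linarith) hfin
  exact (ENNReal.mul_le_mul_iff_left h3 h4).1 (h2.symm.trans_le h1)

/-- Smooth cutoff functions adapted to ellipsoids. -/
lemma exists_cutoff (a : Fin d → ℝ) {r R : ℝ} (hr : 0 < r) (hrR : r < R) :
    ∃ C : ℕ → ℝ, (∀ n, 0 ≤ C n) ∧ ∀ t > 0, ∀ b, ∃ χ : 𝓢(E d, ℂ), (∀ x, ‖χ x‖ ≤ 1) ∧
      (∀ x ∈ ellip a t b r, χ x = 1) ∧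
      (∀ n, ∀ x ∉ ellip a t b R, iteratedFDeriv ℝ n χ x = 0) ∧
      ∀ B, (∀ y : E d, ‖dl a t⁻¹ y‖ ≤ B * ‖y‖) → 0 ≤ B → ∀ n x,
        ‖iteratedFDeriv ℝ n χ x‖ ≤ C n * B ^ n := by
  -- The outer radius is below R, so the closed support lies in the open ellipsoid of radius R and
  -- every derivative vanishes off that ellipsoid.
  let f : ContDiffBump (0 : E d) := ⟨r, (r + R) / 2, hr, by linarith⟩
  have hsm : ContDiff ℝ ((⊤ : ℕ∞) : WithTop ℕ∞) (fun x => ((f x : ℝ) : ℂ)) :=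
    Complex.ofRealCLM.contDiff.comp f.contDiff
  have hcs : HasCompactSupport (fun x => ((f x : ℝ) : ℂ)) :=
    f.hasCompactSupport.comp_left (g := fun t : ℝ => (t : ℂ)) (by simp)
  set m : 𝓢(E d, ℂ) := hcs.toSchwartzMap hsm
  have hm : ∀ x, m x = ((f x : ℝ) : ℂ) := fun x => rfl
  refine ⟨fun n => SchwartzMap.seminorm ℝ 0 n m, fun n => apply_nonneg _ _, fun t ht b => ?_⟩
  set L : E d →L[ℝ] E d := LinearMap.toContinuousLinearMap (dl a t⁻¹) with hL
  have hLa : ∀ x, L x = dl a t⁻¹ x := fun x => rfl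
  have hsm' : ContDiff ℝ ((⊤ : ℕ∞) : WithTop ℕ∞) (fun x => m (L (x - b))) :=
    (m.smooth ⊤).comp (L.contDiff.comp (contDiff_id.sub contDiff_const))
  have hcs' : HasCompactSupport (fun x => m (L (x - b))) := by
    refine HasCompactSupport.of_support_subset_isCompact
      (Metric.isCompact_of_isClosed_isBounded isClosed_closure (isBounded_ellip (a := a) ht b R).closure)
      fun x hx => subset_closure ?_
    rw [Function.mem_support, hm, Ne, Complex.ofReal_eq_zero, ← Ne, ← Function.mem_support,
      f.support_eq, Metric.mem_ball, dist_zero_right] at hx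
    rw [ellip, Set.mem_ofPred_eq, ← hLa]
    exact hx.trans (by change (r + R) / 2 < R; linarith)
  have hder : ∀ n x, iteratedFDeriv ℝ n (fun x => m (L (x - b))) x =
      (iteratedFDeriv ℝ n m (L (x - b))).compContinuousLinearMap fun _ => L := by
    intro n x
    have h1 := iteratedFDeriv_comp_add_right (𝕜 := ℝ) (f := (m : E d → ℂ) ∘ L) n (-b) x
    have h2 := L.iteratedFDeriv_comp_right (m.smooth ⊤) (x - b)
      (show (n : WithTop ℕ∞) ≤ ((⊤ : ℕ∞) : WithTop ℕ∞) by exact_mod_cast le_top)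
    simp only [← sub_eq_add_neg] at h1
    rw [← h2, ← h1]
    rfl
  refine ⟨hcs'.toSchwartzMap hsm', fun x => ?_, fun x hx => ?_, fun n x hx => ?_,
    fun B hB hB0 n x => ?_⟩
  · change ‖m (L (x - b))‖ ≤ 1
    rw [hm, Complex.norm_real, Real.norm_of_nonneg f.nonneg]
    exact f.le_one
  · change m (L (x - b)) = 1
    rw [hm, f.one_of_mem_closedBall, Complex.ofReal_one]
    rw [Metric.mem_closedBall, dist_zero_right]
    exact (show ‖dl a t⁻¹ (x - b)‖ < r from hx).le
  · change iteratedFDeriv ℝ n (fun x => m (L (x - b))) x = 0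
    rw [hder]
    have : iteratedFDeriv ℝ n m (L (x - b)) = 0 := by
      by_contra hne
      have h1 := support_iteratedFDeriv_subset (𝕜 := ℝ) (f := (m : E d → ℂ)) n
        (Function.mem_support.2 hne)
      have h2 : tsupport (m : E d → ℂ) ⊆ Metric.closedBall 0 ((r + R) / 2) := by
        refine closure_minimal (fun y hy => ?_) Metric.isClosed_closedBall
        rw [Function.mem_support, hm, Ne, Complex.ofReal_eq_zero, ← Ne, ← Function.mem_support,
          f.support_eq] at hy
        exact Metric.ball_subset_closedBall hy
      have h3 := h2 h1
      rw [Metric.mem_closedBall, dist_zero_right] at h3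
      refine hx ?_
      rw [ellip, Set.mem_ofPred_eq, ← hLa]
      linarith
    rw [this]
    ext v; simp
  · change ‖iteratedFDeriv ℝ n (fun x => m (L (x - b))) x‖ ≤ _
    rw [hder]
    refine (ContinuousMultilinearMap.norm_compContinuousLinearMap_le _ _).trans ?_
    rw [Finset.prod_const, Finset.card_univ, Fintype.card_fin]
    have h1 : ‖L‖ ≤ B := L.opNorm_le_bound hB0 hB
    gcongr
    exact SchwartzMap.norm_iteratedFDeriv_le_seminorm ℝ m n _

/-- With a cutoff χ equal to 1 on the spectrum, G is up to a constant the convolution of G with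
𝓕⁻¹χ, and the supremum of |𝓕⁻¹χ| is at most a constant times the volume of the support of χ, which
is proportional to t^d. -/
lemma enorm_le_of_band (ha : IsAnisotropy a) {R : ℝ} (hR : 0 < R) :
    ∃ C : ℝ≥0, ∀ t > 0, ∀ b, ∀ G : 𝓢(E d, ℂ), (∀ ξ ∉ ellip a t b R, fourierS d G ξ = 0) →
      ∀ x, ‖G x‖ₑ ≤ C * ENNReal.ofReal (t ^ d) * ∫⁻ y, ‖G y‖ₑ := by
  obtain ⟨_, _, hC⟩ := exists_cutoff a hR (show R < 2 * R by linarith)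
  set V := volume (Metric.ball (0 : E d) (2 * R))
  have hV : V ≠ ∞ := measure_ball_lt_top.ne
  refine ⟨(ENNReal.ofReal (fourierConst d) * (ENNReal.ofReal (fourierConst d) * V)).toNNReal,
    fun t ht b G hG x => ?_⟩
  obtain ⟨χ, hχ1, hχ2, hχ3, -⟩ := hC t ht b
  have hχ0 : ∀ ξ ∉ ellip a t b (2 * R), χ ξ = 0 := fun ξ hξ => by
    have := hχ3 0 ξ hξ
    rw [← norm_eq_zero, norm_iteratedFDeriv_zero, norm_eq_zero] at this
    exact this
  have h1 : G = invS d (mulS (fourierS d G) χ) := by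
    have : mulS (fourierS d G) χ = fourierS d G := by
      ext ξ
      rw [mulS_apply]
      by_cases hξ : ξ ∈ ellip a t b R
      · rw [hχ2 ξ hξ, mul_one]
      · rw [hG ξ hξ, zero_mul]
    rw [this, invS_fourierS]
  have hsup : ∀ y, ‖invS d χ y‖ₑ ≤ ENNReal.ofReal (fourierConst d) *
      (ENNReal.ofReal (t ^ d) * V) := by
    intro y
    rw [invS_apply, fourierS_apply, enorm_mul]
    refine mul_le_mul' ?_ ?_
    · rw [← ofReal_norm, Complex.norm_real]
      exact ENNReal.ofReal_le_ofReal (Real.norm_of_nonneg (fourierConst_pos d).le).le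
    · refine (enorm_integral_le_lintegral_enorm _).trans ?_
      rw [← volume_ellip ha ht b (2 * R), ← setLIntegral_one,
        ← lintegral_indicator (isOpen_ellip t b _).measurableSet]
      refine lintegral_mono fun ξ => ?_
      by_cases hξ : ξ ∈ ellip a t b (2 * R)
      · rw [Set.indicator_of_mem hξ, enorm_mul, ← ofReal_norm, ← ofReal_norm,
          Complex.norm_exp, ← ENNReal.ofReal_mul (by positivity)]
        refine ENNReal.ofReal_le_one.2 ?_
        have := hχ1 ξ
        simpa using this
      · simp [hχ0 ξ hξ]
  rw [ENNReal.coe_toNNReal (by finiteness)]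
  calc ‖G x‖ₑ = ‖invS d (mulS (fourierS d G) χ) x‖ₑ := by rw [← h1]
    _ ≤ ENNReal.ofReal (fourierConst d) * ∫⁻ y, ‖G y‖ₑ * ‖invS d χ (x - y)‖ₑ := by
        have := enorm_invS_mulS_le (fourierS d G) χ x
        rwa [invS_fourierS] at this
    _ ≤ ENNReal.ofReal (fourierConst d) * ∫⁻ y, ‖G y‖ₑ *
          (ENNReal.ofReal (fourierConst d) * (ENNReal.ofReal (t ^ d) * V)) := by
        gcongr
        exact hsup _
    _ = _ := by
        rw [lintegral_mul_const _ G.continuous.enorm.measurable]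
        ring

lemma ellip_sub_mem {t R R' : ℝ} {b b' x y : E d} (hx : x ∈ ellip a t b R)
    (hy : y ∈ ellip a t b' R') : x - y ∈ ellip a t (b - b') (R + R') := by
  simp only [ellip, Set.mem_ofPred_eq] at *
  have : x - y - (b - b') = (x - b) - (y - b') := by abel
  rw [this, map_sub]
  exact (norm_sub_le _ _).trans_lt (add_lt_add hx hy)

/-- The product `y ↦ (𝓕⁻¹ψ)(y) (𝓕⁻¹g)(x - y)` is band-limited. -/
lemma fourierS_mul_reflect_eq_zero {t R : ℝ} {b b' : E d} {ψ g : 𝓢(E d, ℂ)}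
    (hψ : ∀ ξ ∉ ellip a t b R, ψ ξ = 0) (hg : ∀ ξ ∉ ellip a t b' R, g ξ = 0) (x : E d) :
    ∀ ξ ∉ ellip a t (b - b') (R + R),
      fourierS d (mulS (invS d ψ) (reflS d (transS (-x) (invS d g)))) ξ = 0 := by
  intro ξ hξ
  have h1 : ∀ z, fourierS d (reflS d (transS (-x) (invS d g))) z = modS x g (-z) := by
    intro z
    have h2 : transS (-x) (invS d g) = invS d (modS x g) := by
      ext y
      rw [invS_apply, fourierS_modS, SchwartzMap.compSubConstCLM_apply,
        SchwartzMap.compSubConstCLM_apply, invS_apply]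
      congr 1
      abel
    rw [h2, fourierS_reflS, fourierS_invS, reflS_apply]
  rw [fourierS_mulS, fourierS_invS]
  simp_rw [h1]
  rw [integral_eq_zero_of_ae, mul_zero]
  refine Eventually.of_forall fun z => ?_
  change modS x g (-z) * ψ (ξ - z) = 0
  by_contra hne
  have hg' : -z ∈ ellip a t b' R := by
    by_contra h
    exact hne (by rw [modS_apply, hg _ h]; simp)
  have hψ' : ξ - z ∈ ellip a t b R := by
    by_contra h
    exact hne (by rw [hψ _ h]; simp)
  have := ellip_sub_mem hψ' hg'
  exact hξ (by simpa using this)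

/-- The substitute for Young's inequality when p ≤ 1. For fixed x the integrand of the convolution
is band-limited at scale t, so its L¹ norm is at most a constant times t^{d(1/p-1)} times its L_p
norm; integrating p-th powers over x and using Tonelli separates the two factors. -/
lemma eLpNorm_invS_mulS_le_of_le_one (ha : IsAnisotropy a) {R p : ℝ} (hR : 0 < R) (hp0 : 0 < p)
    (hp1 : p ≤ 1) : ∃ C : ℝ≥0, ∀ t > 0, ∀ b b', ∀ ψ g : 𝓢(E d, ℂ),
      (∀ ξ ∉ ellip a t b R, ψ ξ = 0) → (∀ ξ ∉ ellip a t b' R, g ξ = 0) →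
      eLpNorm (invS d (mulS ψ g)) (ENNReal.ofReal p) volume ≤
        C * ENNReal.ofReal (t ^ d) ^ (1 / p - 1) * eLpNorm (invS d ψ) (ENNReal.ofReal p) volume *
          eLpNorm (invS d g) (ENNReal.ofReal p) volume := by
  obtain ⟨C, hC⟩ := enorm_le_of_band ha (show 0 < R + R by linarith)
  have hq : (0 : ℝ) ≤ 1 / p - 1 := by
    rw [sub_nonneg, le_div_iff₀ hp0]; linarith
  refine ⟨(ENNReal.ofReal (fourierConst d) * (C : ℝ≥0∞) ^ (1 / p - 1)).toNNReal,
    fun t ht b b' ψ g hψ hg => ?_⟩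
  rw [ENNReal.coe_toNNReal (by finiteness)]
  refine eLpNorm_le_of_rpow_le hp0 ?_
  have hmψ := (invS d ψ).continuous.enorm.measurable
  have hmg := (invS d g).continuous.enorm.measurable
  have key : ∀ x, (∫⁻ y, ‖invS d ψ y‖ₑ * ‖invS d g (x - y)‖ₑ) ^ p ≤
      (C * ENNReal.ofReal (t ^ d)) ^ (1 - p) *
        ∫⁻ y, ‖invS d ψ y‖ₑ ^ p * ‖invS d g (x - y)‖ₑ ^ p := by
    intro x
    set G := mulS (invS d ψ) (reflS d (transS (-x) (invS d g)))
    have hG : ∀ y, ‖G y‖ₑ = ‖invS d ψ y‖ₑ * ‖invS d g (x - y)‖ₑ := by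
      intro y
      simp only [G, mulS_apply, reflS_apply, SchwartzMap.compSubConstCLM_apply, enorm_mul]
      congr 3
      abel
    have h1 := lintegral_rpow_le_of_enorm_le G.continuous.enorm.measurable hp0 hp1
      (hC t ht _ G (fourierS_mul_reflect_eq_zero hψ hg x)) G.integrable.2.ne
    simp_rw [hG, ENNReal.mul_rpow_of_nonneg _ _ hp0.le] at h1
    exact h1
  calc ∫⁻ x, ‖invS d (mulS ψ g) x‖ₑ ^ p
      ≤ ∫⁻ x, ENNReal.ofReal (fourierConst d) ^ p * ((C * ENNReal.ofReal (t ^ d)) ^ (1 - p) *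
          ∫⁻ y, ‖invS d ψ y‖ₑ ^ p * ‖invS d g (x - y)‖ₑ ^ p) := by
        refine lintegral_mono fun x => ?_
        refine (ENNReal.rpow_le_rpow (enorm_invS_mulS_le ψ g x) hp0.le).trans ?_
        rw [ENNReal.mul_rpow_of_nonneg _ _ hp0.le]
        gcongr
        exact key x
    _ = ENNReal.ofReal (fourierConst d) ^ p * ((C * ENNReal.ofReal (t ^ d)) ^ (1 - p) *
          ((∫⁻ y, ‖invS d ψ y‖ₑ ^ p) * ∫⁻ y, ‖invS d g y‖ₑ ^ p)) := by
        rw [lintegral_const_mul' _ _ (by finiteness), lintegral_const_mul' _ _ (by finiteness),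
          lintegral_conv (hmψ.pow_const p) (hmg.pow_const p)]
    _ = _ := by
        have hpp : (1 / p - 1) * p = 1 - p := by field_simp
        simp only [ENNReal.mul_rpow_of_nonneg _ _ hp0.le, eLpNorm_rpow_eq _ hp0,
          ← ENNReal.rpow_mul, hpp, ENNReal.mul_rpow_of_nonneg _ _ (show 0 ≤ 1 - p by linarith)]
        ring

/-- The bound of sup by L¹ for band-limited functions is combined with the bound of L¹ by L_p that
it implies. -/
lemma enorm_le_eLpNorm_of_le_one (ha : IsAnisotropy a) {R p : ℝ} (hR : 0 < R) (hp0 : 0 < p)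
    (hp1 : p ≤ 1) : ∃ C : ℝ≥0, ∀ t > 0, ∀ b, ∀ G : 𝓢(E d, ℂ),
      (∀ ξ ∉ ellip a t b R, fourierS d G ξ = 0) → ∀ x,
        ‖G x‖ₑ ≤ C * ENNReal.ofReal (t ^ d) ^ (1 / p) * eLpNorm G (ENNReal.ofReal p) volume := by
  obtain ⟨C, hC⟩ := enorm_le_of_band ha hR
  refine ⟨((C : ℝ≥0∞) ^ (1 / p)).toNNReal, fun t ht b G hG x => ?_⟩
  rw [ENNReal.coe_toNNReal (by finiteness)]
  have h1 := lintegral_rpow_le_of_enorm_le G.continuous.enorm.measurable hp0 hp1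
      (hC t ht _ G hG) G.integrable.2.ne
  refine (ENNReal.rpow_le_rpow_iff hp0).1 ?_
  calc ‖G x‖ₑ ^ p ≤ (C * ENNReal.ofReal (t ^ d) * ∫⁻ y, ‖G y‖ₑ) ^ p :=
        ENNReal.rpow_le_rpow (hC t ht _ G hG x) hp0.le
    _ = (C * ENNReal.ofReal (t ^ d)) ^ p * (∫⁻ y, ‖G y‖ₑ) ^ p :=
        ENNReal.mul_rpow_of_nonneg _ _ hp0.le
    _ ≤ (C * ENNReal.ofReal (t ^ d)) ^ p *
          ((C * ENNReal.ofReal (t ^ d)) ^ (1 - p) * ∫⁻ y, ‖G y‖ₑ ^ p) := by gcongr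
    _ = (C * ENNReal.ofReal (t ^ d)) * ∫⁻ y, ‖G y‖ₑ ^ p := by
        rw [← mul_assoc, ← ENNReal.rpow_add_of_nonneg _ _ hp0.le (by linarith)]
        simp
    _ = _ := by
        simp only [ENNReal.mul_rpow_of_nonneg _ _ hp0.le, eLpNorm_rpow_eq _ hp0,
          ← ENNReal.rpow_mul, one_div_mul_cancel hp0.ne', ENNReal.rpow_one]

/-- Hölder's inequality for the reproducing formula `G = 𝓕⁻¹(χ 𝓕G)`. -/
lemma enorm_le_eLpNorm_of_one_le {p q : ℝ≥0∞} [hpq : ENNReal.HolderConjugate p q]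
    {χ G : 𝓢(E d, ℂ)} (hχ : mulS (fourierS d G) χ = fourierS d G) (x : E d) :
    ‖G x‖ₑ ≤ ENNReal.ofReal (fourierConst d) *
      (eLpNorm G p volume * eLpNorm (invS d χ) q volume) := by
  have h1 := enorm_invS_mulS_le (fourierS d G) χ x
  rw [hχ, invS_fourierS] at h1
  refine h1.trans ?_
  gcongr
  rw [← eLpNorm_comp_sub_left (invS d χ).continuous q x]
  have h2 := eLpNorm_smul_le_mul_eLpNorm (p := p) (q := q) (r := 1) (μ := volume) (f := fun y => invS d χ (x - y))
    (φ := G) (((invS d χ).continuous.comp (by fun_prop)).aestronglyMeasurable)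
    G.continuous.aestronglyMeasurable
  rw [eLpNorm_one_eq_lintegral_enorm] at h2
  refine le_trans (le_of_eq ?_) h2
  congr 1; ext y
  simp [enorm_mul]

end BandLimited

end HomDecomp

end

open MeasureTheory Filter Topology

noncomputable section

namespace HomDecomp

/-! ### The seminorms of `𝓢₀` -/

section SZero

variable {d : ℕ}

/-- Expanding every argument in the standard basis produces d^n terms. This passes from the partial
derivatives in `s0Norm` to operator norms. -/
lemma norm_multilinear_le_of_basis {n : ℕ} (T : E d [×n]→L[ℝ] ℂ) {B : ℝ} (hB0 : 0 ≤ B)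
    (hB : ∀ v : Fin n → Fin d, ‖T fun i => EuclideanSpace.single (v i) 1‖ ≤ B) :
    ‖T‖ ≤ (d : ℝ) ^ n * B := by
  refine T.opNorm_le_bound (by positivity) fun m => ?_
  have hm : m = fun i => ∑ k, m i k • (EuclideanSpace.single k (1 : ℝ) : E d) := by
    ext i l
    simp [Pi.single_apply]
  have h1 : T m = ∑ v : Fin n → Fin d, (∏ i, m i (v i)) • T fun i => EuclideanSpace.single (v i) 1 := by
    conv_lhs => rw [hm]
    rw [T.map_sum]
    exact Finset.sum_congr rfl fun v _ => T.map_smul_univ _ _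
  rw [h1]
  refine (norm_sum_le _ _).trans ?_
  have h2 : ∀ v ∈ (Finset.univ : Finset (Fin n → Fin d)),
      ‖(∏ i, m i (v i)) • T fun i => EuclideanSpace.single (v i) 1‖ ≤ (∏ i, ‖m i‖) * B := by
    intro v _
    rw [norm_smul]
    refine mul_le_mul ?_ (hB v) (norm_nonneg _) (Finset.prod_nonneg fun i _ => norm_nonneg _)
    rw [norm_prod]
    exact Finset.prod_le_prod (fun i _ => norm_nonneg _) fun i _ => PiLp.norm_apply_le _ _
  refine (Finset.sum_le_card_nsmul _ _ _ h2).trans (le_of_eq ?_)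
  simp
  ring

/-- Decay of all derivatives up to order `n` at the origin and at infinity. -/
def HasDecay (η : E d → ℂ) (n L : ℕ) (A : ℝ) : Prop :=
  ∀ m ≤ n, ∀ ξ ≠ 0, ‖iteratedFDeriv ℝ m η ξ‖ * wt ξ ^ L ≤ A

lemma wt_pos {x : E d} (hx : x ≠ 0) : 0 < wt x := by linarith [two_le_wt hx]

lemma hasDecay_fourierS (M : ℕ) : ∃ C : ℝ, 0 ≤ C ∧ ∀ θ : 𝓢(E d, ℂ), s0Norm M θ < ∞ →
    HasDecay (fourierS d θ) M M (C * (s0Norm M θ).toReal) := by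
  refine ⟨2 ^ M * (1 + d : ℝ) ^ M, by positivity, fun θ hθ n hn ξ hξ => ?_⟩
  have hpos : 0 < ‖ξ‖ := norm_pos_iff.2 hξ
  set S := (s0Norm M θ).toReal
  have hS : 0 ≤ S := ENNReal.toReal_nonneg
  set w := ‖ξ‖ ^ M + (‖ξ‖ ^ M)⁻¹
  have hw : 0 < w := by positivity
  have h1 : ∀ v : Fin n → Fin d,
      ‖iteratedFDeriv ℝ n (fourierS d θ) ξ fun i => EuclideanSpace.single (v i) 1‖ ≤ S / w := by
    intro v
    rw [le_div_iff₀ hw]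
    rw [← ENNReal.ofReal_le_iff_le_toReal hθ.ne]
    exact le_iSup_of_le n <| le_iSup_of_le hn <| le_iSup_of_le v <| le_iSup_of_le ξ <|
      le_iSup_of_le hξ le_rfl
  have h2 := norm_multilinear_le_of_basis _ (by positivity) h1
  have h3 : wt ξ ^ M ≤ 2 ^ M * w := by
    have := add_pow_le_two M hpos.le (inv_pos.2 hpos).le
    rwa [inv_pow] at this
  have h4 : (d : ℝ) ^ n ≤ (1 + d : ℝ) ^ M := by
    calc (d : ℝ) ^ n ≤ (1 + d : ℝ) ^ n := by gcongr; linarith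
      _ ≤ _ := pow_le_pow_right₀ (by linarith [Nat.cast_nonneg (α := ℝ) d]) hn
  have := (wt_pos hξ).le
  calc ‖iteratedFDeriv ℝ n (fourierS d θ) ξ‖ * wt ξ ^ M
      ≤ ((1 + d : ℝ) ^ M * (S / w)) * (2 ^ M * w) := by
        gcongr
        exact h2.trans (by gcongr)
    _ = _ := by field_simp

lemma norm_iteratedFDeriv_reflS (η : 𝓢(E d, ℂ)) (n : ℕ) (ξ : E d) :
    ‖iteratedFDeriv ℝ n (reflS d η) ξ‖ = ‖iteratedFDeriv ℝ n η (-ξ)‖ :=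
  LinearIsometryEquiv.norm_iteratedFDeriv_comp_right (LinearIsometryEquiv.neg ℝ) η ξ n

lemma HasDecay.reflS {η : 𝓢(E d, ℂ)} {n L : ℕ} {A : ℝ} (h : HasDecay η n L A) :
    HasDecay (reflS d η) n L A := fun m hm ξ hξ => by
  rw [norm_iteratedFDeriv_reflS, ← wt_neg]
  exact h m hm (-ξ) (neg_ne_zero.2 hξ)

lemma hasDecay_invS (M : ℕ) : ∃ C : ℝ, 0 ≤ C ∧ ∀ θ : 𝓢(E d, ℂ), s0Norm M θ < ∞ →
    HasDecay (invS d θ) M M (C * (s0Norm M θ).toReal) := by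
  obtain ⟨C, hC, h⟩ := hasDecay_fourierS (d := d) M
  exact ⟨C, hC, fun θ hθ => (h θ hθ).reflS⟩

lemma s0Norm_le_of_hasDecay {M : ℕ} {θ : 𝓢(E d, ℂ)} {A : ℝ} (h : HasDecay (fourierS d θ) M M A) :
    s0Norm M θ ≤ ENNReal.ofReal (2 * A) := by
  refine iSup_le fun n => iSup_le fun hn => iSup_le fun v => iSup_le fun ξ => iSup_le fun hξ => ?_
  refine ENNReal.ofReal_le_ofReal ?_
  have h1 : ‖iteratedFDeriv ℝ n (fourierS d θ) ξ fun i => EuclideanSpace.single (v i) 1‖ ≤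
      ‖iteratedFDeriv ℝ n (fourierS d θ) ξ‖ := by
    refine (ContinuousMultilinearMap.le_opNorm _ _).trans ?_
    simp
  have h2 : ‖ξ‖ ^ M + (‖ξ‖ ^ M)⁻¹ ≤ 2 * wt ξ ^ M := by
    have h3 := pow_le_pow_left₀ (norm_nonneg _) (norm_le_wt ξ) M
    have h4 := pow_le_pow_left₀ (by positivity) (inv_norm_le_wt ξ) M
    rw [inv_pow] at h4
    linarith
  calc _ ≤ ‖iteratedFDeriv ℝ n (fourierS d θ) ξ‖ * (2 * wt ξ ^ M) := by gcongr
    _ = 2 * (‖iteratedFDeriv ℝ n (fourierS d θ) ξ‖ * wt ξ ^ M) := by ring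
    _ ≤ _ := by gcongr; exact h n hn ξ hξ

lemma differentiable_iteratedFDeriv (η : 𝓢(E d, ℂ)) (n : ℕ) :
    Differentiable ℝ (iteratedFDeriv ℝ n η) :=
  (η.smooth ⊤).differentiable_iteratedFDeriv (by exact_mod_cast WithTop.coe_lt_top _)

/-- Finiteness of ‖θ‖_{n+1} makes the derivative O(|ξ|) off the origin; continuity gives the value
at 0. -/
lemma iteratedFDeriv_zero_of_mem_S0 [Nontrivial (E d)] {θ : 𝓢(E d, ℂ)} (hθ : θ ∈ S0 d) (n : ℕ) :
    iteratedFDeriv ℝ n (fourierS d θ) 0 = 0 := by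
  obtain ⟨C, hC, h⟩ := hasDecay_fourierS (d := d) (n + 1)
  set A := C * (s0Norm (n + 1) θ).toReal
  have h1 : ∀ ξ : E d, ξ ≠ 0 → ‖iteratedFDeriv ℝ n (fourierS d θ) ξ‖ ≤ A * ‖ξ‖ := by
    intro ξ hξ
    have hpos : 0 < ‖ξ‖ := norm_pos_iff.2 hξ
    have h2 := h θ (hθ _) n (by omega) ξ hξ
    have h3 : ‖ξ‖⁻¹ ≤ wt ξ ^ (n + 1) := by
      refine (inv_norm_le_wt ξ).trans ?_
      exact le_self_pow₀ (by linarith [two_le_wt hξ]) (by omega)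
    have h4 : ‖iteratedFDeriv ℝ n (fourierS d θ) ξ‖ * ‖ξ‖⁻¹ ≤ A :=
      le_trans (by gcongr) h2
    rwa [← div_eq_mul_inv, div_le_iff₀ hpos] at h4
  have hc : Tendsto (fun ξ => ‖iteratedFDeriv ℝ n (fourierS d θ) ξ‖) (𝓝[≠] 0)
      (𝓝 ‖iteratedFDeriv ℝ n (fourierS d θ) 0‖) :=
    (((differentiable_iteratedFDeriv _ n).continuous.norm).tendsto 0).mono_left nhdsWithin_le_nhds
  have h0 : Tendsto (fun ξ : E d => A * ‖ξ‖) (𝓝[≠] 0) (𝓝 0) := by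
    have : Continuous fun ξ : E d => A * ‖ξ‖ := by fun_prop
    have h5 := this.tendsto 0
    simp only [norm_zero, mul_zero] at h5
    exact h5.mono_left nhdsWithin_le_nhds
  have h6 := le_of_tendsto_of_tendsto hc h0
    (eventually_nhdsWithin_of_forall fun ξ hξ => h1 ξ hξ)
  exact norm_le_zero_iff.1 h6

/-- All derivatives vanish at 0, so each use of the mean value inequality on the ball of radius |ξ|
gains one power of |ξ| at the cost of one derivative. -/
lemma norm_iteratedFDeriv_le_pow [Nontrivial (E d)] {θ : 𝓢(E d, ℂ)} (hθ : θ ∈ S0 d) (m : ℕ) :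
    ∀ (n : ℕ) (ξ : E d), ‖iteratedFDeriv ℝ n (fourierS d θ) ξ‖ ≤
      ‖ξ‖ ^ m * SchwartzMap.seminorm ℝ 0 (n + m) (fourierS d θ) := by
  induction m with
  | zero =>
    intro n ξ
    simpa using SchwartzMap.norm_iteratedFDeriv_le_seminorm ℝ (fourierS d θ) n ξ
  | succ m ih =>
    intro n ξ
    set P := SchwartzMap.seminorm ℝ 0 (n + (m + 1)) (fourierS d θ)
    have h1 := (convex_closedBall (0 : E d) ‖ξ‖).norm_image_sub_le_of_norm_fderiv_le
      (f := iteratedFDeriv ℝ n (fourierS d θ)) (C := ‖ξ‖ ^ m * P) (𝕜 := ℝ) (x := 0) (y := ξ)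
      (fun z _ => differentiable_iteratedFDeriv _ n z) (fun z hz => ?_) (by simp) (by simp)
    · rw [iteratedFDeriv_zero_of_mem_S0 hθ, sub_zero, sub_zero] at h1
      refine h1.trans (le_of_eq ?_)
      ring
    · rw [norm_fderiv_iteratedFDeriv]
      have h2 := ih (n + 1) z
      have h3 : n + 1 + m = n + (m + 1) := by ring
      rw [h3] at h2
      refine h2.trans ?_
      have h4 : ‖z‖ ≤ ‖ξ‖ := by simpa using hz
      have : 0 ≤ P := apply_nonneg _ _
      gcongr

/-- Decay at infinity is a Schwartz seminorm, and decay at 0 comes from the infinite order of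
vanishing. Hence ‖·‖_M is controlled by the topology that 𝓢 induces on 𝓢₀. -/
lemma HasDecay.of_mem_S0 [Nontrivial (E d)] (M : ℕ) {θ : 𝓢(E d, ℂ)} (hθ : θ ∈ S0 d) :
    HasDecay (fourierS d θ) M M
      (2 ^ M * (2 * (Finset.Iic (2 * M, 2 * M)).sup (schwartzSeminormFamily ℂ (E d) ℂ)
        (fourierS d θ))) := by
  intro n hn ξ hξ
  have hpos : 0 < ‖ξ‖ := norm_pos_iff.2 hξ
  set P := (Finset.Iic (2 * M, 2 * M)).sup (schwartzSeminormFamily ℂ (E d) ℂ) (fourierS d θ)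
  have hP : ∀ k l, k ≤ 2 * M → l ≤ 2 * M → SchwartzMap.seminorm ℝ k l (fourierS d θ) ≤ P := by
    intro k l hk hl
    have := Finset.le_sup (f := schwartzSeminormFamily ℂ (E d) ℂ)
      (Finset.mem_Iic.2 (show (k, l) ≤ (2 * M, 2 * M) from ⟨hk, hl⟩))
    exact Seminorm.le_def.1 this _
  have h1 := (norm_iteratedFDeriv_le_pow hθ M n ξ).trans
    (mul_le_mul_of_nonneg_left (hP 0 (n + M) (by omega) (by omega)) (by positivity))
  have h2 := (SchwartzMap.le_seminorm ℝ M n (fourierS d θ) ξ).trans (hP M n (by omega) (by omega))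
  have h3 : wt ξ ^ M ≤ 2 ^ M * (‖ξ‖ ^ M + (‖ξ‖ ^ M)⁻¹) := by
    have := add_pow_le_two M hpos.le (inv_pos.2 hpos).le
    rwa [inv_pow] at this
  calc ‖iteratedFDeriv ℝ n (fourierS d θ) ξ‖ * wt ξ ^ M
      ≤ ‖iteratedFDeriv ℝ n (fourierS d θ) ξ‖ * (2 ^ M * (‖ξ‖ ^ M + (‖ξ‖ ^ M)⁻¹)) := by gcongr
    _ = 2 ^ M * (‖ξ‖ ^ M * ‖iteratedFDeriv ℝ n (fourierS d θ) ξ‖ +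
          ‖iteratedFDeriv ℝ n (fourierS d θ) ξ‖ * (‖ξ‖ ^ M)⁻¹) := by ring
    _ ≤ 2 ^ M * (P + ‖ξ‖ ^ M * P * (‖ξ‖ ^ M)⁻¹) := by gcongr
    _ = _ := by field_simp; ring

lemma continuous_sup_seminorm (s : Finset (ℕ × ℕ)) :
    Continuous ⇑(s.sup (schwartzSeminormFamily ℂ (E d) ℂ) : Seminorm ℂ 𝓢(E d, ℂ)) := by
  classical
  induction s using Finset.induction_on with
  | empty =>
    rw [Finset.sup_empty, Seminorm.coe_bot]
    exact continuous_const
  | insert m s _ ih =>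
    rw [Finset.sup_insert, Seminorm.coe_sup]
    exact ((schwartz_withSeminorms ℂ (E d) ℂ).continuous_seminorm m).max ih

/-- The seminorms `‖·‖_M` are continuous on `𝓢₀`. -/
lemma exists_s0Norm_le [Nontrivial (E d)] (M : ℕ) : ∃ (s : Seminorm ℂ 𝓢(E d, ℂ)), Continuous s ∧
    ∀ θ ∈ S0 d, s0Norm M θ ≤ ENNReal.ofReal (s θ) := by
  set P := (Finset.Iic (2 * M, 2 * M)).sup (schwartzSeminormFamily ℂ (E d) ℂ)
  have hP : Continuous P := continuous_sup_seminorm _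
  refine ⟨(2 * (2 ^ M * 2) : ℝ≥0) • P.comp (fourierS d).toLinearMap, ?_, fun θ hθ => ?_⟩
  · change Continuous fun f => ((2 * (2 ^ M * 2) : ℝ≥0) : ℝ) * P (fourierS d f)
    exact continuous_const.mul (hP.comp (fourierS d).continuous)
  · refine (s0Norm_le_of_hasDecay (HasDecay.of_mem_S0 M hθ)).trans (le_of_eq ?_)
    congr 1
    change _ = ((2 * (2 ^ M * 2) : ℝ≥0) : ℝ) * P (fourierS d θ)
    push_cast
    ring

lemma norm_iteratedFDeriv_mulS_le {χ η : 𝓢(E d, ℂ)} {ξ : E d} {m : ℕ} {X A : ℝ}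
    (hX : ∀ i ≤ m, ‖iteratedFDeriv ℝ i χ ξ‖ ≤ X) (hA : ∀ i ≤ m, ‖iteratedFDeriv ℝ i η ξ‖ ≤ A) :
    ‖iteratedFDeriv ℝ m (mulS χ η) ξ‖ ≤ 2 ^ m * X * A := by
  have h1 := norm_iteratedFDeriv_mul_le (𝕜 := ℝ) (χ.smooth ⊤) (η.smooth ⊤) ξ (n := m)
    (by exact_mod_cast le_top)
  refine (show _ from h1).trans ?_
  have hX0 : 0 ≤ X := (norm_nonneg _).trans (hX 0 (Nat.zero_le _))
  calc ∑ i ∈ Finset.range (m + 1), (m.choose i : ℝ) * ‖iteratedFDeriv ℝ i χ ξ‖ *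
        ‖iteratedFDeriv ℝ (m - i) η ξ‖
      ≤ ∑ i ∈ Finset.range (m + 1), (m.choose i : ℝ) * X * A := by
        refine Finset.sum_le_sum fun i hi => ?_
        have hi' : i ≤ m := Nat.lt_succ_iff.1 (Finset.mem_range.1 hi)
        have := hX i hi'
        have := hA (m - i) (by omega)
        gcongr
    _ = 2 ^ m * X * A := by
        rw [← Finset.sum_mul, ← Finset.sum_mul]
        congr 2
        exact_mod_cast Nat.sum_range_choose m

/-- With all exponents equal to 1 the ellipsoids are round balls, so `exists_cutoff` also supplies
the radial truncations used for density. -/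
lemma dl_one_exponent (t : ℝ) (x : E d) : dl (fun _ => 1) t x = t • x := by
  ext i; simp [dl_apply]

lemma mem_ellip_one_exponent {t R : ℝ} (ht : 0 < t) (x : E d) :
    x ∈ ellip (fun _ : Fin d => (1 : ℝ)) t 0 R ↔ ‖x‖ < t * R := by
  rw [ellip, Set.mem_ofPred_eq, dl_one_exponent, sub_zero, norm_smul, norm_inv,
    Real.norm_of_nonneg ht.le, inv_mul_lt_iff₀ ht]

/-- The functions with spectrum compactly supported away from the origin are dense in `𝓢₀`. -/
lemma exists_tendsto_of_mem_S0 [Nontrivial (E d)] {θ : 𝓢(E d, ℂ)} (hθ : θ ∈ S0 d) :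
    ∃ u : ℕ → 𝓢(E d, ℂ), Tendsto u atTop (𝓝 θ) ∧ ∀ n, ∃ ε > 0, ∃ R, ∀ ξ,
      fourierS d (u n) ξ ≠ 0 → ε ≤ ‖ξ‖ ∧ ‖ξ‖ ≤ R := by
  set η := fourierS d θ
  obtain ⟨C, hC0, hC⟩ := exists_cutoff (d := d) (fun _ => 1) one_pos one_lt_two
  have hn0 : ∀ n : ℕ, (0 : ℝ) < n + 1 := fun n => by positivity
  have hn1 : ∀ n : ℕ, (0 : ℝ) < (n + 1 : ℝ)⁻¹ := fun n => by positivity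
  -- χ_n cuts off at |ξ| ~ n+1 and ω_n at |ξ| ~ 1/(n+1); the approximants have transform (χ_n -
  -- ω_n)η, which lives on an annulus.
  choose χ hχ1 hχ2 hχ3 hχ4 using fun n : ℕ => hC (n + 1) (hn0 n) 0
  choose ω hω1 hω2 hω3 hω4 using fun n : ℕ => hC (n + 1 : ℝ)⁻¹ (hn1 n) 0
  simp only [mem_ellip_one_exponent (hn0 _), mem_ellip_one_exponent (hn1 _)] at hχ2 hχ3 hω2 hω3
  have h0 : ∀ {f : 𝓢(E d, ℂ)} {x}, iteratedFDeriv ℝ 0 f x = 0 → f x = 0 := fun {f x} h => by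
    rwa [← norm_eq_zero, norm_iteratedFDeriv_zero, norm_eq_zero] at h
  have hdec : ∀ M, ∃ A, 0 ≤ A ∧ HasDecay η M M A := by
    intro M
    obtain ⟨c, hc, h⟩ := hasDecay_fourierS (d := d) M
    exact ⟨_, mul_nonneg hc ENNReal.toReal_nonneg, h θ (hθ M)⟩
  -- the derivatives of `η` are small where the weight is large
  have hsmall : ∀ k m : ℕ, ∃ A, 0 ≤ A ∧ ∀ i ≤ m, ∀ n : ℕ, ∀ ξ : E d, ξ ≠ 0 → (n + 1 : ℝ) ≤ 2 * wt ξ →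
      ‖ξ‖ ^ k * ‖iteratedFDeriv ℝ i η ξ‖ * (n + 1) ^ (m + 1) ≤ A := by
    intro k m
    obtain ⟨A, hA0, hA⟩ := hdec (k + m + 1)
    refine ⟨2 ^ (m + 1) * A, by positivity, fun i hi n ξ hξ hn => ?_⟩
    have h1 := hA i (by omega) ξ hξ
    have := wt_pos hξ
    have := norm_le_wt ξ
    calc ‖ξ‖ ^ k * ‖iteratedFDeriv ℝ i η ξ‖ * (n + 1) ^ (m + 1)
        ≤ wt ξ ^ k * ‖iteratedFDeriv ℝ i η ξ‖ * (2 * wt ξ) ^ (m + 1) := by gcongr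
      _ = 2 ^ (m + 1) * (‖iteratedFDeriv ℝ i η ξ‖ * wt ξ ^ (k + m + 1)) := by ring
      _ ≤ _ := by gcongr
  have hXbd : ∀ m i : ℕ, i ≤ m → C i ≤ ∑ l ∈ Finset.range (m + 1), C l := fun m i hi =>
    Finset.single_le_sum (fun l _ => hC0 l) (Finset.mem_range.2 (by omega))
  have hsc : ∀ t : ℝ, 0 < t → ∀ y : E d, ‖dl (fun _ : Fin d => (1 : ℝ)) t⁻¹ y‖ ≤ t⁻¹ * ‖y‖ := by
    intro t ht y
    rw [dl_one_exponent, norm_smul, norm_inv, Real.norm_of_nonneg ht.le]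
  have hlim0 : ∀ A : ℝ, Tendsto (fun n : ℕ => A * (1 / ((n : ℝ) + 1))) atTop (𝓝 0) := fun A => by
    simpa using (tendsto_one_div_add_atTop_nhds_zero_nat (𝕜 := ℝ)).const_mul A
  -- The difference vanishes for |ξ| < n+1; beyond that the derivatives of χ_n are bounded uniformly
  -- in n and those of η are O(1/(n+1)).
  have lim1 : Tendsto (fun n => mulS (χ n) η) atTop (𝓝 η) := by
    refine ((schwartz_withSeminorms ℝ (E d) ℂ).tendsto_nhds _ _).2 fun q ε hε => ?_
    obtain ⟨k, m⟩ := q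
    obtain ⟨A, hA0, hA⟩ := hsmall k m
    set X := ∑ l ∈ Finset.range (m + 1), C l
    have hX0 : 0 ≤ X := Finset.sum_nonneg fun l _ => hC0 l
    filter_upwards [(hlim0 ((2 ^ m * X + 1) * A)).eventually (gt_mem_nhds hε)] with n hn
    refine lt_of_le_of_lt (SchwartzMap.seminorm_le_bound ℝ k m _ (by positivity) fun ξ => ?_) hn
    rcases lt_or_ge ‖ξ‖ ((n + 1 : ℝ) * 1) with hξ | hξ
    · have h1 : iteratedFDeriv ℝ m (mulS (χ n) η - η) ξ = 0 := by
        have : (mulS (χ n) η - η : E d → ℂ) =ᶠ[𝓝 ξ] 0 := by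
          filter_upwards [(isOpen_lt continuous_norm continuous_const).mem_nhds hξ] with z hz
          simp [hχ2 n z hz]
        have h2 := (this.iteratedFDeriv (𝕜 := ℝ) m).self_of_nhds
        refine h2.trans ?_
        rw [show (0 : E d → ℂ) = fun _ => 0 from rfl, iteratedFDeriv_fun_zero]
        rfl
      rw [h1, norm_zero, mul_zero]
      positivity
    · rw [mul_one] at hξ
      have hξ0 : ξ ≠ 0 := by
        rintro rfl
        rw [norm_zero] at hξ
        linarith [hn0 n]
      have hw : (n + 1 : ℝ) ≤ 2 * wt ξ := by
        have := norm_le_wt ξ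
        have := wt_pos hξ0
        linarith
      have hd : ∀ i ≤ m, ‖iteratedFDeriv ℝ i η ξ‖ * ‖ξ‖ ^ k ≤ A / (n + 1) := by
        intro i hi
        rw [le_div_iff₀ (hn0 n)]
        refine le_trans ?_ (hA i hi n ξ hξ0 hw)
        rw [mul_comm (‖ξ‖ ^ k)]
        refine mul_le_mul_of_nonneg_left ?_ (by positivity)
        exact le_self_pow₀ (by linarith [Nat.cast_nonneg (α := ℝ) n]) (by omega)
      have hpk : 0 < ‖ξ‖ ^ k := by
        have := norm_pos_iff.2 hξ0
        positivity
      have h1 := norm_iteratedFDeriv_mulS_le (χ := χ n) (η := η) (ξ := ξ) (m := m) (X := X)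
        (A := A / (n + 1) / ‖ξ‖ ^ k) (fun i hi => ?_) (fun i hi => ?_)
      · have h2 : ‖iteratedFDeriv ℝ m (mulS (χ n) η - η) ξ‖ ≤
            ‖iteratedFDeriv ℝ m (mulS (χ n) η) ξ‖ + ‖iteratedFDeriv ℝ m η ξ‖ := by
          have : iteratedFDeriv ℝ m (mulS (χ n) η - η) ξ =
              iteratedFDeriv ℝ m (mulS (χ n) η) ξ - iteratedFDeriv ℝ m η ξ :=
            map_sub (derivEval m ξ) _ _
          rw [this]
          exact norm_sub_le _ _
        have h3 := hd m le_rfl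
        calc ‖ξ‖ ^ k * ‖iteratedFDeriv ℝ m (mulS (χ n) η - η) ξ‖
            ≤ ‖ξ‖ ^ k * (2 ^ m * X * (A / (n + 1) / ‖ξ‖ ^ k)) +
                ‖iteratedFDeriv ℝ m η ξ‖ * ‖ξ‖ ^ k := by
              rw [mul_comm _ (‖ξ‖ ^ k), ← mul_add]
              exact mul_le_mul_of_nonneg_left (h2.trans (by linarith)) hpk.le
          _ ≤ 2 ^ m * X * (A / (n + 1)) + A / (n + 1) := by
              refine add_le_add (le_of_eq ?_) h3
              field_simp
          _ = _ := by ring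
      · refine (hχ4 n _ (hsc _ (hn0 n)) (hn1 n).le i ξ).trans ?_
        refine le_trans ?_ (hXbd m i hi)
        refine mul_le_of_le_one_right (hC0 i) (pow_le_one₀ (hn1 n).le ?_)
        exact inv_le_one_of_one_le₀ (by linarith [Nat.cast_nonneg (α := ℝ) n])
      · rw [le_div_iff₀ hpk]
        exact hd i hi
  -- Derivatives of ω_n up to order m may grow like (n+1)^m; the factor (n+1)^{m+1} in `hsmall`
  -- compensates and leaves 1/(n+1).
  have lim2 : Tendsto (fun n => mulS (ω n) η) atTop (𝓝 0) := by
    refine ((schwartz_withSeminorms ℝ (E d) ℂ).tendsto_nhds _ _).2 fun q ε hε => ?_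
    obtain ⟨k, m⟩ := q
    obtain ⟨A, hA0, hA⟩ := hsmall k m
    set X := ∑ l ∈ Finset.range (m + 1), C l
    have hX0 : 0 ≤ X := Finset.sum_nonneg fun l _ => hC0 l
    filter_upwards [(hlim0 (2 ^ m * X * A)).eventually (gt_mem_nhds hε)] with n hn
    rw [sub_zero]
    refine lt_of_le_of_lt (SchwartzMap.seminorm_le_bound ℝ k m _ (by positivity) fun ξ => ?_) hn
    have hωm : ∀ i ≤ m, ‖iteratedFDeriv ℝ i (ω n) ξ‖ ≤ X * (n + 1 : ℝ) ^ m := by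
      intro i hi
      have h1 := hω4 n _ (hsc _ (hn1 n)) (inv_pos.2 (hn1 n)).le i ξ
      rw [inv_inv] at h1
      refine h1.trans ?_
      have : (1 : ℝ) ≤ n + 1 := by linarith [Nat.cast_nonneg (α := ℝ) n]
      have := hXbd m i hi
      have := hC0 i
      gcongr
    by_cases hξ : ‖ξ‖ < (n + 1 : ℝ)⁻¹ * 2
    · rcases eq_or_ne ξ 0 with rfl | hξ0
      · have h1 := norm_iteratedFDeriv_mulS_le (χ := ω n) (η := η) (ξ := 0) (m := m) (A := 0) hωm
          (fun i _ => by rw [iteratedFDeriv_zero_of_mem_S0 hθ, norm_zero])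
        rw [mul_zero] at h1
        rw [le_antisymm h1 (norm_nonneg _), mul_zero]
        positivity
      · have hw : (n + 1 : ℝ) ≤ 2 * wt ξ := by
          have h1 := inv_norm_le_wt ξ
          have hpos := norm_pos_iff.2 hξ0
          have h2 : (n + 1 : ℝ) ≤ 2 * ‖ξ‖⁻¹ := by
            rw [inv_mul_eq_div, lt_div_iff₀ (hn0 n)] at hξ
            rw [← div_eq_mul_inv, le_div_iff₀ hpos]
            linarith
          linarith
        have hpk : 0 < ‖ξ‖ ^ k := by
          have := norm_pos_iff.2 hξ0
          positivity
        have h1 := norm_iteratedFDeriv_mulS_le (χ := ω n) (η := η) (ξ := ξ) (m := m)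
          (A := A / (n + 1) ^ (m + 1) / ‖ξ‖ ^ k) hωm (fun i hi => ?_)
        · calc ‖ξ‖ ^ k * ‖iteratedFDeriv ℝ m (mulS (ω n) η) ξ‖
              ≤ ‖ξ‖ ^ k * (2 ^ m * (X * (n + 1 : ℝ) ^ m) * (A / (n + 1) ^ (m + 1) / ‖ξ‖ ^ k)) := by
                gcongr
            _ = _ := by
                have := hn0 n
                field_simp
                ring
        · rw [le_div_iff₀ hpk, le_div_iff₀ (pow_pos (hn0 n) _)]
          refine le_trans (le_of_eq ?_) (hA i hi n ξ hξ0 hw)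
          ring
    · have h1 := norm_iteratedFDeriv_mulS_le (χ := ω n) (η := η) (ξ := ξ) (m := m) (X := 0)
        (A := ∑ i ∈ Finset.range (m + 1), ‖iteratedFDeriv ℝ i η ξ‖)
        (fun i _ => by rw [hω3 n i ξ hξ, norm_zero])
        (fun i hi => Finset.single_le_sum (f := fun i => ‖iteratedFDeriv ℝ i η ξ‖)
          (fun _ _ => norm_nonneg _) (Finset.mem_range.2 (by omega)))
      rw [mul_zero, zero_mul] at h1
      rw [le_antisymm h1 (norm_nonneg _), mul_zero]
      positivity
  refine ⟨fun n => invS d (mulS (χ n) η - mulS (ω n) η), ?_, fun n =>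
    ⟨(n + 1 : ℝ)⁻¹, hn1 n, (n + 1 : ℝ) * 2, fun ξ hξ => ?_⟩⟩
  · have h1 := (invS d).continuous.continuousAt.tendsto.comp (lim1.sub lim2)
    rw [sub_zero, show invS d η = θ from invS_fourierS θ] at h1
    exact h1
  · rw [fourierS_invS] at hξ
    have h1 : χ n ξ - ω n ξ ≠ 0 := by
      intro h
      apply hξ
      rw [sub_apply, mulS_apply, mulS_apply, ← sub_mul, h, zero_mul]
    have hlt : (n + 1 : ℝ)⁻¹ ≤ n + 1 := by
      have h2 : (1 : ℝ) ≤ n + 1 := by linarith [Nat.cast_nonneg (α := ℝ) n]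
      exact (inv_le_one_of_one_le₀ h2).trans h2
    constructor
    · by_contra! hcon
      refine h1 ?_
      rw [hχ2 n ξ (by linarith), hω2 n ξ (by linarith), sub_self]
    · by_contra! hcon
      refine h1 ?_
      rw [h0 (hχ3 n 0 ξ (by linarith)), h0 (hω3 n 0 ξ (by linarith)), sub_self]

/-- For every p the L_p norm is bounded by a Schwartz seminorm, so L_p bounds for transforms reduce
to finitely many pointwise bounds on the frequency side. -/
lemma exists_eLpNorm_le (T : 𝓢(E d, ℂ) →L[ℂ] 𝓢(E d, ℂ)) (p : ℝ≥0∞) :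
    ∃ (N : ℕ) (C : ℝ), 0 ≤ C ∧ ∀ (f : 𝓢(E d, ℂ)) (B : ℝ), 0 ≤ B →
      (∀ k ≤ N, ∀ m ≤ N, ∀ x, ‖x‖ ^ k * ‖iteratedFDeriv ℝ m f x‖ ≤ B) →
      eLpNorm (T f) p volume ≤ ENNReal.ofReal (C * B) := by
  obtain ⟨l, c, hc⟩ := SchwartzMap.eLpNorm_le_seminorm (E := E d) ℂ ℂ p volume
  set P := (Finset.Iic (l, 0)).sup (schwartzSeminormFamily ℂ (E d) ℂ)
  have hP : Continuous P := continuous_sup_seminorm _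
  obtain ⟨s, C, -, hC⟩ := Seminorm.bound_of_continuous (schwartz_withSeminorms ℂ (E d) ℂ)
    (P.comp T.toLinearMap) (hP.comp T.continuous)
  refine ⟨s.sup (fun m => max m.1 m.2), c * C, by positivity, fun f B hB h => ?_⟩
  refine (hc _).trans ?_
  rw [← ENNReal.ofReal_coe_nnreal, ← ENNReal.ofReal_mul c.coe_nonneg, mul_assoc]
  refine ENNReal.ofReal_le_ofReal (mul_le_mul_of_nonneg_left ?_ c.coe_nonneg)
  refine (hC f).trans ?_
  change (C : ℝ) * _ ≤ _
  refine mul_le_mul_of_nonneg_left (Seminorm.finset_sup_apply_le hB fun m hm => ?_) C.2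
  have h1 := Finset.le_sup (f := fun m : ℕ × ℕ => max m.1 m.2) hm
  exact SchwartzMap.seminorm_le_bound ℂ m.1 m.2 f hB fun x =>
    h m.1 ((le_max_left _ _).trans h1) m.2 ((le_max_right _ _).trans h1) x

end SZero

end HomDecomp

end

open MeasureTheory Filter Topology

noncomputable section

namespace HomDecomp

/-! ### Multiplier estimates for the covering -/

variable {d : ℕ} {a : Fin d → ℝ} {h : E d → ℝ} {J : Type*}

/-- Smooth cutoff functions adapted to the covering. -/
structure Cutoffs (D : DecompositionSystem a h J) where
  r : ℝ
  K : ℕ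
  C : ℕ → ℝ
  χ : J → 𝓢(E d, ℂ)
  one_lt : 1 < r
  lt_two : r < 2
  C_nonneg : ∀ n, 0 ≤ C n
  eq_one : ∀ j, ∀ x ∈ ellip a (D.rad j) (D.ξ j) r, χ j x = 1
  eq_zero : ∀ j, ∀ x ∉ ellip a (D.rad j) (D.ξ j) 2, χ j x = 0
  support : ∀ j n x, iteratedFDeriv ℝ n (χ j) x ≠ 0 →
    x ≠ 0 ∧ wt x ≤ wt (D.ξ j) ^ K ∧ wt (D.ξ j) ≤ wt x ^ K
  bound : ∀ j n x, ‖iteratedFDeriv ℝ n (χ j) x‖ ≤ C n * wt (D.ξ j) ^ (K * n)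
  rad_le : ∀ j, D.rad j ≤ wt (D.ξ j) ^ K
  inv_rad_le : ∀ j, (D.rad j)⁻¹ ≤ wt (D.ξ j) ^ K

lemma norm_dl_inv_le (ha : IsAnisotropy a) {t w : ℝ} (ht : 0 < t) (hw : 1 ≤ w) {K : ℕ}
    (h : t⁻¹ ≤ w ^ K) (y : E d) : ‖dl a t⁻¹ y‖ ≤ w ^ (K * d) * ‖y‖ := by
  have hw1 : (1 : ℝ) ≤ w ^ (K * d) := one_le_pow₀ hw
  refine norm_dl_le (inv_pos.2 ht).le (by positivity) (fun i => ?_) y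
  rcases le_total t⁻¹ 1 with h1 | h1
  · exact (Real.rpow_le_one (inv_pos.2 ht).le h1 (ha.pos i).le).trans hw1
  · calc t⁻¹ ^ a i ≤ t⁻¹ ^ (d : ℝ) := Real.rpow_le_rpow_of_exponent_le h1 (ha.le_dim i)
      _ = t⁻¹ ^ d := Real.rpow_natCast _ _
      _ ≤ (w ^ K) ^ d := by gcongr
      _ = _ := by rw [pow_mul]

namespace DecompositionSystem

variable (D : DecompositionSystem a h J)

lemma one_le_wt (j : J) : 1 ≤ wt (D.ξ j) := by linarith [two_le_wt (D.ξ_ne_zero j)]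

lemma exists_cutoffs (ha : IsAnisotropy a) (hh : IsHybridRegulation a h) : Nonempty (Cutoffs D) := by
  obtain ⟨R, K, hR1, hR2, H, Hr⟩ := D.exists_comparison ha hh
  obtain ⟨C, hC0, hC⟩ := exists_cutoff a (show 0 < (1 + R) / 2 by linarith)
    (show (1 + R) / 2 < R by linarith)
  choose χ hχ1 hχ2 hχ3 hχ4 using fun j => hC (D.rad j) (D.rad_pos ha hh j) (D.ξ j)
  -- The single exponent K(d+1) covers both the comparison of weights, which needs K, and the norm
  -- of the inverse dilation, which needs Kd.
  have hKd : ∀ x : E d, x ≠ 0 → ∀ k, k ≤ K * (d + 1) → wt x ^ k ≤ wt x ^ (K * (d + 1)) :=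
    fun x hx k hk => pow_le_pow_right₀ (by linarith [two_le_wt hx]) hk
  have hK : K ≤ K * (d + 1) := Nat.le_mul_of_pos_right _ (Nat.succ_pos _)
  refine ⟨⟨(1 + R) / 2, K * (d + 1), C, χ, by linarith, by linarith, hC0, hχ2, fun j x hx => ?_,
    fun j n x hx => ?_, fun j n x => ?_, fun j => ?_, fun j => ?_⟩⟩
  · have := hχ3 j 0 x fun hmem => hx ((show _ < R from hmem).trans_le hR2)
    rwa [← norm_eq_zero, norm_iteratedFDeriv_zero, norm_eq_zero] at this
  · have hx' : x ∈ ellip a (D.rad j) (D.ξ j) R := by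
      by_contra hcon
      exact hx (hχ3 j n x hcon)
    obtain ⟨h0, h1, h2⟩ := H j x hx'
    exact ⟨h0, h1.trans (hKd _ (D.ξ_ne_zero j) _ hK), h2.trans (hKd _ h0 _ hK)⟩
  · have hpos : (0 : ℝ) ≤ wt (D.ξ j) := by linarith [D.one_le_wt j]
    refine (hχ4 j (wt (D.ξ j) ^ (K * (d + 1))) (fun y => ?_) (by positivity) n x).trans
      (le_of_eq ?_)
    · refine (norm_dl_inv_le ha (D.rad_pos ha hh j) (D.one_le_wt j) (Hr j).2 y).trans ?_
      have := hKd _ (D.ξ_ne_zero j) (K * d) (by gcongr; omega)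
      gcongr
    · rw [pow_mul _ _ n]
  · exact (Hr j).1.trans (hKd _ (D.ξ_ne_zero j) _ hK)
  · exact (Hr j).2.trans (hKd _ (D.ξ_ne_zero j) _ hK)

/-- The terms of a convergent series tend to 0 along the cofinite filter. With the comparison of
weights, only finitely many balls meet a given annulus. -/
lemma finite_wt_le (ha : IsAnisotropy a) (hh : IsHybridRegulation a h) (w : ℝ) :
    {i | wt (D.ξ i) ≤ w}.Finite := by
  obtain ⟨L, hL⟩ := D.exists_summable ha hh
  have h1 := ENNReal.tendsto_cofinite_zero_of_tsum_ne_top hL.ne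
  have hpos : 0 < ENNReal.ofReal (((max w 1) ^ L)⁻¹) := by
    rw [ENNReal.ofReal_pos]
    have : 0 < max w 1 := lt_max_of_lt_right one_pos
    positivity
  have h2 := h1.eventually (gt_mem_nhds hpos)
  rw [Filter.eventually_cofinite] at h2
  refine h2.subset fun i hi => ?_
  rw [Set.mem_ofPred_eq, not_lt]
  refine ENNReal.ofReal_le_ofReal ?_
  have := D.one_le_wt i
  have h3 : wt (D.ξ i) ≤ max w 1 := (show wt (D.ξ i) ≤ w from hi).trans (le_max_left _ _)
  gcongr

/-- The bound in the definition of a BAPU, with |Q_j| written as the d-th power of the radius times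
the volume of the unit ball. -/
lemma exists_eLpNorm_invS_psi_le (ha : IsAnisotropy a) (hh : IsHybridRegulation a h) {p : ℝ}
    (hp0 : 0 < p) (hp1 : p ≤ 1) : ∃ C : ℝ≥0, ∀ j, ENNReal.ofReal (D.rad j ^ d) ^ (1 / p - 1) *
      eLpNorm (invS d (D.psi j)) (ENNReal.ofReal p) volume ≤ C := by
  obtain ⟨C, hC⟩ := D.bapu.bounded p hp0 hp1
  have hq : (0 : ℝ) ≤ 1 / p - 1 := by
    rw [sub_nonneg, le_div_iff₀ hp0]; linarith
  set V := volume (Metric.ball (0 : E d) 1)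
  have hV : V ≠ ∞ := measure_ball_lt_top.ne
  have hV0 : V ≠ 0 := (Metric.measure_ball_pos _ _ one_pos).ne'
  have hW : V ^ (1 / p - 1) ≠ ∞ := ENNReal.rpow_ne_top_of_nonneg hq hV
  have hW0 : V ^ (1 / p - 1) ≠ 0 := by
    rw [Ne, ENNReal.rpow_eq_zero_iff]
    simp [hV, hV0]
  refine ⟨(C / V ^ (1 / p - 1)).toNNReal, fun j => ?_⟩
  rw [ENNReal.coe_toNNReal (ENNReal.div_ne_top ENNReal.coe_ne_top hW0),
    ENNReal.le_div_iff_mul_le (Or.inl hW0) (Or.inl hW)]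
  have h1 := hC j
  rw [D.aBall_eq ha hh, D.volume_ball ha hh, ENNReal.mul_rpow_of_nonneg _ _ hq, ← D.coe_psi,
    invFourierFn_eq] at h1
  refine le_trans (le_of_eq ?_) h1
  ring

/-- The functions `φ_j²` are uniform Fourier multipliers on band-limited functions. -/
lemma exists_eLpNorm_mulS_psi_le (ha : IsAnisotropy a) (hh : IsHybridRegulation a h) {p : ℝ≥0∞}
    (hp : 0 < p) {R : ℝ} (hR : 1 ≤ R) : ∃ C : ℝ≥0, ∀ j b, ∀ g : 𝓢(E d, ℂ),
      (∀ ξ ∉ ellip a (D.rad j) b R, g ξ = 0) →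
      eLpNorm (invS d (mulS (D.psi j) g)) p volume ≤ C * eLpNorm (invS d g) p volume := by
  rcases le_total 1 p with hp1 | hp1
  · obtain ⟨C, hC⟩ := D.exists_eLpNorm_invS_psi_le ha hh one_pos le_rfl
    refine ⟨(ENNReal.ofReal (fourierConst d)).toNNReal * C, fun j b g _ => ?_⟩
    refine (eLpNorm_invS_mulS_le_of_one_le hp1 _ _).trans ?_
    rw [ENNReal.coe_mul, ENNReal.coe_toNNReal ENNReal.ofReal_ne_top]
    have := hC j
    rw [div_one, sub_self, ENNReal.rpow_zero, one_mul, ENNReal.ofReal_one] at this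
    gcongr
  -- The factor rad_j^{d(1/p-1)} lost in the convolution inequality is exactly the one that the BAPU
  -- bound contains.
  · have hpt : p ≠ ∞ := (hp1.trans_lt ENNReal.one_lt_top).ne
    obtain ⟨p, rfl⟩ : ∃ s : ℝ, p = ENNReal.ofReal s := ⟨p.toReal, (ENNReal.ofReal_toReal hpt).symm⟩
    have hp0 : 0 < p := ENNReal.ofReal_pos.1 hp
    have hp1' : p ≤ 1 := ENNReal.ofReal_le_one.1 hp1
    obtain ⟨C, hC⟩ := D.exists_eLpNorm_invS_psi_le ha hh hp0 hp1'
    obtain ⟨C', hC'⟩ := eLpNorm_invS_mulS_le_of_le_one ha (show 0 < R by linarith) hp0 hp1'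
    refine ⟨C' * C, fun j b g hg => ?_⟩
    refine (hC' _ (D.rad_pos ha hh j) (D.ξ j) b (D.psi j) g (fun ξ hξ => ?_) hg).trans ?_
    · refine D.psi_eq_zero ha hh fun hmem => hξ ?_
      exact (show _ < (1 : ℝ) from hmem).trans_le hR
    · rw [mul_assoc (C' : ℝ≥0∞), ENNReal.coe_mul]
      have := hC j
      gcongr

lemma exists_ellip_subset (ha : IsAnisotropy a) (hh : IsHybridRegulation a h) :
    ∃ R : ℝ, 1 ≤ R ∧ ∀ i j, (D.ball i ∩ D.ball j).Nonempty →
      ellip a (D.rad j) (D.ξ j) 2 ⊆ ellip a (D.rad i) (D.ξ j) R := by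
  obtain ⟨K, hK0, hK⟩ := D.exists_rad_le ha hh
  refine ⟨K * 2 + 1, by linarith, fun i j hij x hx => ?_⟩
  have hi := D.rad_pos ha hh i
  have hj := D.rad_pos ha hh j
  have h1 := norm_dl_le (a := a) (div_pos hj hi).le hK0.le (hK j i (by rwa [Set.inter_comm]))
    (dl a (D.rad j)⁻¹ (x - D.ξ j))
  rw [dl_dl (div_pos hj hi).le (inv_pos.2 hj).le] at h1
  have h2 : D.rad j / D.rad i * (D.rad j)⁻¹ = (D.rad i)⁻¹ := by field_simp
  rw [h2] at h1
  have h3 : ‖dl a (D.rad j)⁻¹ (x - D.ξ j)‖ < 2 := hx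
  rw [ellip, Set.mem_ofPred_eq]
  nlinarith

end DecompositionSystem

namespace Cutoffs

variable {D : DecompositionSystem a h J} (X : Cutoffs D)

lemma of_mem_ellip {j : J} {x : E d} (hx : x ∈ ellip a (D.rad j) (D.ξ j) X.r) :
    x ≠ 0 ∧ wt x ≤ wt (D.ξ j) ^ X.K ∧ wt (D.ξ j) ≤ wt x ^ X.K := by
  refine X.support j 0 x ?_
  rw [← norm_ne_zero_iff, norm_iteratedFDeriv_zero, X.eq_one j x hx]
  simp

lemma ball_subset (j : J) : D.ball j ⊆ ellip a (D.rad j) (D.ξ j) X.r :=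
  fun _ hx => (show _ < (1 : ℝ) from hx).trans X.one_lt

/-- φ_j² comes with L_p bounds on 𝓕⁻¹φ_j² but no derivative bounds. Inserting χ_j, which is 1 on
Q_j, lets the pointwise estimates be made for χ_j η while φ_j² acts only as a multiplier. -/
lemma mulS_psi (ha : IsAnisotropy a) (hh : IsHybridRegulation a h) (j : J) (η : 𝓢(E d, ℂ)) :
    mulS (D.psi j) (mulS (X.χ j) η) = mulS (D.psi j) η := by
  ext x
  simp only [mulS_apply]
  by_cases hx : x ∈ D.ball j
  · rw [X.eq_one j x (X.ball_subset j hx), one_mul]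
  · rw [D.psi_eq_zero ha hh hx, zero_mul, zero_mul]

lemma exists_seminorm_mulS_le (N L : ℕ) : ∃ (M : ℕ) (C : ℝ), 0 ≤ C ∧ ∀ j (η : 𝓢(E d, ℂ)) (A : ℝ),
    0 ≤ A → HasDecay η M M A → ∀ k ≤ N, ∀ m ≤ N, ∀ x,
      ‖x‖ ^ k * ‖iteratedFDeriv ℝ m (mulS (X.χ j) η) x‖ ≤ C * A * (wt (D.ξ j) ^ L)⁻¹ := by
  set S := ∑ l ∈ Finset.range (N + 1), X.C l
  have hS : 0 ≤ S := Finset.sum_nonneg fun l _ => X.C_nonneg l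
  -- N powers of wt(x) absorb |x|^k, K·K·N absorb the derivatives of χ_j, and K·L yield
  -- wt(ξ_j)^{-L}; on the support of χ_j one has wt(ξ_j) ≤ wt(x)^K.
  set M := N + X.K * (X.K * N) + X.K * L
  refine ⟨M, 2 ^ N * S, by positivity, fun j η A hA hη k hk m hm x => ?_⟩
  have hj := D.one_le_wt j
  by_cases hx : ∀ i, iteratedFDeriv ℝ i (X.χ j) x = 0
  · have h1 := norm_iteratedFDeriv_mulS_le (χ := X.χ j) (η := η) (ξ := x) (m := m) (X := 0)
      (A := ∑ i ∈ Finset.range (m + 1), ‖iteratedFDeriv ℝ i η x‖)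
      (fun i _ => by rw [hx i, norm_zero])
      (fun i hi => Finset.single_le_sum (f := fun i => ‖iteratedFDeriv ℝ i η x‖)
        (fun _ _ => norm_nonneg _) (Finset.mem_range.2 (by omega)))
    rw [mul_zero, zero_mul] at h1
    rw [le_antisymm h1 (norm_nonneg _), mul_zero]
    positivity
  · push Not at hx
    obtain ⟨i, hi⟩ := hx
    obtain ⟨hx0, -, hjx⟩ := X.support j i x hi
    have hw := two_le_wt hx0
    have hw1 : 1 ≤ wt x := by linarith
    have hχ : ∀ i ≤ m, ‖iteratedFDeriv ℝ i (X.χ j) x‖ ≤ S * wt x ^ (X.K * (X.K * N)) := by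
      intro i hi
      refine (X.bound j i x).trans ?_
      have h1 : X.C i ≤ S := Finset.single_le_sum (f := X.C) (fun l _ => X.C_nonneg l)
        (Finset.mem_range.2 (by omega))
      have h2 : wt (D.ξ j) ^ (X.K * i) ≤ wt x ^ (X.K * (X.K * N)) := by
        rw [pow_mul (wt x)]
        refine (pow_le_pow_left₀ (by linarith) hjx _).trans ?_
        refine pow_le_pow_right₀ (one_le_pow₀ hw1) ?_
        gcongr
        omega
      gcongr
    have hη' : ∀ i ≤ m, ‖iteratedFDeriv ℝ i η x‖ ≤ A / wt x ^ M := by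
      intro i hi
      rw [le_div_iff₀ (by positivity)]
      refine hη i ?_ x hx0
      simp only [M]
      omega
    have h1 := norm_iteratedFDeriv_mulS_le hχ hη'
    have h2 : wt (D.ξ j) ^ L ≤ wt x ^ (X.K * L) := by
      rw [pow_mul]
      exact pow_le_pow_left₀ (by linarith) hjx _
    have h3 : ‖x‖ ^ k ≤ wt x ^ N :=
      (pow_le_pow_left₀ (norm_nonneg _) (norm_le_wt x) k).trans (pow_le_pow_right₀ hw1 hk)
    have h4 : (2 : ℝ) ^ m ≤ 2 ^ N := pow_le_pow_right₀ one_le_two hm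
    rw [← div_eq_mul_inv, le_div_iff₀ (by positivity)]
    calc ‖x‖ ^ k * ‖iteratedFDeriv ℝ m (mulS (X.χ j) η) x‖ * wt (D.ξ j) ^ L
        ≤ wt x ^ N * (2 ^ N * (S * wt x ^ (X.K * (X.K * N))) * (A / wt x ^ M)) *
            wt x ^ (X.K * L) := by
          gcongr
          exact h1.trans (by gcongr)
      _ = 2 ^ N * S * A * (wt x ^ (N + X.K * (X.K * N) + X.K * L) / wt x ^ M) := by
          rw [pow_add, pow_add]
          ring
      _ = 2 ^ N * S * A := by
          rw [div_self (by positivity), mul_one]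

lemma exists_eLpNorm_mulS_le (T : 𝓢(E d, ℂ) →L[ℂ] 𝓢(E d, ℂ)) (p : ℝ≥0∞) (L : ℕ) :
    ∃ (M : ℕ) (C : ℝ), 0 ≤ C ∧ ∀ j (η : 𝓢(E d, ℂ)) (A : ℝ), 0 ≤ A → HasDecay η M M A →
      eLpNorm (T (mulS (X.χ j) η)) p volume ≤ ENNReal.ofReal (C * A * (wt (D.ξ j) ^ L)⁻¹) := by
  obtain ⟨N, c, hc, hT⟩ := exists_eLpNorm_le T p
  obtain ⟨M, C, hC, hX⟩ := X.exists_seminorm_mulS_le N L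
  refine ⟨M, c * C, by positivity, fun j η A hA hη => ?_⟩
  have := D.one_le_wt j
  refine (hT _ (C * A * (wt (D.ξ j) ^ L)⁻¹) (by positivity) (hX j η A hA hη)).trans (le_of_eq ?_)
  congr 1
  ring

lemma exists_eLpNorm_invS_le (p : ℝ≥0∞) : ∃ (C : ℝ) (L : ℕ), 0 ≤ C ∧ ∀ j,
    eLpNorm (invS d (X.χ j)) p volume ≤ ENNReal.ofReal (C * wt (D.ξ j) ^ L) := by
  obtain ⟨N, c, hc, hT⟩ := exists_eLpNorm_le (invS d) p
  set S := ∑ l ∈ Finset.range (N + 1), X.C l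
  have hS : 0 ≤ S := Finset.sum_nonneg fun l _ => X.C_nonneg l
  refine ⟨c * S, X.K * N + X.K * N, by positivity, fun j => ?_⟩
  have hj := D.one_le_wt j
  rw [mul_assoc]
  refine hT _ _ (by positivity) fun k hk m hm x => ?_
  by_cases hx : iteratedFDeriv ℝ m (X.χ j) x = 0
  · rw [hx, norm_zero, mul_zero]
    positivity
  · obtain ⟨hx0, hxj, -⟩ := X.support j m x hx
    have h1 : ‖x‖ ^ k ≤ wt (D.ξ j) ^ (X.K * N) := by
      rw [pow_mul]
      exact (pow_le_pow_left₀ (norm_nonneg _) ((norm_le_wt x).trans hxj) k).trans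
        (pow_le_pow_right₀ (one_le_pow₀ hj) hk)
    have h2 : X.C m ≤ S := Finset.single_le_sum (f := X.C) (fun l _ => X.C_nonneg l)
        (Finset.mem_range.2 (by omega))
    have h3 : wt (D.ξ j) ^ (X.K * m) ≤ wt (D.ξ j) ^ (X.K * N) :=
      pow_le_pow_right₀ hj (by gcongr)
    calc ‖x‖ ^ k * ‖iteratedFDeriv ℝ m (X.χ j) x‖
        ≤ wt (D.ξ j) ^ (X.K * N) * (S * wt (D.ξ j) ^ (X.K * N)) := by
          gcongr
          exact (X.bound j m x).trans (by gcongr)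
      _ = _ := by ring

/-- A Nikol'skij inequality. -/
lemma exists_enorm_le (ha : IsAnisotropy a) (hh : IsHybridRegulation a h) {p : ℝ≥0∞} (hp : 0 < p) :
    ∃ (C : ℝ) (L : ℕ), 0 ≤ C ∧ ∀ j (G : 𝓢(E d, ℂ)),
      (∀ ξ ∉ ellip a (D.rad j) (D.ξ j) X.r, fourierS d G ξ = 0) →
      ∀ x, ‖G x‖ₑ ≤ ENNReal.ofReal (C * wt (D.ξ j) ^ L) * eLpNorm G p volume := by
  rcases le_total 1 p with hp1 | hp1
  -- For p ≥ 1 this is Hölder's inequality against 𝓕⁻¹χ_j, whose norm in the conjugate exponent is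
  -- polynomial in wt(ξ_j).
  · have := ENNReal.HolderConjugate.conjExponent hp1
    obtain ⟨C, L, hC, hX⟩ := X.exists_eLpNorm_invS_le p.conjExponent
    have hfc := fourierConst_pos d
    refine ⟨fourierConst d * C, L, by positivity, fun j G hG x => ?_⟩
    have hχ : mulS (fourierS d G) (X.χ j) = fourierS d G := by
      ext ξ
      rw [mulS_apply]
      by_cases hξ : ξ ∈ ellip a (D.rad j) (D.ξ j) X.r
      · rw [X.eq_one j ξ hξ, mul_one]
      · rw [hG ξ hξ, zero_mul]
    refine (enorm_le_eLpNorm_of_one_le (p := p) (q := p.conjExponent) hχ x).trans ?_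
    rw [mul_assoc, ENNReal.ofReal_mul hfc.le, mul_assoc, mul_comm (eLpNorm G p volume)]
    gcongr
    exact hX j
  · have hpt : p ≠ ∞ := (hp1.trans_lt ENNReal.one_lt_top).ne
    obtain ⟨p, rfl⟩ : ∃ s : ℝ, p = ENNReal.ofReal s := ⟨p.toReal, (ENNReal.ofReal_toReal hpt).symm⟩
    have hp0 : 0 < p := ENNReal.ofReal_pos.1 hp
    obtain ⟨C, hC⟩ := enorm_le_eLpNorm_of_le_one ha (show 0 < X.r by linarith [X.one_lt]) hp0
      (ENNReal.ofReal_le_one.1 hp1)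
    obtain ⟨k, hk⟩ := exists_nat_ge (1 / p)
    refine ⟨C, X.K * d * k, C.2, fun j G hG x => ?_⟩
    refine (hC _ (D.rad_pos ha hh j) _ G hG x).trans ?_
    have hj := D.one_le_wt j
    have hr := D.rad_pos ha hh j
    have h1 : ENNReal.ofReal (D.rad j ^ d) ^ (1 / p) ≤
        ENNReal.ofReal (wt (D.ξ j) ^ (X.K * d * k)) := by
      rw [ENNReal.ofReal_rpow_of_nonneg (by positivity) (by positivity)]
      refine ENNReal.ofReal_le_ofReal ?_
      have h2 : D.rad j ^ d ≤ wt (D.ξ j) ^ (X.K * d) := by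
        rw [pow_mul]
        exact pow_le_pow_left₀ hr.le (X.rad_le j) d
      calc (D.rad j ^ d) ^ (1 / p) ≤ (wt (D.ξ j) ^ (X.K * d)) ^ (1 / p) :=
            Real.rpow_le_rpow (by positivity) h2 (by positivity)
        _ ≤ (wt (D.ξ j) ^ (X.K * d)) ^ (k : ℝ) :=
            Real.rpow_le_rpow_of_exponent_le (one_le_pow₀ hj) hk
        _ = _ := by rw [Real.rpow_natCast, ← pow_mul]
    rw [ENNReal.ofReal_mul C.coe_nonneg, ENNReal.ofReal_coe_nnreal]
    gcongr

end Cutoffs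

end HomDecomp

end

open MeasureTheory Filter Topology

noncomputable section

namespace HomDecomp

/-! ### The sequence space quasi-norm -/

section SeqNorm

variable {J : Type*} {q : ℝ≥0∞}

lemma seqNorm_mono {x y : J → ℝ≥0∞} (h : ∀ j, x j ≤ y j) : seqNorm q x ≤ seqNorm q y := by
  unfold seqNorm
  split_ifs
  · exact iSup_mono h
  · refine ENNReal.rpow_le_rpow (ENNReal.tsum_le_tsum fun j => ?_) (by positivity)
    exact ENNReal.rpow_le_rpow (h j) ENNReal.toReal_nonneg

lemma seqNorm_const_mul (hq : 0 < q) (c : ℝ≥0∞) (x : J → ℝ≥0∞) :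
    seqNorm q (fun j => c * x j) = c * seqNorm q x := by
  unfold seqNorm
  split_ifs with h
  · rw [ENNReal.mul_iSup]
  · have hq' : 0 < q.toReal := ENNReal.toReal_pos hq.ne' h
    simp_rw [ENNReal.mul_rpow_of_nonneg _ _ hq'.le]
    rw [ENNReal.tsum_mul_left, ENNReal.mul_rpow_of_nonneg _ _ (by positivity), ← ENNReal.rpow_mul,
      mul_one_div_cancel hq'.ne', ENNReal.rpow_one]

lemma le_seqNorm (hq : 0 < q) (x : J → ℝ≥0∞) (j : J) : x j ≤ seqNorm q x := by
  unfold seqNorm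
  split_ifs with h
  · exact le_iSup x j
  · have hq' : 0 < q.toReal := ENNReal.toReal_pos hq.ne' h
    calc x j = (x j ^ q.toReal) ^ (1 / q.toReal) := by
          rw [← ENNReal.rpow_mul, mul_one_div_cancel hq'.ne', ENNReal.rpow_one]
      _ ≤ _ := ENNReal.rpow_le_rpow (ENNReal.le_tsum j) (by positivity)

lemma seqNorm_le_iff (hq : 0 < q) (hqt : q ≠ ∞) (x : J → ℝ≥0∞) (A : ℝ≥0∞) :
    seqNorm q x ≤ A ↔ ∑' j, x j ^ q.toReal ≤ A ^ q.toReal := by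
  have hq' : 0 < q.toReal := ENNReal.toReal_pos hq.ne' hqt
  rw [seqNorm, if_neg hqt, one_div, ENNReal.rpow_inv_le_iff hq']

lemma seqNorm_add_le_of_one_le (hq : 1 ≤ q) (x y : J → ℝ≥0∞) :
    seqNorm q (fun j => x j + y j) ≤ seqNorm q x + seqNorm q y := by
  unfold seqNorm
  split_ifs with h
  · exact iSup_le fun j => add_le_add (le_iSup x j) (le_iSup y j)
  · let _ : MeasurableSpace J := ⊤
    have hq' : 1 ≤ q.toReal := by
      rwa [← ENNReal.toReal_one, ENNReal.toReal_le_toReal ENNReal.one_ne_top h]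
    have h1 := ENNReal.lintegral_Lp_add_le (μ := Measure.count) (f := x) (g := y)
      (measurable_from_top.aemeasurable) (measurable_from_top.aemeasurable) hq'
    simpa only [lintegral_count, Pi.add_apply] using h1

lemma exists_seqNorm_add_le (hq : 0 < q) : ∃ κ : ℝ≥0, ∀ x y : J → ℝ≥0∞,
    seqNorm q (fun j => x j + y j) ≤ κ * (seqNorm q x + seqNorm q y) := by
  rcases le_total 1 q with h | h
  · exact ⟨1, fun x y => by simpa using seqNorm_add_le_of_one_le h x y⟩
  have hqt : q ≠ ∞ := (h.trans_lt ENNReal.one_lt_top).ne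
  have hq' : 0 < q.toReal := ENNReal.toReal_pos hq.ne' hqt
  have hq1 : q.toReal ≤ 1 := by
    rwa [← ENNReal.toReal_one, ENNReal.toReal_le_toReal hqt ENNReal.one_ne_top]
  -- For q ≤ 1 the q-th powers are subadditive, and A^q + B^q ≤ 2(A+B)^q.
  refine ⟨2 ^ (1 / q.toReal), fun x y => ?_⟩
  rw [seqNorm_le_iff hq hqt]
  have hx := (seqNorm_le_iff hq hqt x _).1 le_rfl
  have hy := (seqNorm_le_iff hq hqt y _).1 le_rfl
  set A := seqNorm q x
  set B := seqNorm q y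
  calc ∑' j, (x j + y j) ^ q.toReal ≤ ∑' j, (x j ^ q.toReal + y j ^ q.toReal) :=
        ENNReal.tsum_le_tsum fun j => ENNReal.rpow_add_le_add_rpow _ _ hq'.le hq1
    _ = ∑' j, x j ^ q.toReal + ∑' j, y j ^ q.toReal := ENNReal.tsum_add
    _ ≤ A ^ q.toReal + B ^ q.toReal := add_le_add hx hy
    _ ≤ (A + B) ^ q.toReal + (A + B) ^ q.toReal :=
        add_le_add (ENNReal.rpow_le_rpow le_self_add hq'.le)
          (ENNReal.rpow_le_rpow le_add_self hq'.le)
    _ = _ := by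
        rw [ENNReal.mul_rpow_of_nonneg _ _ hq'.le, ENNReal.coe_rpow_of_nonneg _ (by positivity),
          ← ENNReal.rpow_mul, one_div_mul_cancel hq'.ne', ENNReal.rpow_one]
        push_cast
        ring

/-- Fatou's lemma for the counting measure; for q = ∞ it is immediate. -/
lemma seqNorm_le_of_le_liminf (hq : 0 < q) {x : J → ℝ≥0∞} {y : ℕ → J → ℝ≥0∞}
    (h : ∀ j, x j ≤ liminf (fun n => y n j) atTop) {A : ℝ≥0∞}
    (hA : ∀ᶠ n in atTop, seqNorm q (y n) ≤ A) : seqNorm q x ≤ A := by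
  rcases eq_or_ne q ∞ with rfl | hqt
  · rw [seqNorm, if_pos rfl]
    refine iSup_le fun j => (h j).trans ?_
    refine liminf_le_of_frequently_le' (Eventually.frequently ?_)
    filter_upwards [hA] with n hn
    exact (le_seqNorm hq _ j).trans hn
  · have hq' : 0 < q.toReal := ENNReal.toReal_pos hq.ne' hqt
    rw [seqNorm_le_iff hq hqt]
    let _ : MeasurableSpace J := ⊤
    have h1 : ∀ j, x j ^ q.toReal ≤ liminf (fun n => y n j ^ q.toReal) atTop := fun j => by
      refine (ENNReal.rpow_le_rpow (h j) hq'.le).trans (le_of_eq ?_)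
      exact (ENNReal.orderIsoRpow _ hq').liminf_apply
    calc ∑' j, x j ^ q.toReal ≤ ∑' j, liminf (fun n => y n j ^ q.toReal) atTop :=
          ENNReal.tsum_le_tsum h1
      _ = ∫⁻ j, liminf (fun n => y n j ^ q.toReal) atTop ∂Measure.count :=
          (lintegral_count _).symm
      _ ≤ liminf (fun n => ∫⁻ j, y n j ^ q.toReal ∂Measure.count) atTop :=
          lintegral_liminf_le fun n => measurable_from_top
      _ ≤ A ^ q.toReal := by
          refine liminf_le_of_frequently_le' (Eventually.frequently ?_)
          filter_upwards [hA] with n hn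
          rw [lintegral_count]
          exact (seqNorm_le_iff hq hqt _ _).1 hn

end SeqNorm

/-! ### Multipliers and extensions of functionals -/

section Multiplier

variable {d : ℕ} {a : Fin d → ℝ} {h : E d → ℝ} {J : Type*}

/-- Hahn–Banach in the locally convex space 𝓢, whose topology 𝓢₀ inherits. The choice of U is
immaterial for φ_j²(D)f, which tests f only on elements of 𝓢₀ (`multiplier_eq_band`). -/
lemma exists_extension (f : SModP d) : ∃ U : 𝓢(E d, ℂ) →L[ℂ] ℂ, ∀ θ : S0 d, U θ = f θ := by
  have : PolynormableSpace ℂ 𝓢(E d, ℂ) := (schwartz_withSeminorms ℂ (E d) ℂ).toPolynormableSpace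
  exact StrongDual.exists_extension (S0 d) f

variable (D : DecompositionSystem a h J)

namespace DecompositionSystem

lemma multiplier_eq_band {f : SModP d} {U : 𝓢(E d, ℂ) →L[ℂ] ℂ} (hU : ∀ θ : S0 d, U θ = f θ) (j : J) :
    D.multiplier j f = band U (D.psi j) := by
  ext x
  rw [multiplier, fourierPairing, ← hU, band]
  simp only [modSq_eq, fourierS_modS]
  rfl

lemma multiplier_add (j : J) (f g : SModP d) :
    D.multiplier j (f + g) = D.multiplier j f + D.multiplier j g := by
  ext x
  simp [multiplier, fourierPairing, mul_add]

lemma multiplier_sub (j : J) (f g : SModP d) :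
    D.multiplier j (f - g) = D.multiplier j f - D.multiplier j g := by
  ext x
  simp [multiplier, fourierPairing, mul_sub]

lemma multiplier_smul (j : J) (c : ℂ) (f : SModP d) :
    D.multiplier j (c • f) = c • D.multiplier j f := by
  ext x
  simp [multiplier, fourierPairing]
  ring

lemma continuous_multiplier (j : J) (f : SModP d) : Continuous (D.multiplier j f) := by
  obtain ⟨U, hU⟩ := exists_extension f
  rw [D.multiplier_eq_band hU]
  exact continuous_band _ _

lemma tendsto_multiplier (j : J) {u : ℕ → SModP d} {v : SModP d}
    (h : ∀ θ, Tendsto (fun n => u n θ) atTop (𝓝 (v θ))) (x : E d) :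
    Tendsto (fun n => D.multiplier j (u n) x) atTop (𝓝 (D.multiplier j v x)) :=
  (h _).const_mul _

lemma multiplier_toSModP (j : J) (θ : S0 d) :
    D.multiplier j (toSModP θ) = invS d (mulS (D.psi j) (fourierS d (θ : 𝓢(E d, ℂ)))) := by
  ext x
  rw [multiplier, fourierPairing, toSModP_apply, ← integral_fourierS_mul, ← invFourierFn_eq,
    invFourierFn]
  congr 2
  ext ξ
  rw [modSq_apply, mulS_apply, psi_apply]
  ring

variable {p q : ℝ≥0∞} {β : ℝ}

/-- The value of φ_j²(D)f at a point is f applied to one element of 𝓢₀, so pointwise convergence of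
functionals gives pointwise convergence of these functions, and Fatou applies. -/
lemma eLpNorm_multiplier_le_liminf (j : J) {u : ℕ → SModP d} {v : SModP d}
    (h : ∀ θ, Tendsto (fun n => u n θ) atTop (𝓝 (v θ))) (p : ℝ≥0∞) :
    eLpNorm (D.multiplier j v) p volume ≤
      liminf (fun n => eLpNorm (D.multiplier j (u n)) p volume) atTop :=
  Lp.eLpNorm_lim_le_liminf_eLpNorm
    (fun n => (D.continuous_multiplier j (u n)).aestronglyMeasurable) _
    (Eventually.of_forall fun x => D.tendsto_multiplier j h x)

/-- Lower semicontinuity of the quasi-norm under pointwise convergence on 𝓢₀, by Fatou in x and then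
in j. It serves both completeness and density. -/
lemma norm_le_of_tendsto (hq : 0 < q) {u : ℕ → SModP d} {v : SModP d}
    (h : ∀ θ, Tendsto (fun n => u n θ) atTop (𝓝 (v θ))) {A : ℝ≥0∞}
    (hA : ∀ᶠ n in atTop, D.norm p q β (u n) ≤ A) : D.norm p q β v ≤ A := by
  refine seqNorm_le_of_le_liminf hq (fun j => ?_) hA
  rw [ENNReal.liminf_const_mul_of_ne_top ENNReal.ofReal_ne_top]
  exact mul_le_mul_right (D.eLpNorm_multiplier_le_liminf j h p) _

lemma norm_smul (hq : 0 < q) (c : ℂ) (f : SModP d) :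
    D.norm p q β (c • f) = ENNReal.ofReal ‖c‖ * D.norm p q β f := by
  rw [norm, norm, ← seqNorm_const_mul hq]
  congr 1
  ext j
  rw [D.multiplier_smul, eLpNorm_const_smul, ← ofReal_norm]
  ring

lemma norm_zero (hq : 0 < q) : D.norm p q β 0 = 0 := by
  have := D.norm_smul (p := p) (β := β) hq 0 0
  rwa [show (0 : ℂ) • (0 : SModP d) = 0 from by ext θ; exact zero_mul _, _root_.norm_zero, ENNReal.ofReal_zero, zero_mul] at this

lemma norm_add_le_of_one_le (hp : 1 ≤ p) (hq : 1 ≤ q) (f g : SModP d) :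
    D.norm p q β (f + g) ≤ D.norm p q β f + D.norm p q β g := by
  refine le_trans (seqNorm_mono fun j => ?_) (seqNorm_add_le_of_one_le hq _ _)
  rw [← mul_add, D.multiplier_add]
  gcongr
  exact eLpNorm_add_le (D.continuous_multiplier j f).aestronglyMeasurable
    (D.continuous_multiplier j g).aestronglyMeasurable hp

lemma exists_norm_add_le (p : ℝ≥0∞) (hq : 0 < q) (β : ℝ) : ∃ κ : ℝ≥0, ∀ f g : SModP d,
    D.norm p q β (f + g) ≤ κ * (D.norm p q β f + D.norm p q β g) := by
  obtain ⟨κ, hκ⟩ := exists_seqNorm_add_le (J := J) hq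
  refine ⟨(ENNReal.LpAddConst p).toNNReal * κ, fun f g => ?_⟩
  rw [ENNReal.coe_mul, ENNReal.coe_toNNReal (ENNReal.LpAddConst_lt_top p).ne, mul_assoc]
  refine le_trans ?_ (mul_le_mul_right (hκ _ _) _)
  rw [← seqNorm_const_mul hq]
  refine seqNorm_mono fun j => ?_
  rw [← mul_add, D.multiplier_add, mul_left_comm]
  gcongr
  exact eLpNorm_add_le' (D.continuous_multiplier j f).aestronglyMeasurable
    (D.continuous_multiplier j g).aestronglyMeasurable p

end DecompositionSystem

end Multiplier

end HomDecomp

end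

open MeasureTheory Filter Topology

noncomputable section

namespace HomDecomp

/-! ### The embeddings -/

variable {d : ℕ} {a : Fin d → ℝ} {h : E d → ℝ} {J : Type*}

/-- Testing against transforms of functions supported away from 0 shows that the transform of the
difference vanishes almost everywhere off the origin. As {0} is null and the transform is
continuous, it is zero. -/
lemma toSModP_injective [Nontrivial (E d)] : Function.Injective (toSModP (d := d)) := by
  intro θ θ' hθ
  set u : 𝓢(E d, ℂ) := (θ : 𝓢(E d, ℂ)) - θ' with hu
  have h1 : ∀ g : 𝓢(E d, ℂ), (0 : E d) ∉ tsupport g → ∫ ξ, fourierS d u ξ * g ξ = 0 := by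
    intro g hg
    rw [integral_fourierS_mul]
    have h2 := DFunLike.congr_fun hθ ⟨fourierS d g, fourierS_mem_S0 hg⟩
    rw [toSModP_apply, toSModP_apply] at h2
    have hint : ∀ v : 𝓢(E d, ℂ), Integrable fun x => v x * fourierS d g x := fun v =>
      (mulS v (fourierS d g)).integrable
    simp only [hu, sub_apply, sub_mul]
    rw [integral_sub (hint _) (hint _)]
    exact sub_eq_zero.2 h2
  have h3 : ∀ᵐ ξ : E d, ξ ∈ ({0}ᶜ : Set (E d)) → fourierS d u ξ = 0 := by
    refine isOpen_compl_singleton.ae_eq_zero_of_integral_contDiff_smul_eq_zero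
      ((fourierS d u).integrable.locallyIntegrable.locallyIntegrableOn _) fun g hg hgc hgs => ?_
    have hsm : ContDiff ℝ ((⊤ : ℕ∞) : WithTop ℕ∞) (fun x => ((g x : ℝ) : ℂ)) :=
      Complex.ofRealCLM.contDiff.comp hg
    have hcs : HasCompactSupport (fun x => ((g x : ℝ) : ℂ)) :=
      hgc.comp_left (g := fun t : ℝ => (t : ℂ)) (by simp)
    have h4 := h1 (hcs.toSchwartzMap hsm) (fun h0 => ?_)
    · rw [← h4]
      refine integral_congr_ae (Eventually.of_forall fun ξ => ?_)
      change g ξ • fourierS d u ξ = fourierS d u ξ * ((g ξ : ℝ) : ℂ)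
      rw [Complex.real_smul, mul_comm]
    · have : tsupport (fun x => ((g x : ℝ) : ℂ)) ⊆ tsupport g :=
        closure_mono fun x hx hx0 => hx (by simp [hx0])
      exact hgs (this h0) rfl
  have h5 : (fourierS d u : E d → ℂ) =ᵐ[volume] 0 := by
    have h6 : ∀ᵐ ξ : E d, ξ ∈ ({0}ᶜ : Set (E d)) := by
      rw [ae_iff]; simp
    filter_upwards [h3, h6] with ξ h7 h8 using h7 h8
  have h9 := (Continuous.ae_eq_iff_eq volume (fourierS d u).continuous continuous_zero).1 h5
  have h10 : fourierS d u = 0 := DFunLike.coe_injective h9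
  have h11 : u = 0 := by rw [← invS_fourierS u, h10, map_zero]
  exact Subtype.ext (sub_eq_zero.1 h11)

lemma mem_S0_of_spectrum {u : 𝓢(E d, ℂ)} {ε : ℝ} (hε : 0 < ε)
    (hu : ∀ ξ, fourierS d u ξ ≠ 0 → ε ≤ ‖ξ‖) : u ∈ S0 d := by
  have h1 : u = fourierS d (invS d u) := (fourierS_invS _).symm
  rw [h1]
  refine fourierS_mem_S0 fun h0 => ?_
  have h2 : tsupport (invS d u : E d → ℂ) ⊆ {ξ | ε ≤ ‖ξ‖} := by
    refine closure_minimal (fun ξ hξ => ?_) (isClosed_le continuous_const continuous_norm)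
    rw [Function.mem_support, invS_apply] at hξ
    simpa using hu (-ξ) hξ
  have h3 := h2 h0
  rw [Set.mem_ofPred_eq, _root_.norm_zero] at h3
  linarith

/-- U is continuous and ‖·‖_M is dominated by a continuous seminorm on 𝓢₀, so the estimate passes to
limits of functions whose spectrum is compact and avoids 0. For those the partition of unity is a
finite sum. -/
lemma enorm_le_of_compact_spectrum [Nontrivial (E d)] (U : 𝓢(E d, ℂ) →L[ℂ] ℂ) {B : ℝ≥0∞}
    (hB : B ≠ ∞) {M : ℕ} (hU : ∀ u ∈ S0 d, (∃ ε > 0, ∃ R, ∀ ξ, fourierS d u ξ ≠ 0 →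
      ε ≤ ‖ξ‖ ∧ ‖ξ‖ ≤ R) → ‖U u‖ₑ ≤ B * s0Norm M u) {θ : 𝓢(E d, ℂ)} (hθ : θ ∈ S0 d) :
    ‖U θ‖ₑ ≤ B * s0Norm M θ := by
  obtain ⟨u, hu, huS⟩ := exists_tendsto_of_mem_S0 hθ
  obtain ⟨P, hP, hPs⟩ := exists_s0Norm_le (d := d) M
  have huS0 : ∀ n, u n ∈ S0 d := by
    intro n
    obtain ⟨ε, hε, R, hR⟩ := huS n
    exact mem_S0_of_spectrum hε fun ξ hξ => (hR ξ hξ).1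
  have hlim : Tendsto (fun n => B * (s0Norm M θ + ENNReal.ofReal (P (u n - θ)))) atTop
      (𝓝 (B * (s0Norm M θ + 0))) := by
    refine ENNReal.Tendsto.const_mul (Tendsto.add tendsto_const_nhds ?_) (Or.inr hB)
    have h1 : Tendsto (fun n => P (u n - θ)) atTop (𝓝 (P 0)) := by
      refine hP.continuousAt.tendsto.comp ?_
      have := hu.sub_const θ
      rwa [sub_self] at this
    rw [map_zero] at h1
    simpa using ENNReal.tendsto_ofReal h1
  rw [add_zero] at hlim
  have hUl : Tendsto (fun n => ‖U (u n)‖ₑ) atTop (𝓝 ‖U θ‖ₑ) :=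
    ((U.continuous.tendsto _).comp hu).enorm
  refine le_of_tendsto_of_tendsto hUl hlim (Eventually.of_forall fun n => ?_)
  refine (hU (u n) (huS0 n) (huS n)).trans (mul_le_mul_right ?_ _)
  have h1 : u n = θ + (u n - θ) := by abel
  calc s0Norm M (u n) = s0Norm M (θ + (u n - θ)) := by rw [← h1]
    _ ≤ s0Norm M θ + s0Norm M (u n - θ) := s0Norm_add_le _ _ _
    _ ≤ _ := by
        gcongr
        exact hPs _ ((S0 d).sub_mem (huS0 n) hθ)

namespace DecompositionSystem

variable (D : DecompositionSystem a h J)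

lemma exists_weight_le (ha : IsAnisotropy a) (hh : IsHybridRegulation a h) (X : Cutoffs D) (β : ℝ) :
    ∃ (C : ℝ) (L : ℕ), 0 ≤ C ∧ ∀ j, h (D.ξ j) ^ β ≤ C * wt (D.ξ j) ^ L := by
  have hδ := D.δ_pos
  obtain ⟨k, hk⟩ := exists_nat_ge |β|
  refine ⟨(1 + D.δ + D.δ⁻¹) ^ k, X.K * k, by positivity, fun j => ?_⟩
  have hj := D.one_le_wt j
  have hH := hh.pos ha (D.ξ_ne_zero j)
  set H := h (D.ξ j)
  set W := wt (D.ξ j) ^ X.K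
  have hW : 1 ≤ W := one_le_pow₀ hj
  have h1 : D.δ * H ≤ W := X.rad_le j
  have h2 : (D.δ * H)⁻¹ ≤ W := X.inv_rad_le j
  have hm : 1 ≤ (1 + D.δ + D.δ⁻¹) * W := by
    have : 1 ≤ 1 + D.δ + D.δ⁻¹ := by have := inv_pos.2 hδ; linarith
    nlinarith
  have h3 : H ≤ (1 + D.δ + D.δ⁻¹) * W := by
    calc H = D.δ⁻¹ * (D.δ * H) := by field_simp
      _ ≤ D.δ⁻¹ * W := by gcongr
      _ ≤ _ := by gcongr; linarith
  have h4 : H⁻¹ ≤ (1 + D.δ + D.δ⁻¹) * W := by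
    calc H⁻¹ = D.δ * (D.δ * H)⁻¹ := by field_simp
      _ ≤ D.δ * W := by gcongr
      _ ≤ _ := by gcongr; have := inv_pos.2 hδ; linarith
  have h5 : H ^ β ≤ ((1 + D.δ + D.δ⁻¹) * W) ^ |β| := by
    rcases le_total 0 β with hβ | hβ
    · rw [abs_of_nonneg hβ]
      exact Real.rpow_le_rpow hH.le h3 hβ
    · rw [abs_of_nonpos hβ, ← inv_inv H, Real.inv_rpow (inv_pos.2 hH).le, ← Real.rpow_neg
        (inv_pos.2 hH).le]
      exact Real.rpow_le_rpow (inv_pos.2 hH).le h4 (by linarith)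
  calc H ^ β ≤ ((1 + D.δ + D.δ⁻¹) * W) ^ |β| := h5
    _ ≤ ((1 + D.δ + D.δ⁻¹) * W) ^ (k : ℝ) := Real.rpow_le_rpow_of_exponent_le hm hk
    _ = _ := by rw [Real.rpow_natCast, mul_pow, pow_mul]

lemma exists_seqNorm_wt_lt_top (ha : IsAnisotropy a) (hh : IsHybridRegulation a h) {q : ℝ≥0∞}
    (hq : 0 < q) : ∃ L : ℕ, seqNorm q (fun j => ENNReal.ofReal ((wt (D.ξ j) ^ L)⁻¹)) < ∞ := by
  rcases eq_or_ne q ∞ with rfl | hqt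
  · refine ⟨0, ?_⟩
    rw [seqNorm, if_pos rfl]
    refine (iSup_le fun j => ?_).trans_lt ENNReal.one_lt_top
    simp
  · have hq' : 0 < q.toReal := ENNReal.toReal_pos hq.ne' hqt
    obtain ⟨L, hL⟩ := D.exists_summable ha hh
    obtain ⟨k, hk⟩ := exists_nat_ge (L / q.toReal)
    rw [div_le_iff₀ hq'] at hk
    refine ⟨k, ?_⟩
    rw [seqNorm, if_neg hqt]
    refine ENNReal.rpow_lt_top_of_nonneg (by positivity) (ne_of_lt ?_)
    refine lt_of_le_of_lt (ENNReal.tsum_le_tsum fun j => ?_) hL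
    have hj := D.one_le_wt j
    rw [ENNReal.ofReal_rpow_of_nonneg (by positivity) hq'.le]
    refine ENNReal.ofReal_le_ofReal ?_
    rw [Real.inv_rpow (by positivity)]
    refine inv_anti₀ (by positivity) ?_
    rw [← Real.rpow_natCast, ← Real.rpow_natCast, ← Real.rpow_mul (by positivity)]
    exact Real.rpow_le_rpow_of_exponent_le hj hk

/-- The multiplier estimate removes φ_j² from φ_j² χ_j 𝓕θ, and 𝓕⁻¹(χ_j 𝓕θ) decays like any power of
1/wt(ξ_j): Lw powers pay for h(ξ_j)^β and Ls for summability in ℓ_q. -/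
lemma exists_norm_toSModP_le (ha : IsAnisotropy a) (hh : IsHybridRegulation a h) {p q : ℝ≥0∞}
    (hp : 0 < p) (hq : 0 < q) (β : ℝ) : ∃ (M : ℕ) (C : ℝ≥0), ∀ θ : S0 d,
      D.norm p q β (toSModP θ) ≤ C * s0Norm M (θ : 𝓢(E d, ℂ)) := by
  obtain ⟨X⟩ := D.exists_cutoffs ha hh
  obtain ⟨Cw, Lw, hCw, hw⟩ := D.exists_weight_le ha hh X β
  obtain ⟨Ls, hLs⟩ := D.exists_seqNorm_wt_lt_top ha hh hq
  obtain ⟨Cm, hCm⟩ := D.exists_eLpNorm_mulS_psi_le ha hh hp (show (1 : ℝ) ≤ 2 by norm_num)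
  obtain ⟨M, Ce, hCe, he⟩ := X.exists_eLpNorm_mulS_le (invS d) p (Ls + Lw)
  obtain ⟨Cd, hCd, hd⟩ := hasDecay_fourierS (d := d) M
  set S := seqNorm q (fun j => ENNReal.ofReal ((wt (D.ξ j) ^ Ls)⁻¹))
  refine ⟨M, (ENNReal.ofReal Cw * Cm * ENNReal.ofReal (Ce * Cd) * S).toNNReal, fun θ => ?_⟩
  rw [ENNReal.coe_toNNReal (by finiteness)]
  set s := (s0Norm M (θ : 𝓢(E d, ℂ))).toReal
  have hs : s0Norm M (θ : 𝓢(E d, ℂ)) = ENNReal.ofReal s :=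
    (ENNReal.ofReal_toReal (θ.2 M).ne).symm
  have hs0 : 0 ≤ s := ENNReal.toReal_nonneg
  have key : ∀ j, ENNReal.ofReal (h (D.ξ j) ^ β) *
      eLpNorm (D.multiplier j (toSModP θ)) p volume ≤
      (ENNReal.ofReal Cw * Cm * ENNReal.ofReal (Ce * Cd) * ENNReal.ofReal s) *
        ENNReal.ofReal ((wt (D.ξ j) ^ Ls)⁻¹) := by
    intro j
    have hj : 0 < wt (D.ξ j) := by linarith [D.one_le_wt j]
    have h1 := hCm j (D.ξ j) (mulS (X.χ j) (fourierS d (θ : 𝓢(E d, ℂ)))) (fun ξ hξ => by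
      rw [mulS_apply, X.eq_zero j ξ hξ, zero_mul])
    rw [X.mulS_psi ha hh, ← D.multiplier_toSModP] at h1
    have h2 := he j (fourierS d (θ : 𝓢(E d, ℂ))) (Cd * s) (by positivity) (hd _ (θ.2 M))
    calc ENNReal.ofReal (h (D.ξ j) ^ β) * eLpNorm (D.multiplier j (toSModP θ)) p volume
        ≤ ENNReal.ofReal (Cw * wt (D.ξ j) ^ Lw) *
            (Cm * ENNReal.ofReal (Ce * (Cd * s) * (wt (D.ξ j) ^ (Ls + Lw))⁻¹)) := by
          gcongr
          · exact hw j
          · exact h1.trans (by gcongr)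
      _ = Cm * ENNReal.ofReal (Cw * wt (D.ξ j) ^ Lw *
            (Ce * (Cd * s) * (wt (D.ξ j) ^ (Ls + Lw))⁻¹)) := by
          rw [ENNReal.ofReal_mul (p := Cw * wt (D.ξ j) ^ Lw) (by positivity)]
          ring
      _ = Cm * ENNReal.ofReal (Cw * (Ce * Cd) * s * (wt (D.ξ j) ^ Ls)⁻¹) := by
          congr 2
          rw [pow_add]
          field_simp
      _ = _ := by
          rw [ENNReal.ofReal_mul (by positivity), ENNReal.ofReal_mul (by positivity),
            ENNReal.ofReal_mul (by positivity)]
          ring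
  refine (seqNorm_mono key).trans (le_of_eq ?_)
  rw [seqNorm_const_mul hq, hs]
  ring

end DecompositionSystem

namespace Cutoffs

variable {D : DecompositionSystem a h J} (X : Cutoffs D)

/-- Schwartz approximations of `𝓕⁻¹(φ_j² 𝓕U)`. -/
lemma exists_approx (ha : IsAnisotropy a) (hh : IsHybridRegulation a h)
    (U : 𝓢(E d, ℂ) →L[ℂ] ℂ) (j : J) : ∃ κ θ : ℕ → 𝓢(E d, ℂ), (∀ n x, ‖κ n x‖ ≤ 1) ∧
      (∀ x, Tendsto (fun n => κ n x) atTop (𝓝 1)) ∧ (∀ n x, θ n x = κ n x * band U (D.psi j) x) ∧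
      ∀ n, ∀ ζ ∉ ellip a (D.rad j) (D.ξ j) X.r, fourierS d (θ n) ζ = 0 := by
  have hj := D.one_le_wt j
  set B := wt (D.ξ j) ^ (X.K * d)
  have hB : 0 < B := by positivity
  have hr := X.one_lt
  -- The inverse dilation has norm at most B, so a spectral shift of Euclidean length below (r-1)/B
  -- is shorter than r-1 at scale j and stays in the enlarged ball.
  obtain ⟨κ, θ, h1, h2, h3, h4⟩ := exists_band_approx U (D.psi j) (R := wt (D.ξ j) ^ X.K)
    (ε := (X.r - 1) / B) (div_pos (by linarith) hB) (fun ξ hξ => by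
      have hξ' : ξ ∈ D.ball j := by
        by_contra hcon
        exact hξ (D.psi_eq_zero ha hh hcon)
      exact (norm_le_wt ξ).trans (X.of_mem_ellip (X.ball_subset j hξ')).2.1)
  refine ⟨κ, θ, h1, h2, h3, fun n ζ hζ => ?_⟩
  by_contra hne
  obtain ⟨ξ, hξ, hd⟩ := h4 n ζ hne
  have hξ' : ξ ∈ D.ball j := by
    by_contra hcon
    exact hξ (D.psi_eq_zero ha hh hcon)
  refine hζ ?_
  have h5 : ‖dl a (D.rad j)⁻¹ (ξ - D.ξ j)‖ < 1 := hξ'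
  have h6 := norm_dl_inv_le ha (D.rad_pos ha hh j) hj (X.inv_rad_le j) (ζ - ξ)
  rw [lt_div_iff₀ hB] at hd
  have h7 : ζ - D.ξ j = (ζ - ξ) + (ξ - D.ξ j) := by abel
  rw [ellip, Set.mem_ofPred_eq, h7, map_add]
  refine (norm_add_le _ _).trans_lt ?_
  rw [mul_comm] at hd
  linarith

lemma eLpNorm_mul_band_le {U : 𝓢(E d, ℂ) →L[ℂ] ℂ} {ψ κ θ : 𝓢(E d, ℂ)} (hκ : ∀ x, ‖κ x‖ ≤ 1)
    (hθ : ∀ x, θ x = κ x * band U ψ x) (p : ℝ≥0∞) :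
    eLpNorm θ p volume ≤ eLpNorm (band U ψ) p volume := by
  refine eLpNorm_mono fun x => ?_
  rw [hθ, norm_mul]
  exact mul_le_of_le_one_left (norm_nonneg _) (hκ x)

end Cutoffs

namespace DecompositionSystem

variable (D : DecompositionSystem a h J)

/-- The Nikol'skij inequality for Schwartz functions is applied to the approximants κ_n · band,
whose L_p norm is no larger, and passes to the pointwise limit. -/
lemma exists_enorm_band_le (ha : IsAnisotropy a) (hh : IsHybridRegulation a h) {p : ℝ≥0∞}
    (hp : 0 < p) : ∃ (C : ℝ) (L : ℕ), 0 ≤ C ∧ ∀ (U : 𝓢(E d, ℂ) →L[ℂ] ℂ) j x,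
      ‖band U (D.psi j) x‖ₑ ≤
        ENNReal.ofReal (C * wt (D.ξ j) ^ L) * eLpNorm (band U (D.psi j)) p volume := by
  obtain ⟨X⟩ := D.exists_cutoffs ha hh
  obtain ⟨C, L, hC, hX⟩ := X.exists_enorm_le ha hh hp
  refine ⟨C, L, hC, fun U j x => ?_⟩
  obtain ⟨κ, θ, h1, h2, h3, h4⟩ := X.exists_approx ha hh U j
  have h5 : Tendsto (fun n => ‖θ n x‖ₑ) atTop (𝓝 ‖band U (D.psi j) x‖ₑ) := by
    have h6 := ((h2 x).mul_const (band U (D.psi j) x)).enorm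
    simp only [one_mul, ← h3] at h6
    exact h6
  refine le_of_tendsto h5 (Eventually.of_forall fun n => (hX j (θ n) (h4 n) x).trans ?_)
  gcongr
  exact Cutoffs.eLpNorm_mul_band_le (h1 n) (h3 n) p

/-- A ball containing ξ with ε ≤ |ξ| ≤ R has wt(ξ_j) ≤ (R + 1/ε)^K, which leaves finitely many
indices; over these the φ_j² already sum to 1 wherever η ≠ 0. -/
lemma exists_finset_sum_psi (ha : IsAnisotropy a) (hh : IsHybridRegulation a h) (X : Cutoffs D)
    {η : 𝓢(E d, ℂ)} {ε R : ℝ} (hε : 0 < ε) (hη : ∀ ξ, η ξ ≠ 0 → ε ≤ ‖ξ‖ ∧ ‖ξ‖ ≤ R) :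
    ∃ s : Finset J, η = ∑ j ∈ s, mulS (D.psi j) (mulS (X.χ j) η) := by
  set s := (D.finite_wt_le ha hh ((R + ε⁻¹) ^ X.K)).toFinset
  refine ⟨s, ?_⟩
  ext ξ
  have h1 : (∑ j ∈ s, mulS (D.psi j) (mulS (X.χ j) η)) ξ = (∑ j ∈ s, D.psi j ξ) * η ξ := by
    rw [sum_apply, Finset.sum_mul]
    exact Finset.sum_congr rfl fun j _ => by rw [X.mulS_psi ha hh, mulS_apply]
  rw [h1]
  by_cases hξ : η ξ = 0
  · rw [hξ, mul_zero]
  obtain ⟨h2, h3⟩ := hη ξ hξ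
  have hξ0 : ξ ≠ 0 := by
    rintro rfl
    rw [_root_.norm_zero] at h2
    linarith
  have h4 := D.bapu.sum_eq_one ξ hξ0
  simp only [← D.psi_apply] at h4
  have h5 : HasSum (fun j => D.psi j ξ) (∑ j ∈ s, D.psi j ξ) := by
    refine hasSum_sum_of_ne_finset_zero fun j hj => ?_
    refine D.psi_eq_zero ha hh fun hmem => hj ?_
    rw [Set.Finite.mem_toFinset]
    refine (X.of_mem_ellip (X.ball_subset j hmem)).2.2.trans ?_
    have := wt_pos hξ0
    refine pow_le_pow_left₀ this.le ?_ _
    rw [wt]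
    gcongr
  rw [h5.unique h4, one_mul]

/-- The embedding into `𝓢'/𝓟`. -/
lemma exists_apply_le (ha : IsAnisotropy a) (hh : IsHybridRegulation a h) {p q : ℝ≥0∞}
    (hp : 0 < p) (hq : 0 < q) (β : ℝ) : ∃ (M : ℕ) (C : ℝ≥0), ∀ f : SModP d, D.norm p q β f < ∞ →
      ∀ θ : S0 d, ENNReal.ofReal ‖f θ‖ ≤ C * D.norm p q β f * s0Norm M (θ : 𝓢(E d, ℂ)) := by
  have := D.nontrivial
  obtain ⟨X⟩ := D.exists_cutoffs ha hh
  obtain ⟨Cw, Lw, hCw, hw⟩ := D.exists_weight_le ha hh X (-β)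
  obtain ⟨Ls, hLs⟩ := D.exists_summable ha hh
  obtain ⟨Cn, Ln, hCn, hn⟩ := D.exists_enorm_band_le ha hh hp
  -- Lw powers of the weight pay for h(ξ_j)^{-β}, Ln for the Nikol'skij constant, and Ls for the sum
  -- over j.
  obtain ⟨M, Ce, hCe, he⟩ := X.exists_eLpNorm_mulS_le (fourierS d) 1 (Ls + (Lw + Ln))
  obtain ⟨Cd, hCd, hd⟩ := hasDecay_invS (d := d) M
  set S := ∑' j, ENNReal.ofReal ((wt (D.ξ j) ^ Ls)⁻¹)
  refine ⟨M, (ENNReal.ofReal (Cw * Cn * (Ce * Cd)) * S).toNNReal, fun f hf θ => ?_⟩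
  rw [ENNReal.coe_toNNReal (by finiteness)]
  obtain ⟨U, hU⟩ := exists_extension f
  set N := D.norm p q β f
  -- the bound of a single term
  have key : ∀ (u : 𝓢(E d, ℂ)), s0Norm M u < ∞ → ∀ j,
      ‖U (fourierS d (mulS (D.psi j) (mulS (X.χ j) (invS d u))))‖ₑ ≤
        (ENNReal.ofReal (Cw * Cn * (Ce * Cd)) * N * s0Norm M u) *
          ENNReal.ofReal ((wt (D.ξ j) ^ Ls)⁻¹) := by
    intro u hu j
    have hj : 0 < wt (D.ξ j) := by linarith [D.one_le_wt j]
    set t := (s0Norm M u).toReal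
    have ht : s0Norm M u = ENNReal.ofReal t := (ENNReal.ofReal_toReal hu.ne).symm
    have ht0 : 0 ≤ t := ENNReal.toReal_nonneg
    set g := fourierS d (mulS (X.χ j) (invS d u))
    have h1 : U (fourierS d (mulS (D.psi j) (mulS (X.χ j) (invS d u)))) =
        ∫ x, g x * band U (D.psi j) x := by
      rw [integral_mul_band, invS_fourierS]
    have h2 : eLpNorm (band U (D.psi j)) p volume ≤ ENNReal.ofReal (h (D.ξ j) ^ (-β)) * N := by
      have h3 : ENNReal.ofReal (h (D.ξ j) ^ β) * eLpNorm (D.multiplier j f) p volume ≤ N :=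
        le_seqNorm hq (fun j => ENNReal.ofReal (h (D.ξ j) ^ β) *
          eLpNorm (D.multiplier j f) p volume) j
      have hH := hh.pos ha (D.ξ_ne_zero j)
      calc eLpNorm (band U (D.psi j)) p volume
          = ENNReal.ofReal (h (D.ξ j) ^ (-β)) *
              (ENNReal.ofReal (h (D.ξ j) ^ β) * eLpNorm (D.multiplier j f) p volume) := by
            rw [← mul_assoc, ← ENNReal.ofReal_mul (by positivity), ← Real.rpow_add hH,
              neg_add_cancel, Real.rpow_zero, ENNReal.ofReal_one, one_mul,
              D.multiplier_eq_band hU]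
        _ ≤ _ := by gcongr
    have h4 := he j (invS d u) (Cd * t) (by positivity) (hd u hu)
    rw [eLpNorm_one_eq_lintegral_enorm] at h4
    rw [h1]
    calc ‖∫ x, g x * band U (D.psi j) x‖ₑ ≤ ∫⁻ x, ‖g x * band U (D.psi j) x‖ₑ :=
          enorm_integral_le_lintegral_enorm _
      _ ≤ ∫⁻ x, ‖g x‖ₑ * (ENNReal.ofReal (Cn * wt (D.ξ j) ^ Ln) *
            (ENNReal.ofReal (Cw * wt (D.ξ j) ^ Lw) * N)) := by
          refine lintegral_mono fun x => ?_
          rw [enorm_mul]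
          gcongr
          refine (hn U j x).trans ?_
          gcongr
          refine h2.trans ?_
          gcongr
          exact hw j
      _ = (∫⁻ x, ‖g x‖ₑ) * (ENNReal.ofReal (Cn * wt (D.ξ j) ^ Ln) *
            (ENNReal.ofReal (Cw * wt (D.ξ j) ^ Lw) * N)) :=
          lintegral_mul_const _ g.continuous.enorm.measurable
      _ ≤ ENNReal.ofReal (Ce * (Cd * t) * (wt (D.ξ j) ^ (Ls + (Lw + Ln)))⁻¹) *
            (ENNReal.ofReal (Cn * wt (D.ξ j) ^ Ln) *
            (ENNReal.ofReal (Cw * wt (D.ξ j) ^ Lw) * N)) := by gcongr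
      _ = ENNReal.ofReal (Ce * (Cd * t) * (wt (D.ξ j) ^ (Ls + (Lw + Ln)))⁻¹ *
            (Cn * wt (D.ξ j) ^ Ln * (Cw * wt (D.ξ j) ^ Lw))) * N := by
          rw [ENNReal.ofReal_mul (p := Ce * (Cd * t) * _) (by positivity),
            ENNReal.ofReal_mul (p := Cn * _) (by positivity)]
          ring
      _ = ENNReal.ofReal (Cw * Cn * (Ce * Cd) * t * (wt (D.ξ j) ^ Ls)⁻¹) * N := by
          congr 2
          rw [pow_add, pow_add]
          field_simp
      _ = _ := by
          rw [ENNReal.ofReal_mul (by positivity), ENNReal.ofReal_mul (p := _ * (Ce * Cd))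
            (by positivity), ht]
          ring
  have core : ∀ (u : 𝓢(E d, ℂ)), u ∈ S0 d → (∃ ε > 0, ∃ R, ∀ ξ, fourierS d u ξ ≠ 0 →
      ε ≤ ‖ξ‖ ∧ ‖ξ‖ ≤ R) → ‖U u‖ₑ ≤ ENNReal.ofReal (Cw * Cn * (Ce * Cd)) * S * N * s0Norm M u := by
    rintro u hu ⟨ε, hε, R, hR⟩
    obtain ⟨s, hs⟩ := D.exists_finset_sum_psi ha hh X (η := invS d u) hε (R := R) (fun ξ hξ => by
      rw [invS_apply] at hξ
      simpa using hR (-ξ) hξ)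
    have h1 : U u = ∑ j ∈ s, U (fourierS d (mulS (D.psi j) (mulS (X.χ j) (invS d u)))) := by
      rw [← map_sum, ← map_sum, ← hs, fourierS_invS]
    rw [h1]
    calc ‖∑ j ∈ s, U (fourierS d (mulS (D.psi j) (mulS (X.χ j) (invS d u))))‖ₑ
        ≤ ∑ j ∈ s, ‖U (fourierS d (mulS (D.psi j) (mulS (X.χ j) (invS d u))))‖ₑ :=
          enorm_sum_le _ _
      _ ≤ ∑ j ∈ s, (ENNReal.ofReal (Cw * Cn * (Ce * Cd)) * N * s0Norm M u) *
          ENNReal.ofReal ((wt (D.ξ j) ^ Ls)⁻¹) := Finset.sum_le_sum fun j _ => key u (hu M) j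
      _ = (ENNReal.ofReal (Cw * Cn * (Ce * Cd)) * N * s0Norm M u) *
          ∑ j ∈ s, ENNReal.ofReal ((wt (D.ξ j) ^ Ls)⁻¹) := (Finset.mul_sum _ _ _).symm
      _ ≤ (ENNReal.ofReal (Cw * Cn * (Ce * Cd)) * N * s0Norm M u) * S := by
          gcongr
          exact ENNReal.sum_le_tsum s
      _ = _ := by ring
  rw [ofReal_norm, ← hU]
  exact enorm_le_of_compact_spectrum U (by finiteness) core θ.2

end DecompositionSystem

end HomDecomp

end

open MeasureTheory Filter Topology

noncomputable section

namespace HomDecomp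

/-! ### Completeness -/

variable {d : ℕ} {a : Fin d → ℝ} {h : E d → ℝ} {J : Type*}

/-- The pointwise limit is linear, and its difference from u_{n₀} inherits the uniform bound by
‖·‖_M, hence is continuous. -/
lemma exists_SModP_of_tendsto [Nontrivial (E d)] {u : ℕ → SModP d} {v : S0 d → ℂ}
    (huv : ∀ θ, Tendsto (fun n => u n θ) atTop (𝓝 (v θ))) (n₀ M : ℕ) (C : ℝ≥0)
    (hC : ∀ᶠ n in atTop, ∀ θ : S0 d, ‖(u n - u n₀) θ‖ₑ ≤ C * s0Norm M (θ : 𝓢(E d, ℂ))) :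
    ∃ w : SModP d, ∀ θ, w θ = v θ := by
  let V : S0 d →ₗ[ℂ] ℂ := linearMapOfTendsto v (fun n => (u n).toLinearMap)
    (tendsto_pi_nhds.2 huv)
  have hV : ∀ θ, V θ = v θ := fun θ => rfl
  let W : S0 d →ₗ[ℂ] ℂ := V - (u n₀).toLinearMap
  have hWa : ∀ θ, W θ = v θ - u n₀ θ := fun θ => rfl
  obtain ⟨P, hP, hPs⟩ := exists_s0Norm_le (d := d) M
  have hW : ∀ θ : S0 d, ‖W θ‖ₑ ≤ C * ENNReal.ofReal (P θ) := by
    intro θ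
    have h1 : Tendsto (fun n => ‖(u n - u n₀) θ‖ₑ) atTop (𝓝 ‖W θ‖ₑ) :=
      ((huv θ).sub_const _).enorm
    refine le_of_tendsto h1 ?_
    filter_upwards [hC] with n hn
    exact (hn θ).trans (mul_le_mul_right (hPs _ θ.2) _)
  have hWc : Continuous W := by
    refine continuous_of_continuousAt_zero W ?_
    rw [ContinuousAt, map_zero, tendsto_zero_iff_norm_tendsto_zero]
    have h1 : Tendsto (fun θ : S0 d => (C : ℝ) * P θ) (𝓝 0) (𝓝 0) := by
      have h2 : Continuous fun θ : S0 d => (C : ℝ) * P θ :=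
        continuous_const.mul (hP.comp continuous_subtype_val)
      have h3 := h2.tendsto 0
      simpa using h3
    refine squeeze_zero (fun θ => norm_nonneg _) (fun θ => ?_) h1
    have h4 := hW θ
    rw [← ofReal_norm, ← ENNReal.ofReal_coe_nnreal, ← ENNReal.ofReal_mul C.coe_nonneg] at h4
    exact (ENNReal.ofReal_le_ofReal_iff (mul_nonneg C.coe_nonneg (apply_nonneg _ _))).1 h4
  refine ⟨u n₀ + ⟨W, hWc⟩, fun θ => ?_⟩
  change u n₀ θ + W θ = v θ
  rw [hWa]
  ring

namespace DecompositionSystem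

variable (D : DecompositionSystem a h J) {p q : ℝ≥0∞}

lemma exists_tendsto_of_cauchy (ha : IsAnisotropy a) (hh : IsHybridRegulation a h)
    (hp : 0 < p) (hq : 0 < q) (β : ℝ) (u : ℕ → SModP d) (hu : ∀ n, D.norm p q β (u n) < ∞)
    (hc : ∀ ε > 0, ∃ n₀, ∀ m ≥ n₀, ∀ n ≥ n₀, D.norm p q β (u m - u n) ≤ ε) :
    ∃ v, D.norm p q β v < ∞ ∧ Tendsto (fun n => D.norm p q β (u n - v)) atTop (𝓝 0) := by
  have := D.nontrivial
  obtain ⟨M, C, hC⟩ := D.exists_apply_le ha hh hp hq β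
  obtain ⟨κ, hκ⟩ := D.exists_norm_add_le p hq β
  have hpt : ∀ θ : S0 d, ∃ z, Tendsto (fun n => u n θ) atTop (𝓝 z) := by
    intro θ
    refine cauchySeq_tendsto_of_complete (EMetric.cauchySeq_iff.2 fun ε hε => ?_)
    obtain ⟨δ, hδ, hδε⟩ := ENNReal.exists_nnreal_pos_mul_lt
      (a := C * s0Norm M (θ : 𝓢(E d, ℂ))) (ENNReal.mul_ne_top ENNReal.coe_ne_top (θ.2 M).ne)
      (ne_of_gt hε)
    obtain ⟨n₀, hn₀⟩ := hc δ (by exact_mod_cast hδ)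
    refine ⟨n₀, fun m hm n hn => ?_⟩
    have h1 := hn₀ m hm n hn
    have h2 := hC (u m - u n) (h1.trans_lt ENNReal.coe_lt_top) θ
    rw [ofReal_norm] at h2
    rw [edist_eq_enorm_sub]
    refine (show ‖u m θ - u n θ‖ₑ ≤ _ from h2).trans_lt (lt_of_le_of_lt ?_ hδε)
    calc C * D.norm p q β (u m - u n) * s0Norm M (θ : 𝓢(E d, ℂ))
        ≤ C * δ * s0Norm M (θ : 𝓢(E d, ℂ)) := by gcongr
      _ = _ := by ring
  choose v hv using hpt
  obtain ⟨n₀, hn₀⟩ := hc 1 one_pos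
  obtain ⟨w, hw⟩ := exists_SModP_of_tendsto hv n₀ M C (by
    filter_upwards [eventually_ge_atTop n₀] with n hn θ
    have h1 := hn₀ n hn n₀ le_rfl
    have h2 := hC (u n - u n₀) (h1.trans_lt ENNReal.one_lt_top) θ
    rw [ofReal_norm] at h2
    refine h2.trans ?_
    calc C * D.norm p q β (u n - u n₀) * s0Norm M (θ : 𝓢(E d, ℂ))
        ≤ C * 1 * s0Norm M (θ : 𝓢(E d, ℂ)) := by gcongr
      _ = _ := by ring)
  simp only [← hw] at hv
  refine ⟨w, ?_, ENNReal.tendsto_atTop_zero.2 fun ε hε => ?_⟩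
  · refine lt_of_le_of_lt (D.norm_le_of_tendsto hq hv (A := κ * (D.norm p q β (u n₀) + 1)) ?_) ?_
    · filter_upwards [eventually_ge_atTop n₀] with n hn
      have h1 : u n = u n₀ + (u n - u n₀) := by abel
      rw [h1]
      refine (hκ _ _).trans ?_
      have := hn₀ n hn n₀ le_rfl
      gcongr
    · exact ENNReal.mul_lt_top ENNReal.coe_lt_top
        (ENNReal.add_lt_top.2 ⟨hu n₀, ENNReal.one_lt_top⟩)
  · obtain ⟨n₁, hn₁⟩ := hc ε hε
    refine ⟨n₁, fun n hn => ?_⟩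
    -- With n fixed, m tends to infinity in the Cauchy condition, by lower semicontinuity.
    refine D.norm_le_of_tendsto hq (u := fun m => u n - u m) (fun θ => (hv θ).const_sub _) ?_
    filter_upwards [eventually_ge_atTop n₁] with m hm
    exact hn₁ n hn m hm

lemma norm_eq_zero_iff (ha : IsAnisotropy a) (hh : IsHybridRegulation a h)
    (hp : 0 < p) (hq : 0 < q) (β : ℝ) (f : SModP d) : D.norm p q β f = 0 ↔ f = 0 := by
  constructor
  · intro hf
    obtain ⟨M, C, hC⟩ := D.exists_apply_le ha hh hp hq β
    ext θ
    have h1 := hC f (by rw [hf]; exact ENNReal.zero_lt_top) θ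
    rw [hf, mul_zero, zero_mul] at h1
    have h2 := ENNReal.ofReal_eq_zero.1 (le_antisymm h1 zero_le)
    exact norm_le_zero_iff.1 h2
  · rintro rfl
    exact D.norm_zero hq

lemma isQuasiBanach (ha : IsAnisotropy a) (hh : IsHybridRegulation a h)
    (hp : 0 < p) (hq : 0 < q) (β : ℝ) {κ : ℝ≥0} (hκ : ∀ f g : SModP d,
      D.norm p q β (f + g) ≤ κ * (D.norm p q β f + D.norm p q β g)) :
    IsQuasiBanach (D.norm p q β) κ where
  eq_zero_iff := D.norm_eq_zero_iff ha hh hp hq β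
  smul c f _ := D.norm_smul hq c f
  add_le f g _ _ := hκ f g
  complete u hu hc := D.exists_tendsto_of_cauchy ha hh hp hq β u hu hc

end DecompositionSystem

end HomDecomp

end

open MeasureTheory Filter Topology

noncomputable section

namespace HomDecomp

/-! ### Density of `𝓢₀` -/

variable {d : ℕ} {a : Fin d → ℝ} {h : E d → ℝ} {J : Type*}

lemma toSModP_add (θ η : S0 d) : toSModP (θ + η) = toSModP θ + toSModP η := by
  ext ζ
  change toSModP (θ + η) ζ = toSModP θ ζ + toSModP η ζ
  simp only [toSModP_apply]
  have hi : ∀ v : 𝓢(E d, ℂ), Integrable fun x => v x * (ζ : 𝓢(E d, ℂ)) x := fun v =>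
    (mulS v (ζ : 𝓢(E d, ℂ))).integrable
  rw [← integral_add (hi _) (hi _)]
  refine integral_congr_ae (Eventually.of_forall fun x => ?_)
  change ((θ : 𝓢(E d, ℂ)) x + (η : 𝓢(E d, ℂ)) x) * _ = _
  ring

lemma toSModP_zero : toSModP (0 : S0 d) = 0 := by
  have := toSModP_add (0 : S0 d) 0
  rw [add_zero] at this
  exact left_eq_add.1 this

lemma toSModP_sub (θ η : S0 d) : toSModP (θ - η) = toSModP θ - toSModP η := by
  rw [eq_sub_iff_add_eq, ← toSModP_add, sub_add_cancel]

/-- For p < 1 there is only a quasi-triangle inequality. A constant growing with the number of terms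
suffices, since the sums run over at most N neighbours. -/
lemma eLpNorm_sum_le_pow {F ι : Type*} [NormedAddCommGroup F] (p : ℝ≥0∞) (s : Finset ι)
    (g : ι → E d → F) (hg : ∀ i, Continuous (g i)) :
    eLpNorm (∑ i ∈ s, g i) p volume ≤
      (1 + ENNReal.LpAddConst p) ^ s.card * ∑ i ∈ s, eLpNorm (g i) p volume := by
  classical
  induction s using Finset.induction_on with
  | empty => simp
  | insert i s hi ih =>
    rw [Finset.sum_insert hi, Finset.sum_insert hi, Finset.card_insert_of_notMem hi]
    have hs : Continuous (∑ i ∈ s, g i) := by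
      have : (∑ i ∈ s, g i) = fun x => ∑ i ∈ s, g i x := by ext x; simp
      rw [this]
      exact continuous_finsetSum _ fun i _ => hg i
    set K := 1 + ENNReal.LpAddConst p
    have hK : 1 ≤ K ^ s.card := one_le_pow₀ le_self_add
    calc eLpNorm (g i + ∑ i ∈ s, g i) p volume
        ≤ ENNReal.LpAddConst p * (eLpNorm (g i) p volume + eLpNorm (∑ i ∈ s, g i) p volume) :=
          eLpNorm_add_le' (hg i).aestronglyMeasurable hs.aestronglyMeasurable p
      _ ≤ K * (K ^ s.card * eLpNorm (g i) p volume +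
            K ^ s.card * ∑ i ∈ s, eLpNorm (g i) p volume) := by
          gcongr
          · exact le_add_self
          · exact le_mul_of_one_le_left zero_le hK
      _ = _ := by ring

lemma tendsto_eLpNorm_mul {κ : ℕ → E d → ℂ} {b : E d → ℂ} (hκc : ∀ n, Continuous (κ n))
    (hb : Continuous b) (hκ : ∀ n x, ‖κ n x‖ ≤ 2) (hκ0 : ∀ x, Tendsto (fun n => κ n x) atTop (𝓝 0))
    {p : ℝ≥0∞} (hp : 0 < p) (hpt : p ≠ ∞) (hbp : eLpNorm b p volume < ∞) :
    Tendsto (fun n => eLpNorm (fun x => κ n x * b x) p volume) atTop (𝓝 0) := by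
  have hp' : 0 < p.toReal := ENNReal.toReal_pos hp.ne' hpt
  rw [eLpNorm_lt_top_iff_lintegral_rpow_enorm_lt_top hp.ne' hpt] at hbp
  simp only [eLpNorm_eq_lintegral_rpow_enorm_toReal hp.ne' hpt]
  have h1 : Tendsto (fun n => ∫⁻ x, ‖κ n x * b x‖ₑ ^ p.toReal) atTop (𝓝 (∫⁻ _ : E d, 0)) := by
    refine tendsto_lintegral_of_dominated_convergence (fun x => 2 ^ p.toReal * ‖b x‖ₑ ^ p.toReal)
      (fun n => ?_) (fun n => Eventually.of_forall fun x => ?_) ?_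
      (Eventually.of_forall fun x => ?_)
    · have := hκc n
      exact (Continuous.enorm (by fun_prop)).measurable.pow_const _
    · beta_reduce
      rw [← ENNReal.mul_rpow_of_nonneg _ _ hp'.le, enorm_mul]
      refine ENNReal.rpow_le_rpow (mul_le_mul_left ?_ _) hp'.le
      rw [← ofReal_norm]
      exact (ENNReal.ofReal_le_ofReal (hκ n x)).trans (by simp)
    · rw [lintegral_const_mul' _ _ (by finiteness)]
      exact ENNReal.mul_ne_top (by finiteness) hbp.ne
    · have h2 := ((hκ0 x).mul_const (b x)).enorm
      rw [zero_mul, enorm_zero] at h2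
      have h3 := (ENNReal.continuous_rpow_const (y := p.toReal)).continuousAt.tendsto.comp h2
      rwa [ENNReal.zero_rpow_of_pos hp'] at h3
  rw [lintegral_zero] at h1
  have h4 := (ENNReal.continuous_rpow_const (y := 1 / p.toReal)).continuousAt.tendsto.comp h1
  rwa [ENNReal.zero_rpow_of_pos (by positivity)] at h4

/-- The functional `θ ↦ ⟨U, 𝓕(ψ 𝓕⁻¹θ)⟩`. -/
def localize (U : 𝓢(E d, ℂ) →L[ℂ] ℂ) (ψ : 𝓢(E d, ℂ)) : 𝓢(E d, ℂ) →L[ℂ] ℂ :=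
  U.comp ((fourierS d).comp ((mulS ψ).comp (invS d)))

lemma localize_apply (U : 𝓢(E d, ℂ) →L[ℂ] ℂ) (ψ θ : 𝓢(E d, ℂ)) :
    localize U ψ θ = ∫ x, θ x * band U ψ x := (integral_mul_band U ψ θ).symm

lemma band_localize (U : 𝓢(E d, ℂ) →L[ℂ] ℂ) (ψ ω : 𝓢(E d, ℂ)) :
    band (localize U ψ) ω = band U (mulS ψ ω) := by
  ext x
  change (fourierConst d : ℂ) * U (fourierS d (mulS ψ (invS d (transS x (fourierS d ω))))) = _
  have h1 : mulS ψ (modS x ω) = modS x (mulS ψ ω) := by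
    ext ξ
    simp only [mulS_apply, modS_apply]
    ring
  rw [← fourierS_modS, invS_fourierS, band, ← fourierS_modS, h1]

lemma band_zero (U : 𝓢(E d, ℂ) →L[ℂ] ℂ) : band U (0 : 𝓢(E d, ℂ)) = 0 := by
  ext x
  simp [band]

lemma band_sum {ι : Type*} (U : 𝓢(E d, ℂ) →L[ℂ] ℂ) (s : Finset ι) (ψ : ι → 𝓢(E d, ℂ)) :
    band U (∑ i ∈ s, ψ i) = ∑ i ∈ s, band U (ψ i) := by
  ext x
  rw [Finset.sum_apply]
  simp only [band, map_sum, Finset.mul_sum]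

namespace DecompositionSystem

variable (D : DecompositionSystem a h J) {p q : ℝ≥0∞}

lemma exists_neighbours (ha : IsAnisotropy a) (hh : IsHybridRegulation a h) :
    ∃ (I : J → Finset J) (N : ℕ), (∀ i j, j ∈ I i ↔ (D.ball j ∩ D.ball i).Nonempty) ∧
      ∀ i, (I i).card ≤ N := by
  obtain ⟨N, hN⟩ := D.exists_overlap ha hh
  have hfin : ∀ i, {j | (D.ball j ∩ D.ball i).Nonempty}.Finite := fun i =>
    Set.finite_of_encard_le_coe (hN i)
  refine ⟨fun i => (hfin i).toFinset, N, fun i j => by simp, fun i => ?_⟩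
  have := hN i
  rw [(hfin i).encard_eq_coe_toFinset_card] at this
  exact_mod_cast this

/-- Quotients of values of `h` at the centres are quotients of radii, and the bound on their a_m-th
powers for one index m is inverted. -/
lemma exists_weight_ratio_le (ha : IsAnisotropy a) (hh : IsHybridRegulation a h) (β : ℝ) :
    ∃ C : ℝ≥0, ∀ i j, (D.ball i ∩ D.ball j).Nonempty →
      ENNReal.ofReal (h (D.ξ i) ^ β) ≤ C * ENNReal.ofReal (h (D.ξ j) ^ β) := by
  obtain ⟨K, hK0, hK⟩ := D.exists_rad_le ha hh
  have := D.nontrivial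
  obtain ⟨m⟩ : Nonempty (Fin d) := by
    by_contra hcon
    rw [not_nonempty_iff] at hcon
    exact not_subsingleton (E d) inferInstance
  have ham := ha.pos m
  set Q : ℝ≥0 := ⟨(K ^ (a m)⁻¹) ^ |β|, by positivity⟩
  refine ⟨Q, fun i j hij => ?_⟩
  have hi := hh.pos ha (D.ξ_ne_zero i)
  have hj := hh.pos ha (D.ξ_ne_zero j)
  have hδ := D.δ_pos
  have hr : ∀ i j, D.rad i / D.rad j = h (D.ξ i) / h (D.ξ j) := fun i j => by
    rw [rad, rad, mul_div_mul_left _ _ hδ.ne']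
  have hle : ∀ {ρ : ℝ}, 0 < ρ → ρ ^ a m ≤ K → ρ ≤ K ^ (a m)⁻¹ := fun {ρ} hρ h1 => by
    have h2 := Real.rpow_le_rpow (by positivity) h1 (inv_pos.2 ham).le
    rwa [← Real.rpow_mul hρ.le, mul_inv_cancel₀ ham.ne', Real.rpow_one] at h2
  have h1 := hK i j hij m
  have h2 := hK j i (by rwa [Set.inter_comm]) m
  rw [hr] at h1 h2
  have h3 := hle (by positivity) h1
  have h4 := hle (by positivity) h2
  have h5 : (h (D.ξ i) / h (D.ξ j)) ^ β ≤ (K ^ (a m)⁻¹) ^ |β| := by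
    rcases le_total 0 β with hβ | hβ
    · rw [abs_of_nonneg hβ]
      exact Real.rpow_le_rpow (by positivity) h3 hβ
    · rw [abs_of_nonpos hβ, ← inv_div, Real.inv_rpow (by positivity), ← Real.rpow_neg
        (by positivity)]
      exact Real.rpow_le_rpow (by positivity) h4 (by linarith)
  rw [Real.div_rpow hi.le hj.le, div_le_iff₀ (by positivity)] at h5
  rw [← ENNReal.ofReal_coe_nnreal, ← ENNReal.ofReal_mul Q.coe_nonneg]
  exact ENNReal.ofReal_le_ofReal h5

lemma psi_eq_sum (ha : IsAnisotropy a) (hh : IsHybridRegulation a h) {I : J → Finset J}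
    (hI : ∀ i j, j ∈ I i ↔ (D.ball j ∩ D.ball i).Nonempty) (i : J) :
    D.psi i = ∑ j ∈ I i, mulS (D.psi j) (D.psi i) := by
  ext ξ
  have h1 : (∑ j ∈ I i, mulS (D.psi j) (D.psi i)) ξ = (∑ j ∈ I i, D.psi j ξ) * D.psi i ξ := by
    rw [sum_apply, Finset.sum_mul]
    rfl
  rw [h1]
  by_cases hξ : ξ ∈ D.ball i
  · have hξ0 : ξ ≠ 0 := by
      have : ξ ∈ ⋃ j, D.ball j := Set.mem_iUnion.2 ⟨i, hξ⟩
      rw [D.iUnion_ball ha hh] at this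
      exact this
    have h4 := D.bapu.sum_eq_one ξ hξ0
    simp only [← D.psi_apply] at h4
    have h5 : HasSum (fun j => D.psi j ξ) (∑ j ∈ I i, D.psi j ξ) := by
      refine hasSum_sum_of_ne_finset_zero fun j hj => ?_
      exact D.psi_eq_zero ha hh fun hmem => hj ((hI i j).2 ⟨ξ, hmem, hξ⟩)
    rw [h5.unique h4, one_mul]
  · rw [D.psi_eq_zero ha hh hξ, mul_zero]

lemma mulS_psi_psi_eq_zero (ha : IsAnisotropy a) (hh : IsHybridRegulation a h) {i j : J}
    (hij : ¬ (D.ball j ∩ D.ball i).Nonempty) : mulS (D.psi j) (D.psi i) = 0 := by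
  ext ξ
  rw [mulS_apply]
  by_cases hξ : ξ ∈ D.ball j
  · rw [D.psi_eq_zero ha hh (x := ξ) (j := i) fun hi => hij ⟨ξ, hξ, hi⟩, mul_zero]; rfl
  · rw [D.psi_eq_zero ha hh hξ, zero_mul]; rfl

/-- The piece `𝓕⁻¹(φ_j² 𝓕U)` as an element of `𝓢'/𝓟`. -/
def piece (U : 𝓢(E d, ℂ) →L[ℂ] ℂ) (j : J) : SModP d := (localize U (D.psi j)).comp (S0 d).subtypeL

lemma multiplier_piece (U : 𝓢(E d, ℂ) →L[ℂ] ℂ) (i j : J) :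
    D.multiplier i (D.piece U j) = band U (mulS (D.psi j) (D.psi i)) := by
  rw [D.multiplier_eq_band (U := localize U (D.psi j)) (fun θ => rfl), band_localize]

end DecompositionSystem

namespace Cutoffs

variable {D : DecompositionSystem a h J} (X : Cutoffs D) {p q : ℝ≥0∞}

lemma mem_S0 {θ : 𝓢(E d, ℂ)} {j : J}
    (hθ : ∀ ζ ∉ ellip a (D.rad j) (D.ξ j) X.r, fourierS d θ ζ = 0) : θ ∈ S0 d := by
  have hj := D.one_le_wt j
  refine mem_S0_of_spectrum (ε := (wt (D.ξ j) ^ X.K)⁻¹) (by positivity) fun ξ hξ => ?_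
  have hmem : ξ ∈ ellip a (D.rad j) (D.ξ j) X.r := by
    by_contra hcon
    exact hξ (hθ ξ hcon)
  obtain ⟨h0, h1, -⟩ := X.of_mem_ellip hmem
  exact inv_le_of_inv_le₀ (norm_pos_iff.2 h0) ((inv_norm_le_wt ξ).trans h1)

/-- Elements of `𝓢₀` approximating a piece. -/
lemma exists_S0_approx (ha : IsAnisotropy a) (hh : IsHybridRegulation a h)
    (U : 𝓢(E d, ℂ) →L[ℂ] ℂ) (j : J) : ∃ (κ : ℕ → 𝓢(E d, ℂ)) (θ : ℕ → S0 d),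
      (∀ n x, ‖κ n x‖ ≤ 1) ∧ (∀ x, Tendsto (fun n => κ n x) atTop (𝓝 1)) ∧
      (∀ n x, (θ n : 𝓢(E d, ℂ)) x = κ n x * band U (D.psi j) x) ∧
      (∀ n, ∀ ζ ∉ ellip a (D.rad j) (D.ξ j) X.r, fourierS d (θ n : 𝓢(E d, ℂ)) ζ = 0) ∧
      ∀ η, Tendsto (fun n => toSModP (θ n) η) atTop (𝓝 (D.piece U j η)) := by
  obtain ⟨κ, θ, h1, h2, h3, h4⟩ := X.exists_approx ha hh U j
  refine ⟨κ, fun n => ⟨θ n, X.mem_S0 (h4 n)⟩, h1, h2, h3, h4, fun η => ?_⟩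
  have h5 : D.piece U j η = ∫ x, (η : 𝓢(E d, ℂ)) x * band U (D.psi j) x := localize_apply _ _ _
  rw [h5]
  simp only [toSModP_apply, h3]
  have hi := integrable_mul_band U (D.psi j) (η : 𝓢(E d, ℂ))
  have hc := continuous_band U (D.psi j)
  refine tendsto_integral_of_dominated_convergence _ (fun n => ?_) hi.norm
    (fun n => Eventually.of_forall fun x => ?_) (Eventually.of_forall fun x => ?_)
  · exact (((κ n).continuous.mul hc).mul (η : 𝓢(E d, ℂ)).continuous).aestronglyMeasurable
  · rw [mul_assoc, norm_mul, mul_comm (band U (D.psi j) x)]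
    exact mul_le_of_le_one_left (norm_nonneg _) (h1 n x)
  · have h6 := ((h2 x).mul_const (band U (D.psi j) x)).mul_const ((η : 𝓢(E d, ℂ)) x)
    rwa [one_mul, mul_comm (band U (D.psi j) x)] at h6

end Cutoffs

namespace DecompositionSystem

variable (D : DecompositionSystem a h J) {p q : ℝ≥0∞}

/-- A piece need not be a Schwartz function, so the multiplier estimate is applied to its
approximants, whose spectrum lies in an ellipsoid of scale rad_i because the balls meet, and Fatou
gives the limit. -/
lemma exists_eLpNorm_multiplier_piece_le (ha : IsAnisotropy a) (hh : IsHybridRegulation a h)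
    (hp : 0 < p) : ∃ C : ℝ≥0, ∀ (U : 𝓢(E d, ℂ) →L[ℂ] ℂ) (i j : J),
      (D.ball i ∩ D.ball j).Nonempty → eLpNorm (D.multiplier i (D.piece U j)) p volume ≤
        C * eLpNorm (band U (D.psi j)) p volume := by
  obtain ⟨X⟩ := D.exists_cutoffs ha hh
  obtain ⟨R, hR, hRs⟩ := D.exists_ellip_subset ha hh
  obtain ⟨C, hC⟩ := D.exists_eLpNorm_mulS_psi_le ha hh hp hR
  refine ⟨C, fun U i j hij => ?_⟩
  obtain ⟨κ, θ, h1, h2, h3, h4, h5⟩ := X.exists_S0_approx ha hh U j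
  refine (D.eLpNorm_multiplier_le_liminf i h5 p).trans ?_
  refine liminf_le_of_frequently_le' (Frequently.of_forall fun n => ?_)
  rw [D.multiplier_toSModP]
  refine (hC i (D.ξ j) _ fun ξ hξ => h4 n ξ fun hmem => hξ (hRs i j hij ?_)).trans ?_
  · exact (show _ < X.r from hmem).trans X.lt_two
  · rw [invS_fourierS]
    gcongr
    exact Cutoffs.eLpNorm_mul_band_le (h1 n) (h3 n) p

/-- Only finitely many Q_i meet the enlarged ball j, so the norm has finitely many nonzero terms.
The constant may depend on j, since pieces are approximated one at a time. -/
lemma exists_norm_toSModP_le_eLpNorm (ha : IsAnisotropy a) (hh : IsHybridRegulation a h)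
    (X : Cutoffs D) (hp : 0 < p) (hq : 0 < q) (hqt : q ≠ ∞) (β : ℝ) (j : J) :
    ∃ C : ℝ≥0, ∀ θ : S0 d,
      (∀ ζ ∉ ellip a (D.rad j) (D.ξ j) X.r, fourierS d (θ : 𝓢(E d, ℂ)) ζ = 0) →
      D.norm p q β (toSModP θ) ≤ C * eLpNorm (θ : 𝓢(E d, ℂ)) p volume := by
  classical
  have hq' : 0 < q.toReal := ENNReal.toReal_pos hq.ne' hqt
  set I := (D.finite_wt_le ha hh ((wt (D.ξ j) ^ X.K) ^ X.K)).toFinset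
  have hC : ∀ i, ∃ C : ℝ≥0, ∀ g : 𝓢(E d, ℂ), (∀ ξ ∉ ellip a (D.rad j) (D.ξ j) X.r, g ξ = 0) →
      eLpNorm (invS d (mulS (D.psi i) g)) p volume ≤ C * eLpNorm (invS d g) p volume := by
    intro i
    obtain ⟨B, hB⟩ := (isBounded_ellip (a := a) (D.rad_pos ha hh j) (D.ξ j) X.r).exists_norm_le
    -- A crude radius: at scale i it contains the whole enlarged ball j, which is bounded.
    set R := wt (D.ξ i) ^ (X.K * d) * (|B| + ‖D.ξ j‖) + 1
    have hi := D.one_le_wt i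
    have hR : 1 ≤ R := le_add_of_nonneg_left (by positivity)
    obtain ⟨C, hC⟩ := D.exists_eLpNorm_mulS_psi_le ha hh hp hR
    refine ⟨C, fun g hg => hC i (D.ξ j) g fun ξ hξ => hg ξ fun hmem => hξ ?_⟩
    refine (norm_dl_inv_le ha (D.rad_pos ha hh i) hi (X.inv_rad_le i) _).trans_lt ?_
    refine lt_of_le_of_lt ?_ (lt_add_one _)
    gcongr
    exact (norm_sub_le _ _).trans (by gcongr; exact (hB ξ hmem).trans (le_abs_self B))
  choose C hC using hC
  set c : J → ℝ≥0∞ := fun i => if i ∈ I then ENNReal.ofReal (h (D.ξ i) ^ β) * C i else 0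
  have hc : seqNorm q c < ∞ := by
    rw [seqNorm, if_neg hqt]
    refine ENNReal.rpow_lt_top_of_nonneg (by positivity) ?_
    rw [tsum_eq_sum (s := I) (fun i hi => by simp [c, hi, hq'])]
    refine (ENNReal.sum_lt_top.2 fun i _ => ?_).ne
    refine ENNReal.rpow_lt_top_of_nonneg hq'.le ?_
    simp only [c]
    split_ifs
    finiteness
  refine ⟨(seqNorm q c).toNNReal, fun θ hθ => ?_⟩
  rw [ENNReal.coe_toNNReal hc.ne, mul_comm, ← seqNorm_const_mul hq]
  refine seqNorm_mono fun i => ?_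
  rw [D.multiplier_toSModP]
  by_cases hi : i ∈ I
  · simp only [c, if_pos hi]
    have h1 := hC i _ hθ
    rw [invS_fourierS] at h1
    calc ENNReal.ofReal (h (D.ξ i) ^ β) *
          eLpNorm (invS d (mulS (D.psi i) (fourierS d (θ : 𝓢(E d, ℂ))))) p volume
        ≤ ENNReal.ofReal (h (D.ξ i) ^ β) * (C i * eLpNorm (θ : 𝓢(E d, ℂ)) p volume) := by gcongr
      _ = _ := by ring
  · have h1 : mulS (D.psi i) (fourierS d (θ : 𝓢(E d, ℂ))) = 0 := by
      ext ξ
      rw [mulS_apply]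
      by_cases hξ : ξ ∈ ellip a (D.rad j) (D.ξ j) X.r
      · rw [D.psi_eq_zero ha hh (fun hmem => hi ?_), zero_mul]
        · rfl
        rw [Set.Finite.mem_toFinset]
        obtain ⟨h0, h2, -⟩ := X.of_mem_ellip hξ
        exact (X.of_mem_ellip (X.ball_subset i hmem)).2.2.trans
          (pow_le_pow_left₀ (wt_pos h0).le h2 _)
      · rw [hθ ξ hξ, mul_zero]; rfl
    rw [h1, map_zero]
    simp

/-- The piece itself may lie outside 𝓢₀, so the L_p bound is used for differences θ_n - θ_m of
approximants. They tend to 0 in L_p by dominated convergence (p < ∞), and n → ∞ by lower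
semicontinuity replaces θ_n by the piece. -/
lemma exists_norm_piece_sub_lt (ha : IsAnisotropy a) (hh : IsHybridRegulation a h)
    (hp : 0 < p) (hpt : p ≠ ∞) (hq : 0 < q) (hqt : q ≠ ∞) (β : ℝ) (U : 𝓢(E d, ℂ) →L[ℂ] ℂ) (j : J)
    (hU : eLpNorm (band U (D.psi j)) p volume < ∞) {ε : ℝ≥0∞} (hε : 0 < ε) :
    ∃ θ : S0 d, D.norm p q β (D.piece U j - toSModP θ) < ε := by
  obtain ⟨X⟩ := D.exists_cutoffs ha hh
  obtain ⟨κ, θ, h1, h2, h3, h4, h5⟩ := X.exists_S0_approx ha hh U j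
  obtain ⟨C, hC⟩ := D.exists_norm_toSModP_le_eLpNorm ha hh X hp hq hqt β j
  set b := band U (D.psi j)
  have hb : Continuous b := continuous_band U (D.psi j)
  set e : ℕ → ℝ≥0∞ := fun n => eLpNorm (fun x => (κ n x - 1) * b x) p volume
  have he : Tendsto e atTop (𝓝 0) := by
    refine tendsto_eLpNorm_mul (fun n => (κ n).continuous.sub continuous_const) hb (fun n x => ?_)
      (fun x => ?_) hp hpt hU
    · refine (norm_sub_le _ _).trans ?_
      have : ‖(1 : ℂ)‖ = 1 := by simp
      linarith [h1 n x]
    · have := (h2 x).sub_const 1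
      rwa [sub_self] at this
  have hdiff : ∀ n m, D.norm p q β (toSModP (θ n) - toSModP (θ m)) ≤
      C * (ENNReal.LpAddConst p * (e n + e m)) := by
    intro n m
    rw [← toSModP_sub]
    refine (hC _ fun ζ hζ => ?_).trans (mul_le_mul_right ?_ _)
    · rw [Submodule.coe_sub, map_sub, sub_apply, h4 n ζ hζ, h4 m ζ hζ, sub_self]
    · have h6 : ((θ n - θ m : S0 d) : 𝓢(E d, ℂ)) =
          (fun x => (κ n x - 1) * b x) - fun x => (κ m x - 1) * b x := by
        ext x
        rw [Submodule.coe_sub, sub_apply, h3, h3, Pi.sub_apply]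
        ring
      rw [h6]
      exact eLpNorm_sub_le' (((κ n).continuous.sub continuous_const).mul hb).aestronglyMeasurable
        (((κ m).continuous.sub continuous_const).mul hb).aestronglyMeasurable p
  obtain ⟨δ, hδ0, hδ⟩ := exists_between hε
  have hδ' : Tendsto (fun nm : ℕ × ℕ => C * (ENNReal.LpAddConst p * (e nm.1 + e nm.2)))
      (atTop ×ˢ atTop) (𝓝 0) := by
    have h7 := ENNReal.Tendsto.const_mul (a := C) (ENNReal.Tendsto.const_mul
      ((he.comp tendsto_fst).add (he.comp (tendsto_snd (f := (atTop : Filter ℕ)))))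
      (Or.inr (ENNReal.LpAddConst_lt_top p).ne)) (Or.inr ENNReal.coe_ne_top)
    simpa using h7
  have h8 := hδ'.eventually (gt_mem_nhds hδ0)
  rw [prod_atTop_atTop_eq, eventually_atTop] at h8
  obtain ⟨⟨n₀, m₀⟩, h9⟩ := h8
  refine ⟨θ m₀, lt_of_le_of_lt (D.norm_le_of_tendsto hq
    (u := fun n => toSModP (θ n) - toSModP (θ m₀)) (fun η => (h5 η).sub_const _) ?_) hδ⟩
  filter_upwards [eventually_ge_atTop n₀] with n hn
  exact (hdiff n m₀).trans (h9 (n, m₀) ⟨hn, le_rfl⟩).le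

lemma exists_norm_sum_piece_sub_lt (ha : IsAnisotropy a) (hh : IsHybridRegulation a h)
    (hp : 0 < p) (hpt : p ≠ ∞) (hq : 0 < q) (hqt : q ≠ ∞) (β : ℝ) (U : 𝓢(E d, ℂ) →L[ℂ] ℂ)
    (hU : ∀ j, eLpNorm (band U (D.psi j)) p volume < ∞) (s : Finset J) :
    ∀ {ε : ℝ≥0∞}, 0 < ε →
      ∃ θ : S0 d, D.norm p q β (∑ j ∈ s, D.piece U j - toSModP θ) < ε := by
  classical
  obtain ⟨κ, hκ⟩ := D.exists_norm_add_le p hq β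
  induction s using Finset.induction_on with
  | empty =>
    intro ε hε
    refine ⟨0, ?_⟩
    rw [Finset.sum_empty, toSModP_zero, sub_zero, D.norm_zero hq]
    exact hε
  | insert j s hj ih =>
    intro ε hε
    obtain ⟨δ, hδ0, hδ⟩ := ENNReal.exists_nnreal_pos_mul_lt (a := κ * 2) (b := ε) (by finiteness)
      hε.ne'
    have hδ0' : (0 : ℝ≥0∞) < δ := by exact_mod_cast hδ0
    obtain ⟨θ₁, h1⟩ := D.exists_norm_piece_sub_lt ha hh hp hpt hq hqt β U j (hU j) hδ0'
    obtain ⟨θ₂, h2⟩ := ih hδ0'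
    refine ⟨θ₁ + θ₂, ?_⟩
    have h3 : ∑ j ∈ insert j s, D.piece U j - toSModP (θ₁ + θ₂) =
        (D.piece U j - toSModP θ₁) + (∑ j ∈ s, D.piece U j - toSModP θ₂) := by
      rw [Finset.sum_insert hj, toSModP_add]
      abel
    rw [h3]
    refine (hκ _ _).trans_lt (lt_of_le_of_lt ?_ hδ)
    calc (κ : ℝ≥0∞) * (D.norm p q β (D.piece U j - toSModP θ₁) +
          D.norm p q β (∑ j ∈ s, D.piece U j - toSModP θ₂)) ≤ κ * (δ + δ) := by gcongr
      _ = _ := by ring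

/-- An inner sum is at most N times its largest term, and by symmetry each j occurs in at most N of
the index sets. -/
lemma tsum_sum_neighbours_le {I : J → Finset J} {N : ℕ} (hIs : ∀ i j, j ∈ I i ↔ i ∈ I j)
    (hN : ∀ i, (I i).card ≤ N) {r : ℝ} (hr : 0 < r) (y : J → ℝ≥0∞) :
    ∑' i, (∑ j ∈ I i, y j) ^ r ≤ N ^ r * (N * ∑' j, y j ^ r) := by
  classical
  have h1 : ∀ i, (∑ j ∈ I i, y j) ^ r ≤ N ^ r * ∑ j ∈ I i, y j ^ r := by
    intro i
    rcases (I i).eq_empty_or_nonempty with h0 | h0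
    · simp [h0, hr]
    · obtain ⟨k, hk, hmax⟩ := Finset.exists_max_image (I i) y h0
      calc (∑ j ∈ I i, y j) ^ r ≤ (N * y k) ^ r := by
            refine ENNReal.rpow_le_rpow ?_ hr.le
            refine (Finset.sum_le_card_nsmul _ _ _ hmax).trans ?_
            rw [nsmul_eq_mul]
            have := hN i
            gcongr
        _ = N ^ r * y k ^ r := ENNReal.mul_rpow_of_nonneg _ _ hr.le
        _ ≤ _ := by
            gcongr
            exact Finset.single_le_sum (f := fun j => y j ^ r) (fun _ _ => zero_le) hk
  calc ∑' i, (∑ j ∈ I i, y j) ^ r ≤ ∑' i, N ^ r * ∑ j ∈ I i, y j ^ r :=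
        ENNReal.tsum_le_tsum h1
    _ = N ^ r * ∑' i, ∑' j, if j ∈ I i then y j ^ r else 0 := by
        rw [ENNReal.tsum_mul_left]
        congr 1
        refine tsum_congr fun i => ?_
        rw [tsum_eq_sum (s := I i) (fun j hj => if_neg hj)]
        exact Finset.sum_congr rfl fun j hj => (if_pos hj).symm
    _ = N ^ r * ∑' j, ∑' i, if i ∈ I j then y j ^ r else 0 := by
        rw [ENNReal.tsum_comm]
        simp only [hIs]
    _ ≤ N ^ r * ∑' j, N * y j ^ r := by
        gcongr with j
        rw [tsum_eq_sum (s := I j) (fun i hi => if_neg hi), Finset.sum_congr rfl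
          (fun i hi => if_pos hi), Finset.sum_const, nsmul_eq_mul]
        have := hN j
        gcongr
    _ = _ := by rw [ENNReal.tsum_mul_left]

/-- After subtracting the pieces in s, the i-th component of f is the sum of its pieces from
neighbours j ∉ s (`hterm`). So the norm is bounded by the tail over j ∉ s of the convergent series
defining ‖f‖^q, which is small for large s since q < ∞. -/
lemma exists_norm_sub_sum_piece_lt (ha : IsAnisotropy a) (hh : IsHybridRegulation a h)
    (hp : 0 < p) (hq : 0 < q) (hqt : q ≠ ∞) (β : ℝ) {f : SModP d} (hf : D.norm p q β f < ∞)
    {U : 𝓢(E d, ℂ) →L[ℂ] ℂ} (hU : ∀ θ : S0 d, U θ = f θ) {ε : ℝ≥0∞} (hε : 0 < ε) :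
    ∃ s : Finset J, D.norm p q β (f - ∑ j ∈ s, D.piece U j) < ε := by
  classical
  have hq' : 0 < q.toReal := ENNReal.toReal_pos hq.ne' hqt
  obtain ⟨I, N, hI, hN⟩ := D.exists_neighbours ha hh
  obtain ⟨Cw, hCw⟩ := D.exists_weight_ratio_le ha hh β
  obtain ⟨Cm, hCm⟩ := D.exists_eLpNorm_multiplier_piece_le ha hh hp
  have hIs : ∀ i j, j ∈ I i ↔ i ∈ I j := fun i j => by rw [hI, hI, Set.inter_comm]
  set w : J → ℝ≥0∞ := fun j => ENNReal.ofReal (h (D.ξ j) ^ β)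
  set b : J → ℝ≥0∞ := fun j => eLpNorm (band U (D.psi j)) p volume
  set K := 1 + ENNReal.LpAddConst p
  have hK1 : 1 ≤ K := le_self_add
  have hKt : K ≠ ∞ := ENNReal.add_ne_top.2 ⟨ENNReal.one_ne_top, (ENNReal.LpAddConst_lt_top p).ne⟩
  have hterm : ∀ (s : Finset J) i,
      D.multiplier i (f - ∑ j ∈ s, D.piece U j) = ∑ j ∈ I i \ s, D.multiplier i (D.piece U j) := by
    intro s i
    have h1 : D.multiplier i (∑ j ∈ s, D.piece U j) = ∑ j ∈ s, D.multiplier i (D.piece U j) := by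
      induction s using Finset.induction_on with
      | empty =>
        ext x
        simp [multiplier, fourierPairing]
      | insert j s hj ih => rw [Finset.sum_insert hj, Finset.sum_insert hj, D.multiplier_add, ih]
    have h2 : D.multiplier i f = ∑ j ∈ I i, D.multiplier i (D.piece U j) := by
      rw [D.multiplier_eq_band hU, D.psi_eq_sum ha hh hI i, band_sum]
      exact Finset.sum_congr rfl fun j _ => (D.multiplier_piece U i j).symm
    have h3 : ∑ j ∈ s, D.multiplier i (D.piece U j) =
        ∑ j ∈ I i ∩ s, D.multiplier i (D.piece U j) := by
      refine (Finset.sum_subset Finset.inter_subset_right fun j hj hj' => ?_).symm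
      rw [D.multiplier_piece, D.mulS_psi_psi_eq_zero ha hh, band_zero]
      intro hne
      exact hj' (Finset.mem_inter.2 ⟨(hI i j).2 hne, hj⟩)
    rw [D.multiplier_sub, h1, h2, h3, sub_eq_iff_eq_add, add_comm, Finset.sum_inter_add_sum_sdiff]
  set A : ℝ≥0∞ := K ^ N * (Cw * Cm)
  have hA : A ≠ ∞ := by
    exact ENNReal.mul_ne_top (ENNReal.pow_ne_top hKt) (by finiteness)
  have hbd : ∀ (s : Finset J) i, w i * eLpNorm (D.multiplier i (f - ∑ j ∈ s, D.piece U j)) p volume ≤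
      A * ∑ j ∈ I i, if j ∈ s then 0 else w j * b j := by
    intro s i
    rw [hterm]
    calc w i * eLpNorm (∑ j ∈ I i \ s, D.multiplier i (D.piece U j)) p volume
        ≤ w i * (K ^ N * ∑ j ∈ I i \ s, Cm * b j) := by
          gcongr
          refine (eLpNorm_sum_le_pow p _ _ fun j => D.continuous_multiplier i _).trans ?_
          have hcard : (I i \ s).card ≤ N := (Finset.card_le_card Finset.sdiff_subset).trans (hN i)
          refine mul_le_mul' (pow_le_pow_right₀ hK1 hcard) (Finset.sum_le_sum fun j hj => ?_)
          refine hCm U i j ?_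
          rw [Set.inter_comm]
          exact (hI i j).1 (Finset.mem_sdiff.1 hj).1
      _ = K ^ N * ∑ j ∈ I i \ s, w i * (Cm * b j) := by
          rw [mul_left_comm, Finset.mul_sum]
      _ ≤ K ^ N * ∑ j ∈ I i \ s, Cw * Cm * (w j * b j) := by
          refine mul_le_mul_right (Finset.sum_le_sum fun j hj => ?_) _
          have h1 : w i ≤ Cw * w j := hCw i j (by
            rw [Set.inter_comm]
            exact (hI i j).1 (Finset.mem_sdiff.1 hj).1)
          calc w i * (Cm * b j) ≤ (Cw * w j) * (Cm * b j) := by gcongr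
            _ = _ := by ring
      _ = A * ∑ j ∈ I i, if j ∈ s then 0 else w j * b j := by
          rw [← Finset.mul_sum, ← mul_assoc, Finset.sdiff_eq_filter, Finset.sum_filter]
          simp only [ite_not]
          rfl
  have hsum : ∑' j, (w j * b j) ^ q.toReal ≠ ∞ := by
    have h1 := (seqNorm_le_iff hq hqt _ _).1 (le_refl (D.norm p q β f))
    refine ne_top_of_le_ne_top (ENNReal.rpow_ne_top_of_nonneg hq'.le hf.ne) (le_trans (le_of_eq ?_) h1)
    refine tsum_congr fun j => ?_
    rw [D.multiplier_eq_band hU]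
  have htail := ENNReal.tendsto_tsum_compl_atTop_zero hsum
  have hfin : A ^ q.toReal * (N ^ q.toReal * N) ≠ ∞ :=
    ENNReal.mul_ne_top (ENNReal.rpow_ne_top_of_nonneg hq'.le hA) (by finiteness)
  have hlim : Tendsto (fun s : Finset J => A ^ q.toReal * (N ^ q.toReal * N) *
      ∑' j : {j // j ∉ s}, (w j * b j) ^ q.toReal) atTop (𝓝 0) := by
    have := ENNReal.Tendsto.const_mul htail (Or.inr hfin)
    rwa [mul_zero] at this
  obtain ⟨δ, hδ0, hδ⟩ := exists_between hε
  have hδq : 0 < δ ^ q.toReal := ENNReal.rpow_pos_of_nonneg hδ0 hq'.le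
  obtain ⟨s, hs⟩ := (hlim.eventually (gt_mem_nhds hδq)).exists
  refine ⟨s, lt_of_le_of_lt ?_ hδ⟩
  refine (seqNorm_mono (hbd s)).trans ?_
  rw [seqNorm_le_iff hq hqt]
  refine le_trans ?_ hs.le
  rw [tsum_congr fun i => ENNReal.mul_rpow_of_nonneg A _ hq'.le, ENNReal.tsum_mul_left, mul_assoc]
  refine mul_le_mul_right ?_ _
  refine (tsum_sum_neighbours_le hIs hN hq' _).trans (le_of_eq ?_)
  rw [mul_assoc]
  congr 2
  refine Eq.trans ?_ (tsum_subtype {j | j ∉ s} fun j => (w j * b j) ^ q.toReal).symm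
  refine tsum_congr fun j => ?_
  by_cases hj : j ∈ s
  · simp [hj, hq']
  · simp [hj]

/-- Density of `𝓢₀`. -/
lemma exists_norm_sub_toSModP_lt (ha : IsAnisotropy a) (hh : IsHybridRegulation a h)
    (hp : 0 < p) (hpt : p ≠ ∞) (hq : 0 < q) (hqt : q ≠ ∞) (β : ℝ) {f : SModP d}
    (hf : D.norm p q β f < ∞) {ε : ℝ≥0∞} (hε : 0 < ε) :
    ∃ θ : S0 d, D.norm p q β (f - toSModP θ) < ε := by
  obtain ⟨κ, hκ⟩ := D.exists_norm_add_le p hq β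
  obtain ⟨U, hU⟩ := exists_extension f
  have hb : ∀ j, eLpNorm (band U (D.psi j)) p volume < ∞ := by
    intro j
    have h1 := (le_seqNorm hq (fun j => ENNReal.ofReal (h (D.ξ j) ^ β) *
      eLpNorm (D.multiplier j f) p volume) j).trans_lt hf
    have hw : ENNReal.ofReal (h (D.ξ j) ^ β) ≠ 0 := by
      rw [Ne, ENNReal.ofReal_eq_zero, not_le]
      exact Real.rpow_pos_of_pos (hh.pos ha (D.ξ_ne_zero j)) β
    rw [D.multiplier_eq_band hU] at h1
    exact ENNReal.lt_top_of_mul_ne_top_right h1.ne hw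
  obtain ⟨δ, hδ0, hδ⟩ := ENNReal.exists_nnreal_pos_mul_lt (a := κ * 2) (b := ε) (by finiteness)
    hε.ne'
  have hδ0' : (0 : ℝ≥0∞) < δ := by exact_mod_cast hδ0
  obtain ⟨s, hs⟩ := D.exists_norm_sub_sum_piece_lt ha hh hp hq hqt β hf hU hδ0'
  obtain ⟨θ, hθ⟩ := D.exists_norm_sum_piece_sub_lt ha hh hp hpt hq hqt β U hb s hδ0'
  refine ⟨θ, ?_⟩
  have h3 : f - toSModP θ = (f - ∑ j ∈ s, D.piece U j) + (∑ j ∈ s, D.piece U j - toSModP θ) := by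
    abel
  rw [h3]
  refine (hκ _ _).trans_lt (lt_of_le_of_lt ?_ hδ)
  calc (κ : ℝ≥0∞) * (D.norm p q β (f - ∑ j ∈ s, D.piece U j) +
        D.norm p q β (∑ j ∈ s, D.piece U j - toSModP θ)) ≤ κ * (δ + δ) := by gcongr
    _ = _ := by ring

end DecompositionSystem

end HomDecomp

end

/-! ### The proposition. -/

open HomDecomp

theorem proposition4p2 {d : ℕ} (a : Fin d → ℝ) (ha : IsAnisotropy a)
    (h : E d → ℝ) (hh : IsHybridRegulation a h)
    {J : Type*} (D : DecompositionSystem a h J)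
    (p q : ℝ≥0∞) (hp : 0 < p) (hq : 0 < q) (β : ℝ) :
    -- the continuous embedding of `𝓢₀` into the decomposition space
    (Function.Injective (toSModP (d := d)) ∧
      ∃ (M : ℕ) (C : ℝ≥0), ∀ θ : S0 d,
        D.norm p q β (toSModP θ) ≤ C * s0Norm M (θ : 𝓢(E d, ℂ))) ∧
    -- the continuous embedding of the decomposition space into `𝓢'/𝓟`
    (∃ (M : ℕ) (C : ℝ≥0), ∀ f : SModP d, D.norm p q β f < ∞ → ∀ θ : S0 d,
      ENNReal.ofReal ‖f θ‖ ≤ C * D.norm p q β f * s0Norm M (θ : 𝓢(E d, ℂ))) ∧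
    -- the decomposition space is a quasi-Banach space, and a Banach space if `p, q ≥ 1`
    (∃ κ : ℝ≥0, IsQuasiBanach (D.norm p q β) κ) ∧
    (1 ≤ p → 1 ≤ q → IsQuasiBanach (D.norm p q β) 1) ∧
    -- `𝓢₀` is dense if `p, q < ∞`
    (p < ∞ → q < ∞ → ∀ f : SModP d, D.norm p q β f < ∞ → ∀ ε > 0,
      ∃ θ : S0 d, D.norm p q β (f - toSModP θ) < ε) := by
  have := D.nontrivial
  obtain ⟨κ, hκ⟩ := D.exists_norm_add_le p hq β
  refine ⟨⟨toSModP_injective, D.exists_norm_toSModP_le ha hh hp hq β⟩,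
    D.exists_apply_le ha hh hp hq β, ⟨κ, D.isQuasiBanach ha hh hp hq β hκ⟩,
    fun hp1 hq1 => D.isQuasiBanach ha hh hp hq β
      (fun f g => by simpa using D.norm_add_le_of_one_le hp1 hq1 f g),
    fun hpt hqt f hf ε hε => D.exists_norm_sub_toSModP_lt ha hh hp hpt.ne hq hqt.ne β hf hε⟩
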